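/- Let $0<\lambda\le L<\infty$ and let $m\ge 2$ be an integer. Denote by $M(\lambda,L)$ the set of symmetric $2\times 2$ matrix fields $A$ on $\mathbb R^2$ with measurable coefficients such that $\lambda|\xi|^2\le A(x)\xi\cdot\xi\le L|\xi|^2$ for all $x,\xi\in\mathbb R^2$, and put $k^*_m=\frac m2\sqrt{\lambda/L}$. For $A\in M(\lambda,L)$, call $(u_1,\dots,u_m)$ admissible for $A$ if each $u_i\in H^1_{\mathrm{loc}}(\mathbb R^2)$ is nonnegative and continuous, satisfies $u_i(0)=0$ and $-\mathrm{div}(A\nabla u_i)\le 0$ weakly in $\mathbb R^2$, that is, $\int_{\mathbb R^2}A\nabla u_i\cdot\nabla\varphi\,dx\le 0$ for all nonnegative $\varphi\in C_c^\infty(\mathbb R^2)$, and if the sets $\{u_i>0\}$ are pairwise disjoint. (i) Let $A\in M(\lambda,L)$ and let $(u_1,\dots,u_m)$ be admissible for $A$. If for some $\gamma\in(0,k^*_m)$ there is $C>0$ with $u_i(x)\le C(1+|x|^\gamma)$ for all $x\in\mathbb R^2$ and $i=1,\dots,m$, then $u_j\equiv 0$ for some $j\in\{1,\dots,m\}$.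 (ii) The bound on $\gamma$ is sharp. Let $A$ be Meyers' matrix, $a_{ij}(x)=\lambda\delta_{ij}+(L-\lambda)\frac{x_ix_j}{|x|^2}$ for $x\ne0$ and $A(0)=\lambda I$. Then $A\in M(\lambda,L)$, and there is a family $(u_1,\dots,u_m)$ admissible for $A$ such that $u_i(x)\le|x|^{k^*_m}$ for all $x\in\mathbb R^2$ and all $i$, and no $u_i$ vanishes identically. -/

import Mathlib

open MeasureTheory
open scoped Matrix ContDiff

/-- The class `M(lam, L)`: symmetric matrix fields on `ℝⁿ` with (Lebesgue) measurable coefficients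
and `lam |ξ|² ≤ A(x) ξ · ξ ≤ L |ξ|²` for all `x` and `ξ`. Boundedness of the coefficients is a
consequence of symmetry and of the two bounds. -/
structure EllipticClass {n : ℕ} (lam L : ℝ)
    (A : EuclideanSpace ℝ (Fin n) → Matrix (Fin n) (Fin n) ℝ) : Prop where
  aemeasurable : ∀ i j, AEMeasurable (fun x => A x i j) volume
  symm : ∀ x, (A x).IsSymm
  lower : ∀ x ξ : EuclideanSpace ℝ (Fin n),
    lam * ‖ξ‖ ^ 2 ≤ inner ℝ (Matrix.toEuclideanLin (A x) ξ) ξ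
  upper : ∀ x ξ : EuclideanSpace ℝ (Fin n),
    inner ℝ (Matrix.toEuclideanLin (A x) ξ) ξ ≤ L * ‖ξ‖ ^ 2

/-- `f ∈ L²_loc(ℝⁿ)`, for a scalar or vector valued `f`. -/
def MemL2loc {n : ℕ} {F : Type*} [NormedAddCommGroup F]
    (f : EuclideanSpace ℝ (Fin n) → F) : Prop :=
  ∀ K : Set (EuclideanSpace ℝ (Fin n)), IsCompact K → MemLp f 2 (volume.restrict K)

/-- Test functions: `φ ∈ C_c^∞(ℝⁿ)`. -/
def IsTestFunction {n : ℕ} (φ : EuclideanSpace ℝ (Fin n) → ℝ) : Prop :=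
  ContDiff ℝ ∞ φ ∧ HasCompactSupport φ

/-- `u ∈ H¹_loc(ℝⁿ)` with weak gradient `G`: both lie in `L²_loc` and
`∫ u ∇φ = - ∫ φ G` for all `φ ∈ C_c^∞(ℝⁿ)`. -/
structure HasWeakGradient {n : ℕ} (u : EuclideanSpace ℝ (Fin n) → ℝ)
    (G : EuclideanSpace ℝ (Fin n) → EuclideanSpace ℝ (Fin n)) : Prop where
  memL2loc : MemL2loc u
  grad_memL2loc : MemL2loc G
  integral_eq : ∀ φ : EuclideanSpace ℝ (Fin n) → ℝ, IsTestFunction φ →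
    ∫ x, u x • gradient φ x = - ∫ x, φ x • G x

/-- `u ∈ H¹_loc(ℝⁿ)` and `-div(A ∇u) ≤ 0` weakly in `ℝⁿ`:
`∫ A ∇u · ∇φ ≤ 0` for all nonnegative `φ ∈ C_c^∞(ℝⁿ)`. The weak gradient is unique up to a null
set, so that it does not matter which one is used. -/
def IsH1locSubsolution {n : ℕ} (A : EuclideanSpace ℝ (Fin n) → Matrix (Fin n) (Fin n) ℝ)
    (u : EuclideanSpace ℝ (Fin n) → ℝ) : Prop :=
  ∃ G : EuclideanSpace ℝ (Fin n) → EuclideanSpace ℝ (Fin n), HasWeakGradient u G ∧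
    ∀ φ : EuclideanSpace ℝ (Fin n) → ℝ, IsTestFunction φ → (∀ x, 0 ≤ φ x) →
      ∫ x, inner ℝ (Matrix.toEuclideanLin (A x) (G x)) (gradient φ x) ≤ 0

/-- A family of nonnegative continuous `H¹_loc` subsolutions of `-div(A ∇u) ≤ 0` in `ℝⁿ` with
pairwise disjoint positivity sets, all vanishing at the origin. -/
structure IsSegregatedFamily {n m : ℕ}
    (A : EuclideanSpace ℝ (Fin n) → Matrix (Fin n) (Fin n) ℝ)
    (u : Fin m → EuclideanSpace ℝ (Fin n) → ℝ) : Prop where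
  nonneg : ∀ i x, 0 ≤ u i x
  continuous : ∀ i, Continuous (u i)
  subsolution : ∀ i, IsH1locSubsolution A (u i)
  disjoint : Pairwise fun i j => Disjoint {x | 0 < u i x} {x | 0 < u j x}
  zero : ∀ i, u i 0 = 0

/-- The exponent `k*_m = (m / 2) √(lam / L)`. -/
noncomputable def kStar (m : ℕ) (lam L : ℝ) : ℝ := (m : ℝ) / 2 * Real.sqrt (lam / L)

/-- The matrix of Meyers' example, `a_ij(x) = lam δ_ij + (L - lam) x_i x_j / |x|²` for `x ≠ 0`.
At `x = 0` the second term is zero and the matrix is `lam` times the identity. -/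
noncomputable def meyersMatrix (lam L : ℝ) (x : EuclideanSpace ℝ (Fin 2)) :
    Matrix (Fin 2) (Fin 2) ℝ :=
  Matrix.of fun i j => lam * (if i = j then 1 else 0) + (L - lam) * (x i * x j / ‖x‖ ^ 2)

/-!
For a nontrivial member `u` of the family, with weak gradient `G`, put
`D(r) = ∫_{|x| < r} A G · G` (`diskEnergy`), `E(r) = D'(r)` (`circleEnergy`) and let `F(r)` be the
flux of `u A G` through the circle of radius `r` (`circleFlux`). Everything rests on two inequalities
that hold for almost every `r`.

* `D ≤ F`: the equation tested with `u` times a cutoff that tends to the indicator of the disc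
  (`integral_mul_energy_le`, `IsPlanarSubsolution.ae_diskEnergy_le_circleFlux`). As `u` is not
  smooth, it is mollified in the test function; the `L²_loc` convergence of mollifications also shows
  that `u` is absolutely continuous on almost every circle (`HasWeakGradient.ae_sub_eq_integral`).
* `2 √(lam / L) (π / l) F ≤ r E`, where `l` is the angular length of `{u > 0}` on the circle
  (`IsPlanarSubsolution.ae_circleFlux_le_circleEnergy`). In the plane, ellipticity splits the energy
  density as `(A G · ν)² / L + lam (G · τ)² ≤ A G · G`, with `ν` and `τ` the unit normal and tangent
  (`EllipticClass.sq_div_add_le`). Young's inequality for `F` and Wirtinger's inequality with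
  constant `π / l` for the tangential derivative do the rest. The positivity set on a circle is an
  arbitrary open set, so the Wirtinger inequality `sq_pi_div_supportLength_mul_integral_sq_le` is
  proved without splitting it into arcs, with a phase that grows only where `u ≠ 0`.

The supports being disjoint, their angular lengths add up to at most `2π`, so that
`∑ π / l_i ≥ m² / 2` by Cauchy–Schwarz. Hence the derivative of `∑ log D_i` is at least
`2 m k* / r`, that is, `∏ D_i` grows at least like `R ^ (2 m k*)` when no member is trivial
(`mul_log_le_sum_log_diskEnergy`). On the other hand `F² ≤ c r ^ (2 γ + 1) E` when `u` grows at most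
like `|x| ^ γ`; together with `D ≤ F` this is a differential inequality for `1 / D` that gives
`D ≤ K R ^ (2 γ)` (`IsPlanarSubsolution.exists_diskEnergy_le_rpow`). The two growth rates are
incompatible for `γ < k*`.

For the sharpness, Meyers' matrix is `L` in the radial and `lam` in the angular direction, so that
`r ^ k cos (m / 2 (θ - α))` is a solution where `L k² = lam (m / 2)²`, that is, `k = k*`. Cut off to
its nodal sector `|θ - α| < π / m` it is a subsolution, by integration by parts in polar coordinates
(`integral_sector_eq`), and `m` such sectors fill the plane.
-/

/-! ### Mollification in `L²_loc` -/

section Mollification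

open Filter Topology Convolution ContinuousLinearMap
open scoped ENNReal

variable {n : ℕ} {F : Type*} [NormedAddCommGroup F] [NormedSpace ℝ F]

/-- The bump function around the origin of outer radius `1 / (k + 1)`. -/
noncomputable def mollifierBump (n k : ℕ) : ContDiffBump (0 : EuclideanSpace ℝ (Fin n)) where
  rIn := 1 / (2 * (k + 1))
  rOut := 1 / (k + 1)
  rIn_pos := by positivity
  rIn_lt_rOut := by
    have : (0 : ℝ) < k + 1 := by positivity
    gcongr
    linarith

/-- The mollification of `f` at scale `1 / (k + 1)`. -/
noncomputable def mollify (k : ℕ) (f : EuclideanSpace ℝ (Fin n) → F) :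
    EuclideanSpace ℝ (Fin n) → F :=
  (mollifierBump n k).normed volume ⋆[lsmul ℝ ℝ, volume] f

theorem mollifierBump_rOut_tendsto (n : ℕ) :
    Tendsto (fun k => (mollifierBump n k).rOut) atTop (𝓝 0) :=
  tendsto_one_div_add_atTop_nhds_zero_nat

theorem mollifierBump_rOut_le_one (n k : ℕ) : (mollifierBump n k).rOut ≤ 1 := by
  change (1 : ℝ) / (k + 1) ≤ 1
  rw [div_le_one (by positivity)]
  linarith [(Nat.cast_nonneg k : (0 : ℝ) ≤ k)]

theorem mollify_sub {f g : EuclideanSpace ℝ (Fin n) → F} (k : ℕ)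
    (hf : LocallyIntegrable f) (hg : LocallyIntegrable g) :
    mollify k (f - g) = mollify k f - mollify k g := by
  have hφ := (mollifierBump n k).hasCompactSupport_normed (μ := volume)
  have hc := (mollifierBump n k).continuous_normed (μ := volume)
  ext x
  have h1 := hφ.convolutionExists_left (L := lsmul ℝ ℝ) (μ := volume) hc hf x
  have h2 := hφ.convolutionExists_left (L := lsmul ℝ ℝ) (μ := volume) hc hg x
  simp only [mollify, convolution_def, Pi.sub_apply, map_sub]
  exact integral_sub h1 h2

/-- Mollification is a contraction of `L²`. -/
theorem eLpNorm_mollify_le (k : ℕ) {f : EuclideanSpace ℝ (Fin n) → F}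
    (hf : AEStronglyMeasurable f volume) :
    eLpNorm (mollify k f) 2 volume ≤ eLpNorm f 2 volume := by
  set ρ := (mollifierBump n k).normed volume with hρ
  have hρm : Measurable (fun t => ‖ρ t‖ₑ) :=
    ((mollifierBump n k).continuous_normed (μ := volume)).enorm.measurable
  have hρ1 : ∫⁻ t, ‖ρ t‖ₑ = 1 := by
    rw [← ofReal_integral_norm_eq_lintegral_enorm
      (mollifierBump n k).integrable_normed]
    simp only [Real.norm_eq_abs, abs_of_nonneg ((mollifierBump n k).nonneg_normed _)]
    rw [(mollifierBump n k).integral_normed]; simp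
  set ν : Measure (EuclideanSpace ℝ (Fin n)) := volume.withDensity (fun t => ‖ρ t‖ₑ) with hν
  have hprob : IsProbabilityMeasure ν := ⟨by simp [hν, hρ1]⟩
  have key : ∀ x, ‖mollify k f x‖ₑ ^ (2 : ℝ) ≤ ∫⁻ t, ‖ρ t‖ₑ * ‖f (x - t)‖ₑ ^ (2 : ℝ) := by
    intro x
    have hm : AEStronglyMeasurable (fun t => f (x - t)) volume :=
      hf.comp_quasiMeasurePreserving (quasiMeasurePreserving_sub_left_of_right_invariant volume x)
    have h1 : ‖mollify k f x‖ₑ ≤ eLpNorm (fun t => f (x - t)) 1 ν := by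
      rw [eLpNorm_one_eq_lintegral_enorm, hν,
        lintegral_withDensity_eq_lintegral_mul₀ hρm.aemeasurable hm.enorm]
      refine (enorm_integral_le_lintegral_enorm _).trans (le_of_eq ?_)
      congr 1; ext t
      simp [enorm_smul, hρ]
    have h2 : eLpNorm (fun t => f (x - t)) 1 ν ≤ eLpNorm (fun t => f (x - t)) 2 ν :=
      eLpNorm_le_eLpNorm_of_exponent_le one_le_two
        (hm.mono_ac (withDensity_absolutelyContinuous _ _))
    have h3 : eLpNorm (fun t => f (x - t)) 2 ν ^ (2 : ℝ)
        = ∫⁻ t, ‖ρ t‖ₑ * ‖f (x - t)‖ₑ ^ (2 : ℝ) := by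
      rw [eLpNorm_eq_lintegral_rpow_enorm_toReal two_ne_zero (by simp), ← ENNReal.rpow_mul, hν,
        lintegral_withDensity_eq_lintegral_mul₀ hρm.aemeasurable (hm.enorm.pow_const _)]
      simp
    rw [← h3]
    exact ENNReal.rpow_le_rpow (h1.trans h2) (by norm_num)
  rw [eLpNorm_eq_lintegral_rpow_enorm_toReal two_ne_zero (by simp),
    eLpNorm_eq_lintegral_rpow_enorm_toReal two_ne_zero (by simp)]
  refine ENNReal.rpow_le_rpow ?_ (by norm_num)
  simp only [ENNReal.toReal_ofNat]
  calc ∫⁻ x, ‖mollify k f x‖ₑ ^ (2 : ℝ)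
      ≤ ∫⁻ x, ∫⁻ t, ‖ρ t‖ₑ * ‖f (x - t)‖ₑ ^ (2 : ℝ) := lintegral_mono key
    _ = ∫⁻ t, ∫⁻ x, ‖ρ t‖ₑ * ‖f (x - t)‖ₑ ^ (2 : ℝ) := by
        refine lintegral_lintegral_swap ?_
        refine (hρm.comp measurable_snd).aemeasurable.mul ?_
        exact ((hf.comp_quasiMeasurePreserving
          (quasiMeasurePreserving_sub volume volume)).enorm.pow_const _)
    _ = ∫⁻ t, ‖ρ t‖ₑ * ∫⁻ x, ‖f x‖ₑ ^ (2 : ℝ) := by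
        congr 1; ext t
        rw [lintegral_const_mul' _ _ enorm_ne_top,
          lintegral_sub_right_eq_self (fun x => ‖f x‖ₑ ^ (2 : ℝ)) t]
    _ = ∫⁻ x, ‖f x‖ₑ ^ (2 : ℝ) := by
        rw [lintegral_mul_const'' _ hρm.aemeasurable, hρ1, one_mul]

theorem eLpNorm_mollify_sub_tendsto_of_continuous [CompleteSpace F]
    {g : EuclideanSpace ℝ (Fin n) → F} (hg : Continuous g) (hc : HasCompactSupport g) :
    Tendsto (fun k => eLpNorm (mollify k g - g) 2 volume) atTop (𝓝 0) := by
  obtain ⟨R, hR⟩ := hc.isCompact.isBounded.subset_closedBall (0 : EuclideanSpace ℝ (Fin n))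
  set V := volume (Metric.closedBall (0 : EuclideanSpace ℝ (Fin n)) (R + 1)) with hV
  have hVt : V ≠ ⊤ := (isCompact_closedBall _ _).measure_lt_top.ne
  have huc := hc.uniformContinuous_of_continuous hg
  have hzero : ∀ k x, x ∉ Metric.closedBall (0 : EuclideanSpace ℝ (Fin n)) (R + 1) →
      (mollify k g - g) x = 0 := by
    intro k x hx
    have hg0 : ∀ y ∈ Metric.ball x (mollifierBump n k).rOut, g y = 0 := by
      intro y hy
      by_contra h
      have hy' := hR (subset_tsupport _ h)
      apply hx
      rw [mem_closedBall_zero_iff] at hy' ⊢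
      have h1 := Metric.mem_ball.1 hy
      have h2 := mollifierBump_rOut_le_one n k
      rw [dist_comm, dist_eq_norm] at h1
      have h3 : ‖x‖ ≤ ‖x - y‖ + ‖y‖ := by simpa using norm_add_le (x - y) y
      linarith
    have hx0 := hg0 x (Metric.mem_ball_self (mollifierBump n k).rOut_pos)
    have : mollify k g x = g x := by
      apply (mollifierBump n k).normed_convolution_eq_right
      intro y hy
      rw [hg0 y hy, hx0]
    simp [this]
  rw [ENNReal.tendsto_atTop_zero]
  intro ε hε
  obtain ⟨δ, hδ, hδε⟩ : ∃ δ : ℝ, 0 < δ ∧ ENNReal.ofReal δ * V ^ (1 / (2 : ℝ)) ≤ ε := by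
    have : Tendsto (fun δ : ℝ => ENNReal.ofReal δ * V ^ (1 / (2 : ℝ))) (𝓝[>] 0) (𝓝 0) := by
      have h1 : Tendsto (fun δ : ℝ => ENNReal.ofReal δ) (𝓝[>] 0) (𝓝 0) := by
        have := (ENNReal.continuous_ofReal.tendsto 0).mono_left
          (nhdsWithin_le_nhds (s := Set.Ioi (0 : ℝ)))
        simpa using this
      simpa using ENNReal.Tendsto.mul_const h1
        (Or.inr (ENNReal.rpow_ne_top_of_nonneg (by norm_num) hVt))
    obtain ⟨δ, h1, h2⟩ := ((this.eventually (Iic_mem_nhds hε)).and self_mem_nhdsWithin).exists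
    exact ⟨δ, h2, h1⟩
  obtain ⟨η, hη, hηδ⟩ := Metric.uniformContinuous_iff.1 huc δ hδ
  obtain ⟨N, hN⟩ := eventually_atTop.1
    ((mollifierBump_rOut_tendsto n).eventually (gt_mem_nhds hη))
  refine ⟨N, fun k hk => ?_⟩
  have hbd : ∀ x, ‖(mollify k g - g) x‖ ≤ δ := by
    intro x
    rw [Pi.sub_apply, ← dist_eq_norm]
    refine (mollifierBump n k).dist_normed_convolution_le hg.aestronglyMeasurable fun y hy => ?_
    exact (hηδ ((Metric.mem_ball.1 hy).trans (hN k hk))).le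
  calc eLpNorm (mollify k g - g) 2 volume
      = eLpNorm ((Metric.closedBall 0 (R + 1)).indicator (mollify k g - g)) 2 volume := by
        congr 1; ext x
        by_cases hx : x ∈ Metric.closedBall (0 : EuclideanSpace ℝ (Fin n)) (R + 1)
        · rw [Set.indicator_of_mem hx]
        · rw [Set.indicator_of_notMem hx, hzero k x hx]
    _ = eLpNorm (mollify k g - g) 2 (volume.restrict (Metric.closedBall 0 (R + 1))) :=
        eLpNorm_indicator_eq_eLpNorm_restrict measurableSet_closedBall
    _ ≤ _ := eLpNorm_le_of_ae_bound (Eventually.of_forall hbd)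
    _ ≤ ε := by
        refine le_trans (le_of_eq ?_) hδε
        rw [Measure.restrict_apply_univ, mul_comm]
        simp [hV]

/-- Mollifications of an `L²` function converge to it in `L²`. -/
theorem eLpNorm_mollify_sub_tendsto [CompleteSpace F] {f : EuclideanSpace ℝ (Fin n) → F}
    (hf : MemLp f 2 volume) :
    Tendsto (fun k => eLpNorm (mollify k f - f) 2 volume) atTop (𝓝 0) := by
  rw [ENNReal.tendsto_atTop_zero]
  intro ε hε
  have hε3 : ε / 3 ≠ 0 := (ENNReal.div_pos hε.ne' (by simp)).ne'
  obtain ⟨g, hgc, hfg, hgcont, hgm⟩ :=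
    hf.exists_hasCompactSupport_eLpNorm_sub_le (by simp) hε3
  obtain ⟨N, hN⟩ := (ENNReal.tendsto_atTop_zero.1
    (eLpNorm_mollify_sub_tendsto_of_continuous hgcont hgc)) (ε / 3) (by positivity)
  refine ⟨N, fun k hk => ?_⟩
  have hfl : LocallyIntegrable f := hf.locallyIntegrable one_le_two
  have hgl : LocallyIntegrable g := hgm.locallyIntegrable one_le_two
  have hmf : Continuous (mollify k f) :=
    ((mollifierBump n k).hasCompactSupport_normed).continuous_convolution_left _
      (mollifierBump n k).continuous_normed hfl
  have hmg : Continuous (mollify k g) :=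
    ((mollifierBump n k).hasCompactSupport_normed).continuous_convolution_left _
      (mollifierBump n k).continuous_normed hgl
  have hdec : mollify k f - f = mollify k (f - g) + ((mollify k g - g) + (g - f)) := by
    rw [mollify_sub k hfl hgl]; abel
  have hA : AEStronglyMeasurable (mollify k (f - g)) volume := by
    rw [mollify_sub k hfl hgl]
    exact (hmf.sub hmg).aestronglyMeasurable
  have hB : AEStronglyMeasurable (mollify k g - g) volume := (hmg.sub hgcont).aestronglyMeasurable
  have hC : AEStronglyMeasurable (g - f) volume := hgm.1.sub hf.1
  calc eLpNorm (mollify k f - f) 2 volume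
      ≤ eLpNorm (mollify k (f - g)) 2 volume
        + (eLpNorm (mollify k g - g) 2 volume + eLpNorm (g - f) 2 volume) := by
        rw [hdec]
        refine (eLpNorm_add_le hA (hB.add hC) one_le_two).trans ?_
        gcongr
        exact eLpNorm_add_le hB hC one_le_two
    _ ≤ ε / 3 + (ε / 3 + ε / 3) := by
        gcongr
        · exact (eLpNorm_mollify_le k (hf.1.sub hgm.1)).trans hfg
        · exact hN k hk
        · rw [eLpNorm_sub_comm]; exact hfg
    _ = ε := by rw [← add_assoc]; exact ENNReal.add_thirds ε

theorem mollify_congr_of_eqOn {f g : EuclideanSpace ℝ (Fin n) → F} {k : ℕ} {R : ℝ}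
    (h : Set.EqOn f g (Metric.closedBall 0 (R + 1))) :
    Set.EqOn (mollify k f) (mollify k g) (Metric.closedBall 0 R) := by
  intro x hx
  simp only [mollify, convolution_def]
  congr 1; ext t
  by_cases ht : t ∈ Metric.ball (0 : EuclideanSpace ℝ (Fin n)) (mollifierBump n k).rOut
  · rw [h]
    rw [mem_closedBall_zero_iff] at hx ⊢
    rw [mem_ball_zero_iff] at ht
    have h2 := mollifierBump_rOut_le_one n k
    have h3 := norm_sub_le x t
    linarith
  · rw [← (mollifierBump n k).support_normed_eq (μ := volume), Function.notMem_support] at ht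
    simp [ht]

/-- Mollifications of an `L²_loc` function converge to it in `L²` of every ball. -/
theorem MemL2loc.eLpNorm_mollify_sub_tendsto [CompleteSpace F] {f : EuclideanSpace ℝ (Fin n) → F}
    (hf : MemL2loc f) (R : ℝ) :
    Tendsto (fun k => eLpNorm (mollify k f - f) 2
      (volume.restrict (Metric.closedBall 0 R))) atTop (𝓝 0) := by
  set g := (Metric.closedBall (0 : EuclideanSpace ℝ (Fin n)) (R + 1)).indicator f with hg
  have hfg : Set.EqOn f g (Metric.closedBall 0 (R + 1)) := fun x hx => by
    rw [hg, Set.indicator_of_mem hx]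
  have hgL : MemLp g 2 volume :=
    (memLp_indicator_iff_restrict measurableSet_closedBall).2 (hf _ (isCompact_closedBall _ _))
  refine tendsto_of_tendsto_of_tendsto_of_le_of_le tendsto_const_nhds
    (_root_.eLpNorm_mollify_sub_tendsto hgL) (fun _ => zero_le) fun k => ?_
  calc eLpNorm (mollify k f - f) 2 (volume.restrict (Metric.closedBall 0 R))
      = eLpNorm (mollify k g - g) 2 (volume.restrict (Metric.closedBall 0 R)) := by
        refine eLpNorm_congr_ae ?_
        filter_upwards [ae_restrict_mem measurableSet_closedBall] with x hx
        rw [Pi.sub_apply, Pi.sub_apply, mollify_congr_of_eqOn hfg hx,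
          hfg (Metric.closedBall_subset_closedBall (by linarith) hx)]
    _ ≤ eLpNorm (mollify k g - g) 2 volume := eLpNorm_mono_measure _ Measure.restrict_le_self

theorem MemL2loc.locallyIntegrable {F : Type*} [NormedAddCommGroup F]
    {f : EuclideanSpace ℝ (Fin n) → F} (hf : MemL2loc f) :
    LocallyIntegrable f := by
  rw [locallyIntegrable_iff]
  intro K hK
  have : IsFiniteMeasure (volume.restrict K) := ⟨by simpa using hK.measure_lt_top⟩
  exact (hf K hK).integrable one_le_two

theorem contDiff_mollify {f : EuclideanSpace ℝ (Fin n) → F} (hf : LocallyIntegrable f) (k : ℕ) :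
    ContDiff ℝ ∞ (mollify k f) :=
  ((mollifierBump n k).hasCompactSupport_normed).contDiff_convolution_left _
    (mollifierBump n k).contDiff_normed hf

theorem mollify_nonneg {f : EuclideanSpace ℝ (Fin n) → ℝ} (hf : ∀ x, 0 ≤ f x) (k : ℕ) (x) :
    0 ≤ mollify k f x :=
  integral_nonneg fun t => mul_nonneg ((mollifierBump n k).nonneg_normed t) (hf _)

theorem mollify_tendsto [CompleteSpace F] {f : EuclideanSpace ℝ (Fin n) → F}
    (hf : Continuous f) (x) :
    Tendsto (fun k => mollify k f x) atTop (𝓝 (f x)) :=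
  ContDiffBump.convolution_tendsto_right_of_continuous (mollifierBump_rOut_tendsto n) hf x

theorem norm_mollify_le {f : EuclideanSpace ℝ (Fin n) → F} {R M : ℝ}
    (hM : ∀ x ∈ Metric.closedBall (0 : EuclideanSpace ℝ (Fin n)) (R + 1), ‖f x‖ ≤ M) (k : ℕ)
    {x : EuclideanSpace ℝ (Fin n)} (hx : x ∈ Metric.closedBall 0 R) :
    ‖mollify k f x‖ ≤ M := by
  have h0 : 0 ≤ M := (norm_nonneg _).trans
    (hM x (Metric.closedBall_subset_closedBall (by linarith) hx))
  calc ‖mollify k f x‖ ≤ ∫ t, (mollifierBump n k).normed volume t * M := by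
        refine norm_integral_le_of_norm_le
          ((mollifierBump n k).integrable_normed.mul_const M) (Eventually.of_forall fun t => ?_)
        by_cases ht : t ∈ Metric.ball (0 : EuclideanSpace ℝ (Fin n)) (mollifierBump n k).rOut
        · simp only [lsmul_apply, norm_smul, Real.norm_eq_abs,
            abs_of_nonneg ((mollifierBump n k).nonneg_normed t)]
          refine mul_le_mul_of_nonneg_left (hM _ ?_) ((mollifierBump n k).nonneg_normed t)
          rw [mem_closedBall_zero_iff] at hx ⊢
          rw [mem_ball_zero_iff] at ht
          have h2 := mollifierBump_rOut_le_one n k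
          have h3 := norm_sub_le x t
          linarith
        · rw [← (mollifierBump n k).support_normed_eq (μ := volume),
            Function.notMem_support] at ht
          simp [ht]
    _ = M := by rw [integral_mul_const, (mollifierBump n k).integral_normed, one_mul]

theorem ContDiff.continuous_gradient {φ : EuclideanSpace ℝ (Fin n) → ℝ} (hφ : ContDiff ℝ 1 φ) :
    Continuous (gradient φ) :=
  (InnerProductSpace.toDual ℝ _).symm.continuous.comp (hφ.continuous_fderiv one_ne_zero)

/-- The gradient of the mollification is the mollification of the weak gradient. -/
theorem HasWeakGradient.hasGradientAt_mollify {u : EuclideanSpace ℝ (Fin n) → ℝ}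
    {G : EuclideanSpace ℝ (Fin n) → EuclideanSpace ℝ (Fin n)} (h : HasWeakGradient u G) (k : ℕ)
    (x : EuclideanSpace ℝ (Fin n)) : HasGradientAt (mollify k u) (mollify k G x) x := by
  set ρ := (mollifierBump n k).normed volume with hρ
  have hρs : ContDiff ℝ ∞ ρ := (mollifierBump n k).contDiff_normed
  have hρc : HasCompactSupport ρ := (mollifierBump n k).hasCompactSupport_normed
  have hu := h.memL2loc.locallyIntegrable
  have hd := hρc.hasFDerivAt_convolution_left (lsmul ℝ ℝ) (hρs.of_le (by simp)) hu x
  suffices hk : (InnerProductSpace.toDual ℝ _) (mollify k G x) =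
      (fderiv ℝ ρ ⋆[(lsmul ℝ ℝ).precompL (EuclideanSpace ℝ (Fin n)), volume] u) x by
    rw [hasGradientAt_iff_hasFDerivAt, hk]
    exact hd
  set φ : EuclideanSpace ℝ (Fin n) → ℝ := fun y => ρ (x - y) with hφ
  have hφt : IsTestFunction φ :=
    ⟨hρs.comp (contDiff_const.sub contDiff_id), hρc.comp_homeomorph (Homeomorph.subLeft x)⟩
  have hgrad : ∀ y, HasGradientAt φ (-(gradient ρ (x - y))) y := by
    intro y
    have h1 : HasFDerivAt ρ (fderiv ℝ ρ (x - y)) (x - y) :=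
      (hρs.differentiable (by simp)).differentiableAt.hasFDerivAt
    have h2 := h1.comp y ((hasFDerivAt_id y).const_sub x)
    have h3 : (InnerProductSpace.toDual ℝ (EuclideanSpace ℝ (Fin n))) (-gradient ρ (x - y)) =
        (fderiv ℝ ρ (x - y)).comp (-ContinuousLinearMap.id ℝ (EuclideanSpace ℝ (Fin n))) := by
      ext v
      simp [gradient]
    rw [hasGradientAt_iff_hasFDerivAt, h3]
    exact h2
  have hint := h.integral_eq φ hφt
  have hG : mollify k G x = ∫ y, u y • gradient ρ (x - y) := by
    have : mollify k G x = ∫ y, φ y • G y := by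
      rw [mollify, convolution_eq_swap]; rfl
    rw [this, ← neg_eq_iff_eq_neg.2 hint, ← integral_neg]
    congr 1; ext1 y
    rw [(hgrad y).gradient, smul_neg, neg_neg]
  rw [hG, convolution_eq_swap]
  have hi : Integrable (fun y => u y • gradient ρ (x - y)) := by
    have hc : HasCompactSupport (fun y => gradient ρ (x - y)) := by
      have : HasCompactSupport (gradient ρ) := by
        refine (hρc.fderiv ℝ).comp_left (g := fun L => (InnerProductSpace.toDual ℝ _).symm L) ?_
        simp
      exact this.comp_homeomorph (Homeomorph.subLeft x)
    have hcont : Continuous (fun y => gradient ρ (x - y)) :=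
      (hρs.of_le (by simp) : ContDiff ℝ 1 ρ).continuous_gradient.comp
        (continuous_const.sub continuous_id)
    exact hu.integrable_smul_right_of_hasCompactSupport hcont hc
  rw [← LinearIsometryEquiv.coe_toContinuousLinearEquiv,
    ← ContinuousLinearEquiv.integral_comp_comm]
  congr 1; ext y v
  simp [gradient, mul_comm]

end Mollification

/-! ### Ellipticity and the energy inequality -/

section Ellipticity

variable {n : ℕ} {lam L : ℝ} {A : EuclideanSpace ℝ (Fin n) → Matrix (Fin n) (Fin n) ℝ}

theorem EllipticClass.inner_comm (hA : EllipticClass lam L A) (x ξ η : EuclideanSpace ℝ (Fin n)) :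
    inner ℝ (Matrix.toEuclideanLin (A x) ξ) η = inner ℝ (Matrix.toEuclideanLin (A x) η) ξ := by
  have h : (A x).IsHermitian := by
    rw [Matrix.IsHermitian, Matrix.conjTranspose_eq_transpose_of_trivial]
    exact hA.symm x
  rw [Matrix.isSymmetric_toEuclideanLin_iff.2 h ξ η, real_inner_comm]

theorem EllipticClass.inner_self_nonneg (hA : EllipticClass lam L A) (hlam : 0 ≤ lam)
    (x ξ : EuclideanSpace ℝ (Fin n)) : 0 ≤ inner ℝ (Matrix.toEuclideanLin (A x) ξ) ξ :=
  le_trans (by positivity) (hA.lower x ξ)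

/-- The Cauchy–Schwarz inequality for the quadratic form of `A x`. -/
theorem EllipticClass.sq_inner_le (hA : EllipticClass lam L A) (hlam : 0 ≤ lam)
    (x ξ η : EuclideanSpace ℝ (Fin n)) :
    inner ℝ (Matrix.toEuclideanLin (A x) ξ) η ^ 2 ≤
      inner ℝ (Matrix.toEuclideanLin (A x) ξ) ξ * inner ℝ (Matrix.toEuclideanLin (A x) η) η := by
  have h : ∀ t : ℝ, 0 ≤ inner ℝ (Matrix.toEuclideanLin (A x) η) η * (t * t) +
      (2 * inner ℝ (Matrix.toEuclideanLin (A x) ξ) η) * t +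
      inner ℝ (Matrix.toEuclideanLin (A x) ξ) ξ := by
    intro t
    have := hA.inner_self_nonneg hlam x (ξ + t • η)
    simp only [map_add, map_smul, inner_add_left, inner_add_right, inner_smul_left,
      inner_smul_right, hA.inner_comm x η ξ] at this
    simp only [conj_trivial] at this
    linarith
  have := discrim_le_zero h
  rw [discrim] at this
  linarith

theorem EllipticClass.norm_le (hA : EllipticClass lam L A) (hlam : 0 ≤ lam) (hL : 0 ≤ L)
    (x ξ : EuclideanSpace ℝ (Fin n)) : ‖Matrix.toEuclideanLin (A x) ξ‖ ≤ L * ‖ξ‖ := by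
  set v := Matrix.toEuclideanLin (A x) ξ with hv
  rcases eq_or_ne v 0 with h0 | h0
  · rw [h0, norm_zero]; positivity
  have h1 := hA.sq_inner_le hlam x ξ v
  rw [← hv, real_inner_self_eq_norm_sq] at h1
  have h2 := hA.upper x ξ
  have h3 := hA.upper x v
  have hpos : 0 < ‖v‖ ^ 2 := by positivity
  have h4 : (‖v‖ ^ 2) ^ 2 ≤ (L * ‖ξ‖ ^ 2) * (L * ‖v‖ ^ 2) :=
    h1.trans (mul_le_mul h2 h3 (hA.inner_self_nonneg hlam x v) (by positivity))
  have h5 : ‖v‖ ^ 2 ≤ (L * ‖ξ‖) ^ 2 := by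
    refine le_of_mul_le_mul_right ?_ hpos
    calc ‖v‖ ^ 2 * ‖v‖ ^ 2 = (‖v‖ ^ 2) ^ 2 := by ring
      _ ≤ _ := h4
      _ = _ := by ring
  exact (abs_le_of_sq_le_sq' h5 (by positivity)).2

theorem EllipticClass.aestronglyMeasurable (hA : EllipticClass lam L A)
    {G : EuclideanSpace ℝ (Fin n) → EuclideanSpace ℝ (Fin n)}
    (hG : AEStronglyMeasurable G volume) :
    AEStronglyMeasurable (fun x => Matrix.toEuclideanLin (A x) (G x)) volume := by
  have h : AEMeasurable (fun x => (A x) *ᵥ (G x).ofLp) volume := by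
    rw [aemeasurable_pi_iff]
    intro i
    simp only [Matrix.mulVec, dotProduct]
    refine Finset.aemeasurable_fun_sum _ fun j _ => (hA.aemeasurable i j).mul ?_
    exact ((EuclideanSpace.proj (𝕜 := ℝ) j).continuous.measurable).comp_aemeasurable
      hG.aemeasurable
  exact ((PiLp.continuous_toLp 2 _).measurable.comp_aemeasurable h).aestronglyMeasurable

theorem MemL2loc.aestronglyMeasurable {F : Type*} [NormedAddCommGroup F]
    {f : EuclideanSpace ℝ (Fin n) → F} (hf : MemL2loc f) : AEStronglyMeasurable f volume := by
  have h : ∀ k : ℕ, AEStronglyMeasurable f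
      (volume.restrict (Metric.closedBall (0 : EuclideanSpace ℝ (Fin n)) k)) :=
    fun k => (hf _ (isCompact_closedBall _ _)).1
  have := aestronglyMeasurable_iUnion_iff.2 h
  rwa [Metric.iUnion_closedBall_nat, Measure.restrict_univ] at this

theorem EllipticClass.memL2loc (hA : EllipticClass lam L A) (hlam : 0 ≤ lam) (hL : 0 ≤ L)
    {G : EuclideanSpace ℝ (Fin n) → EuclideanSpace ℝ (Fin n)} (hG : MemL2loc G) :
    MemL2loc (fun x => Matrix.toEuclideanLin (A x) (G x)) := fun K hK =>
  (hG K hK).of_le_mul (hA.aestronglyMeasurable hG.aestronglyMeasurable).restrict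
    (Filter.Eventually.of_forall fun x => hA.norm_le hlam hL x (G x))

end Ellipticity

section Energy

open Filter Topology

variable {n : ℕ} {lam L : ℝ} {A : EuclideanSpace ℝ (Fin n) → Matrix (Fin n) (Fin n) ℝ}
  {u : EuclideanSpace ℝ (Fin n) → ℝ} {G : EuclideanSpace ℝ (Fin n) → EuclideanSpace ℝ (Fin n)}

theorem MeasureTheory.MemLp.integrable_inner {α E : Type*} [MeasurableSpace α]
    [NormedAddCommGroup E] [InnerProductSpace ℝ E] {μ : Measure α} {f g : α → E}
    (hf : MemLp f 2 μ) (hg : MemLp g 2 μ) : Integrable (fun x => inner ℝ (f x) (g x)) μ := by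
  refine (L2.integrable_inner (𝕜 := ℝ) (hf.toLp f) (hg.toLp g)).congr ?_
  filter_upwards [hf.coeFn_toLp, hg.coeFn_toLp] with x h1 h2
  rw [h1, h2]

theorem tendsto_integral_inner {α E : Type*} [MeasurableSpace α] [NormedAddCommGroup E]
    [InnerProductSpace ℝ E] {μ : Measure α} {H f : α → E} {g : ℕ → α → E} (hH : MemLp H 2 μ)
    (hf : MemLp f 2 μ) (hg : ∀ k, MemLp (g k) 2 μ)
    (h : Tendsto (fun k => eLpNorm (g k - f) 2 μ) atTop (𝓝 0)) :
    Tendsto (fun k => ∫ x, inner ℝ (H x) (g k x) ∂μ) atTop (𝓝 (∫ x, inner ℝ (H x) (f x) ∂μ)) := by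
  have hi : ∀ {v : α → E} (hv : MemLp v 2 μ),
      ∫ x, inner ℝ (H x) (v x) ∂μ = inner ℝ (hH.toLp H) (hv.toLp v) := by
    intro v hv
    rw [L2.inner_def]
    refine integral_congr_ae ?_
    filter_upwards [hH.coeFn_toLp, hv.coeFn_toLp] with x h1 h2
    rw [h1, h2]
  rw [hi hf]
  simp_rw [fun k => hi (hg k)]
  exact tendsto_const_nhds.inner ((Lp.tendsto_Lp_iff_tendsto_eLpNorm'' g hg f hf).2 h)

/-- The Caccioppoli-type inequality obtained by testing the equation of a nonnegative continuous
subsolution `u` with `η u`. That function is not smooth; it is replaced by the product of `η` and a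
mollification of `u`. -/
theorem integral_mul_energy_le (hA : EllipticClass lam L A) (hlam : 0 ≤ lam) (hL : 0 ≤ L)
    (hw : HasWeakGradient u G) (hu : Continuous u) (hu0 : ∀ x, 0 ≤ u x)
    (hsub : ∀ φ : EuclideanSpace ℝ (Fin n) → ℝ, IsTestFunction φ → (∀ x, 0 ≤ φ x) →
      ∫ x, inner ℝ (Matrix.toEuclideanLin (A x) (G x)) (gradient φ x) ≤ 0)
    {η : EuclideanSpace ℝ (Fin n) → ℝ} (hη : IsTestFunction η) (hη0 : ∀ x, 0 ≤ η x) :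
    ∫ x, η x * inner ℝ (Matrix.toEuclideanLin (A x) (G x)) (G x) ≤
      -∫ x, u x * inner ℝ (Matrix.toEuclideanLin (A x) (G x)) (gradient η x) := by
  set H := fun x => Matrix.toEuclideanLin (A x) (G x) with hH
  have hH2 : MemL2loc H := hA.memL2loc hlam hL hw.grad_memL2loc
  obtain ⟨R, hR⟩ := hη.2.isCompact.isBounded.subset_closedBall (0 : EuclideanSpace ℝ (Fin n))
  set B := Metric.closedBall (0 : EuclideanSpace ℝ (Fin n)) R with hB
  have hBc : IsCompact B := isCompact_closedBall _ _
  have hfin : IsFiniteMeasure (volume.restrict B) := ⟨by simpa using hBc.measure_lt_top⟩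
  have hηd : ∀ x, HasGradientAt η (gradient η x) x := fun x =>
    (hη.1.differentiable (by simp)).differentiableAt.hasGradientAt
  have hηg : Continuous (gradient η) := (hη.1.of_le (by simp)).continuous_gradient
  have hη_out : ∀ x, x ∉ B → η x = 0 := fun x hx => by
    by_contra h
    exact hx (hR (subset_tsupport _ h))
  have hg_out : ∀ x, x ∉ B → gradient η x = 0 := fun x hx => by
    have : fderiv ℝ η x = 0 := by
      by_contra h
      exact hx (hR (support_fderiv_subset ℝ h))
    simp [gradient, this]
  obtain ⟨Mη, hMη⟩ := hBc.exists_bound_of_continuousOn hη.1.continuous.continuousOn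
  obtain ⟨Mg, hMg⟩ := hBc.exists_bound_of_continuousOn hηg.continuousOn
  obtain ⟨Mu, hMu⟩ := (isCompact_closedBall (0 : EuclideanSpace ℝ (Fin n)) (R + 1)
    ).exists_bound_of_continuousOn hu.continuousOn
  have hul := hw.memL2loc.locallyIntegrable
  have hGl := hw.grad_memL2loc.locallyIntegrable
  have hηH : MemLp (fun x => η x • H x) 2 (volume.restrict B) := by
    refine (hH2 B hBc).of_le_mul (c := Mη)
      (hη.1.continuous.aestronglyMeasurable.smul (hH2 B hBc).1) ?_
    filter_upwards [ae_restrict_mem measurableSet_closedBall] with x hx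
    rw [norm_smul]
    exact mul_le_mul_of_nonneg_right (hMη x hx) (norm_nonneg _)
  have hHi : Integrable H (volume.restrict B) := (hH2 B hBc).integrable one_le_two
  have hdom : Integrable (fun x => Mu * (‖H x‖ * Mg)) (volume.restrict B) :=
    (hHi.norm.mul_const Mg).const_mul Mu
  have hGk : ∀ k, MemLp (mollify k G) 2 (volume.restrict B) := fun k => by
    obtain ⟨M, hM⟩ := hBc.exists_bound_of_continuousOn
      (contDiff_mollify hGl k).continuous.continuousOn
    refine MemLp.of_bound (contDiff_mollify hGl k).continuous.aestronglyMeasurable M ?_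
    filter_upwards [ae_restrict_mem measurableSet_closedBall] with x hx using hM x hx
  have huk : ∀ k, ∀ x ∈ B, ‖mollify k u x‖ ≤ Mu := fun k x hx => norm_mollify_le hMu k hx
  have hmeas2 : ∀ {v : EuclideanSpace ℝ (Fin n) → ℝ}, Continuous v →
      AEStronglyMeasurable (fun x => v x * inner ℝ (H x) (gradient η x)) (volume.restrict B) :=
    fun hv => hv.aestronglyMeasurable.mul (hHi.1.inner hηg.aestronglyMeasurable)
  have hbound2 : ∀ {v : EuclideanSpace ℝ (Fin n) → ℝ}, (∀ x ∈ B, ‖v x‖ ≤ Mu) →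
      ∀ᵐ x ∂volume.restrict B, ‖v x * inner ℝ (H x) (gradient η x)‖ ≤ Mu * (‖H x‖ * Mg) := by
    intro v hv
    filter_upwards [ae_restrict_mem measurableSet_closedBall] with x hx
    rw [norm_mul]
    have h1 := norm_inner_le_norm (𝕜 := ℝ) (H x) (gradient η x)
    have h2 := hMg x hx
    exact mul_le_mul (hv x hx) (h1.trans (by gcongr)) (norm_nonneg _)
      ((norm_nonneg _).trans (hv x hx))
  -- pass to the limit in the two terms of the equation tested with `η` times a mollification of `u`
  have ht1 := tendsto_integral_inner hηH (hw.grad_memL2loc B hBc) hGk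
    (hw.grad_memL2loc.eLpNorm_mollify_sub_tendsto R)
  have ht2 : Tendsto (fun k => ∫ x in B, mollify k u x * inner ℝ (H x) (gradient η x)) atTop
      (𝓝 (∫ x in B, u x * inner ℝ (H x) (gradient η x))) :=
    tendsto_integral_of_dominated_convergence _
      (fun k => hmeas2 (contDiff_mollify hul k).continuous) hdom (fun k => hbound2 (huk k))
      (Eventually.of_forall fun x => (mollify_tendsto hu x).mul_const _)
  have hle : ∀ k, (∫ x in B, inner ℝ (η x • H x) (mollify k G x)) +
      ∫ x in B, mollify k u x * inner ℝ (H x) (gradient η x) ≤ 0 := by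
    intro k
    set φ : EuclideanSpace ℝ (Fin n) → ℝ := fun x => η x * mollify k u x with hφ
    have hφt : IsTestFunction φ := ⟨hη.1.mul (contDiff_mollify hul k), hη.2.mul_right⟩
    have hφg : ∀ x, gradient φ x = η x • mollify k G x + mollify k u x • gradient η x := by
      intro x
      have h1 := (hηd x).hasFDerivAt.mul (hw.hasGradientAt_mollify k x).hasFDerivAt
      refine HasGradientAt.gradient ?_
      rw [hasGradientAt_iff_hasFDerivAt]
      rw [map_add, map_smul, map_smul]
      exact h1
    have h0 := hsub φ hφt fun x => mul_nonneg (hη0 x) (mollify_nonneg hu0 k x)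
    rw [← integral_add]
    · refine le_trans (le_of_eq ?_) h0
      rw [← setIntegral_eq_integral_of_forall_compl_eq_zero (s := B) (μ := volume)
        (f := fun x => inner ℝ (Matrix.toEuclideanLin (A x) (G x)) (gradient φ x))]
      · refine integral_congr_ae (Eventually.of_forall fun x => ?_)
        simp only [hφg, inner_add_right, inner_smul_left, inner_smul_right, conj_trivial, hH]
      · intro x hx
        rw [hφg, hη_out x hx, hg_out x hx, zero_smul, smul_zero, add_zero, inner_zero_right]
    · exact hηH.integrable_inner (hGk k)
    · exact hdom.mono' (hmeas2 (contDiff_mollify hul k).continuous) (hbound2 (huk k))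
  have hlim := le_of_tendsto (ht1.add ht2) (Eventually.of_forall hle)
  have e1 : ∫ x, η x * inner ℝ (H x) (G x) = ∫ x in B, inner ℝ (η x • H x) (G x) := by
    rw [← setIntegral_eq_integral_of_forall_compl_eq_zero (s := B)]
    · simp [inner_smul_left]
    · intro x hx; simp [hη_out x hx]
  have e2 : ∫ x, u x * inner ℝ (H x) (gradient η x) =
      ∫ x in B, u x * inner ℝ (H x) (gradient η x) := by
    rw [← setIntegral_eq_integral_of_forall_compl_eq_zero (s := B)]
    intro x hx; simp [hg_out x hx]
  rw [e1, e2]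
  linarith

theorem HasWeakGradient.eq_of_ae_eq_zero (hw : HasWeakGradient u G) (hu : Continuous u)
    (hG : G =ᵐ[volume] 0) (x y : EuclideanSpace ℝ (Fin n)) : u x = u y := by
  have h : ∀ k, mollify k u x = mollify k u y := by
    intro k
    refine is_const_of_fderiv_eq_zero (𝕜 := ℝ)
      ((contDiff_mollify hw.memL2loc.locallyIntegrable k).differentiable (by simp))
      (fun z => ?_) x y
    have hz : mollify k G z = 0 := by
      rw [mollify, convolution_eq_swap]
      refine integral_eq_zero_of_ae ?_
      filter_upwards [hG] with t ht
      simp [ht]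
    have := (hw.hasGradientAt_mollify k z).hasFDerivAt.fderiv
    rw [this, hz, map_zero]
  exact tendsto_nhds_unique ((mollify_tendsto hu x).congr h) (mollify_tendsto hu y)

end Energy

/-! ### Polar coordinates -/

section Polar

open Filter Topology Set
open scoped ENNReal

/-- The point of the plane with polar coordinates `(r, θ)`. -/
noncomputable def polarPoint (r θ : ℝ) : EuclideanSpace ℝ (Fin 2) :=
  !₂[r * Real.cos θ, r * Real.sin θ]

/-- The unit vector of angle `θ`, the direction in which the radius grows. -/
noncomputable def radialDir (θ : ℝ) : EuclideanSpace ℝ (Fin 2) := !₂[Real.cos θ, Real.sin θ]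

/-- The unit vector orthogonal to `radialDir θ`, the direction in which the angle grows. -/
noncomputable def angularDir (θ : ℝ) : EuclideanSpace ℝ (Fin 2) := !₂[-Real.sin θ, Real.cos θ]

theorem polarPoint_eq_smul (r θ : ℝ) : polarPoint r θ = r • radialDir θ := by
  ext i; fin_cases i <;> simp [polarPoint, radialDir]

theorem inner_radialDir_self (θ : ℝ) : inner ℝ (radialDir θ) (radialDir θ) = 1 := by
  simp only [radialDir, PiLp.inner_apply, Fin.sum_univ_two]
  simp only [Matrix.cons_val_zero, Matrix.cons_val_one, Matrix.cons_val_fin_one,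
    RCLike.inner_apply, conj_trivial]
  linarith [Real.sin_sq_add_cos_sq θ]

theorem inner_angularDir_self (θ : ℝ) : inner ℝ (angularDir θ) (angularDir θ) = 1 := by
  simp only [angularDir, PiLp.inner_apply, Fin.sum_univ_two]
  simp only [Matrix.cons_val_zero, Matrix.cons_val_one, Matrix.cons_val_fin_one,
    RCLike.inner_apply, conj_trivial]
  linarith [Real.sin_sq_add_cos_sq θ]

theorem inner_radialDir_angularDir (θ : ℝ) : inner ℝ (radialDir θ) (angularDir θ) = 0 := by
  simp [angularDir, radialDir, PiLp.inner_apply, Fin.sum_univ_two]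
  ring

theorem norm_radialDir (θ : ℝ) : ‖radialDir θ‖ = 1 := by
  have := inner_radialDir_self θ
  rw [real_inner_self_eq_norm_sq] at this
  exact (pow_eq_one_iff_of_nonneg (norm_nonneg _) two_ne_zero).1 this

theorem norm_angularDir (θ : ℝ) : ‖angularDir θ‖ = 1 := by
  have := inner_angularDir_self θ
  rw [real_inner_self_eq_norm_sq] at this
  exact (pow_eq_one_iff_of_nonneg (norm_nonneg _) two_ne_zero).1 this

theorem norm_polarPoint (r θ : ℝ) : ‖polarPoint r θ‖ = |r| := by
  rw [polarPoint_eq_smul, norm_smul, norm_radialDir, mul_one, Real.norm_eq_abs]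

theorem eq_inner_smul_add_inner_smul (θ : ℝ) (v : EuclideanSpace ℝ (Fin 2)) :
    v = inner ℝ v (radialDir θ) • radialDir θ + inner ℝ v (angularDir θ) • angularDir θ := by
  have h := Real.sin_sq_add_cos_sq θ
  ext i
  fin_cases i
  · simp [angularDir, radialDir, PiLp.inner_apply, Fin.sum_univ_two]
    linear_combination -(v 0) * h
  · simp [angularDir, radialDir, PiLp.inner_apply, Fin.sum_univ_two]
    linear_combination -(v 1) * h

theorem continuous_radialDir : Continuous radialDir := by
  refine (PiLp.continuous_toLp 2 _).comp (continuous_pi fun i => ?_)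
  fin_cases i
  · exact Real.continuous_cos
  · exact Real.continuous_sin

theorem continuous_angularDir : Continuous angularDir := by
  refine (PiLp.continuous_toLp 2 _).comp (continuous_pi fun i => ?_)
  fin_cases i
  · exact Real.continuous_sin.neg
  · exact Real.continuous_cos

theorem continuous_polarPoint : Continuous fun p : ℝ × ℝ => polarPoint p.1 p.2 := by
  simp only [polarPoint_eq_smul]
  exact continuous_fst.smul (continuous_radialDir.comp continuous_snd)

theorem hasDerivAt_radialDir (θ : ℝ) : HasDerivAt radialDir (angularDir θ) θ := by
  have h : HasDerivAt (fun t : ℝ => Real.cos t • EuclideanSpace.single (0 : Fin 2) (1 : ℝ) +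
      Real.sin t • EuclideanSpace.single (1 : Fin 2) (1 : ℝ))
      ((-Real.sin θ) • EuclideanSpace.single (0 : Fin 2) (1 : ℝ) +
      Real.cos θ • EuclideanSpace.single (1 : Fin 2) (1 : ℝ)) θ :=
    ((Real.hasDerivAt_cos θ).smul_const _).add ((Real.hasDerivAt_sin θ).smul_const _)
  convert h using 1
  · ext t i; fin_cases i <;> simp [radialDir]
  · ext i; fin_cases i <;> simp [angularDir]

theorem hasDerivAt_polarPoint_angle (r θ : ℝ) :
    HasDerivAt (fun t => polarPoint r t) (r • angularDir θ) θ := by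
  simp only [polarPoint_eq_smul]
  exact (hasDerivAt_radialDir θ).const_smul r

theorem hasDerivAt_polarPoint_radius (r θ : ℝ) :
    HasDerivAt (fun s => polarPoint s θ) (radialDir θ) r := by
  simp only [polarPoint_eq_smul]
  simpa using (hasDerivAt_id r).smul_const (radialDir θ)

/-- Lebesgue measure on the coordinate rectangle `(0, R) × (-π, π)` of the disc of radius `R`. -/
noncomputable def polarBox (R : ℝ) : Measure (ℝ × ℝ) :=
  (volume.restrict (Ioo 0 R)).prod (volume.restrict (Ioo (-Real.pi) Real.pi))

instance (R : ℝ) : IsFiniteMeasure (polarBox R) := by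
  unfold polarBox; infer_instance

theorem polarBox_eq (R : ℝ) :
    polarBox R = volume.restrict (Ioo 0 R ×ˢ Ioo (-Real.pi) Real.pi) := by
  rw [polarBox, Measure.prod_restrict, Measure.volume_eq_prod]

theorem measurePreserving_polarCoord_symm :
    MeasurePreserving polarCoord.symm
      ((volume.restrict polarCoord.target).withDensity fun p => ENNReal.ofReal p.1) volume := by
  have hm : Measurable polarCoord.symm := continuous_polarCoord_symm.measurable
  refine ⟨hm, Measure.ext fun s hs => ?_⟩
  rw [Measure.map_apply hm hs, withDensity_apply _ (hm hs), ← lintegral_indicator (hm hs),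
    ← lintegral_indicator_one hs, ← lintegral_comp_polarCoord_symm]
  refine lintegral_congr fun p => ?_
  by_cases hp : polarCoord.symm p ∈ s
  · rw [indicator_of_mem (show p ∈ polarCoord.symm ⁻¹' s from hp), indicator_of_mem hp]
    simp
  · rw [indicator_of_notMem (show p ∉ polarCoord.symm ⁻¹' s from hp), indicator_of_notMem hp]
    simp

/-- Polar coordinates on the disc of radius `R`. -/
theorem measurePreserving_polarPoint (R : ℝ) :
    MeasurePreserving (fun p : ℝ × ℝ => polarPoint p.1 p.2)
      ((polarBox R).withDensity fun p => ENNReal.ofReal p.1)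
      (volume.restrict (Metric.ball 0 R)) := by
  have h1 : MeasurePreserving (fun p : ℝ × ℝ => polarPoint p.1 p.2)
      ((volume.restrict polarCoord.target).withDensity fun p => ENNReal.ofReal p.1) volume :=
    (PiLp.volume_preserving_toLp (Fin 2)).comp
      ((volume_preserving_finTwoArrow ℝ).symm.comp measurePreserving_polarCoord_symm)
  have h2 := h1.restrict_preimage (s := Metric.ball 0 R) measurableSet_ball
  have hm : MeasurableSet ((fun p : ℝ × ℝ => polarPoint p.1 p.2) ⁻¹' Metric.ball 0 R) :=
    continuous_polarPoint.measurable measurableSet_ball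
  rw [restrict_withDensity hm, Measure.restrict_restrict hm] at h2
  suffices hs : (fun p : ℝ × ℝ => polarPoint p.1 p.2) ⁻¹' Metric.ball 0 R ∩ polarCoord.target =
      Ioo 0 R ×ˢ Ioo (-Real.pi) Real.pi by
    rw [hs, ← polarBox_eq] at h2
    exact h2
  ext ⟨r, θ⟩
  simp only [polarCoord_target, mem_prod, mem_Ioo, mem_inter_iff, mem_preimage,
    mem_ball_zero_iff, norm_polarPoint, mem_Ioi]
  constructor
  · rintro ⟨h1, h2, h3⟩
    exact ⟨⟨h2, by rwa [abs_of_pos h2] at h1⟩, h3⟩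
  · rintro ⟨⟨h1, h2⟩, h3⟩
    exact ⟨by rwa [abs_of_pos h1], h1, h3⟩

theorem ae_polarBox_pos (R : ℝ) : ∀ᵐ p ∂polarBox R, 0 < p.1 := by
  rw [polarBox_eq]
  filter_upwards [ae_restrict_mem (measurableSet_Ioo.prod measurableSet_Ioo)] with p hp
  exact hp.1.1

theorem polarBox_absolutelyContinuous (R : ℝ) :
    polarBox R ≪ (polarBox R).withDensity fun p => ENNReal.ofReal p.1 := by
  refine withDensity_absolutelyContinuous' (by fun_prop) ?_
  filter_upwards [ae_polarBox_pos R] with p hp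
  simpa using hp

theorem quasiMeasurePreserving_polarPoint (R : ℝ) :
    Measure.QuasiMeasurePreserving (fun p : ℝ × ℝ => polarPoint p.1 p.2) (polarBox R)
      (volume.restrict (Metric.ball 0 R)) :=
  (measurePreserving_polarPoint R).quasiMeasurePreserving.mono_left
    (polarBox_absolutelyContinuous R)

variable {F : Type*} [NormedAddCommGroup F] [NormedSpace ℝ F]

theorem integrable_polarBox_iff {f : EuclideanSpace ℝ (Fin 2) → F} {R : ℝ}
    (hf : AEStronglyMeasurable f (volume.restrict (Metric.ball 0 R))) :
    Integrable (fun p : ℝ × ℝ => p.1 • f (polarPoint p.1 p.2)) (polarBox R) ↔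
      IntegrableOn f (Metric.ball 0 R) := by
  rw [IntegrableOn, ← (measurePreserving_polarPoint R).integrable_comp hf,
    integrable_withDensity_iff_integrable_smul' (by fun_prop) (by simp)]
  refine integrable_congr ?_
  filter_upwards [ae_polarBox_pos R] with p hp
  simp [ENNReal.toReal_ofReal hp.le]

theorem integral_ball_eq_integral_polarBox {f : EuclideanSpace ℝ (Fin 2) → F} {R : ℝ}
    (hf : AEStronglyMeasurable f (volume.restrict (Metric.ball 0 R))) :
    ∫ x in Metric.ball 0 R, f x = ∫ p, p.1 • f (polarPoint p.1 p.2) ∂polarBox R := by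
  have hP := measurePreserving_polarPoint R
  rw [← hP.map_eq] at hf ⊢
  rw [integral_map hP.measurable.aemeasurable hf,
    integral_withDensity_eq_integral_toReal_smul (by fun_prop) (by simp)]
  refine integral_congr_ae ?_
  filter_upwards [ae_polarBox_pos R] with p hp
  simp [ENNReal.toReal_ofReal hp.le]

theorem integral_ball_eq_polar {f : EuclideanSpace ℝ (Fin 2) → F} {R : ℝ}
    (hf : IntegrableOn f (Metric.ball 0 R)) :
    ∫ x in Metric.ball 0 R, f x =
      ∫ r in Ioo 0 R, ∫ θ in Ioo (-Real.pi) Real.pi, r • f (polarPoint r θ) := by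
  rw [integral_ball_eq_integral_polarBox hf.1, polarBox, integral_prod]
  exact (integrable_polarBox_iff hf.1).2 hf

/-- Almost every circle of an `L²_loc` function carries an `L²` function. -/
theorem MemL2loc.ae_memLp_circle {F : Type*} [NormedAddCommGroup F]
    {f : EuclideanSpace ℝ (Fin 2) → F} (hf : MemL2loc f) (R : ℝ) :
    ∀ᵐ r ∂volume.restrict (Ioo 0 R),
      MemLp (fun θ => f (polarPoint r θ)) 2 (volume.restrict (Ioo (-Real.pi) Real.pi)) := by
  have hb := (hf _ (isCompact_closedBall 0 R)).mono_measure
    (Measure.restrict_mono Metric.ball_subset_closedBall le_rfl)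
  have hi : IntegrableOn (fun x => ‖f x‖ ^ 2) (Metric.ball 0 R) :=
    hb.integrable_norm_pow two_ne_zero
  have h1 := ((integrable_polarBox_iff hi.1).2 hi).prod_right_ae
  have h2 : AEStronglyMeasurable (fun p : ℝ × ℝ => f (polarPoint p.1 p.2)) (polarBox R) :=
    hb.1.comp_quasiMeasurePreserving (quasiMeasurePreserving_polarPoint R)
  have h3 := h2.prodMk_left
  filter_upwards [h1, h3, ae_restrict_mem measurableSet_Ioo] with r hr1 hr2 hr
  refine (memLp_two_iff_integrable_sq_norm hr2).2 ?_
  have := hr1.const_mul r⁻¹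
  refine this.congr (Eventually.of_forall fun θ => ?_)
  simp only [smul_eq_mul]
  rw [inv_mul_cancel_left₀ hr.1.ne']

/-- On almost every circle, a continuous function with a weak gradient is absolutely continuous,
and its angular derivative is the angular component of the weak gradient. -/
theorem HasWeakGradient.ae_sub_eq_integral {u : EuclideanSpace ℝ (Fin 2) → ℝ}
    {G : EuclideanSpace ℝ (Fin 2) → EuclideanSpace ℝ (Fin 2)} (hw : HasWeakGradient u G)
    (hu : Continuous u) (R : ℝ) :
    ∀ᵐ r ∂volume.restrict (Ioo 0 R), ∀ a ∈ Icc (-Real.pi) Real.pi, ∀ b ∈ Icc (-Real.pi) Real.pi,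
      u (polarPoint r b) - u (polarPoint r a) =
        ∫ θ in a..b, r * inner ℝ (G (polarPoint r θ)) (angularDir θ) := by
  set B : Set (EuclideanSpace ℝ (Fin 2)) := Metric.ball 0 R
  have hGl := hw.grad_memL2loc.locallyIntegrable
  have hGc : ∀ k, Continuous (mollify k G) := fun k => (contDiff_mollify hGl k).continuous
  have hfin : IsFiniteMeasure (volume.restrict B) := ⟨by simpa using measure_ball_lt_top⟩
  set h : ℕ → EuclideanSpace ℝ (Fin 2) → EuclideanSpace ℝ (Fin 2) := fun k => mollify k G - G
  have hhm : ∀ k, AEStronglyMeasurable (h k) (volume.restrict B) := fun k =>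
    ((hGc k).aestronglyMeasurable.sub hw.grad_memL2loc.aestronglyMeasurable).restrict
  have hhi : ∀ k, IntegrableOn (h k) B := fun k =>
    (((hGc k).locallyIntegrable.integrableOn_isCompact (isCompact_closedBall 0 R)).mono_set
      Metric.ball_subset_closedBall).sub
      ((hGl.integrableOn_isCompact (isCompact_closedBall 0 R)).mono_set
      Metric.ball_subset_closedBall)
  have hlim1 : Tendsto (fun k => eLpNorm (h k) 1 (volume.restrict B)) atTop (𝓝 0) := by
    have h2 : Tendsto (fun k => eLpNorm (h k) 2 (volume.restrict B)) atTop (𝓝 0) :=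
      tendsto_of_tendsto_of_tendsto_of_le_of_le tendsto_const_nhds
        (hw.grad_memL2loc.eLpNorm_mollify_sub_tendsto R) (fun _ => zero_le)
        fun k => eLpNorm_mono_measure _ (Measure.restrict_mono Metric.ball_subset_closedBall le_rfl)
    set c := volume.restrict B univ ^ (1 / (1 : ℝ≥0∞).toReal - 1 / (2 : ℝ≥0∞).toReal)
    have hc : c ≠ ⊤ := ENNReal.rpow_ne_top_of_nonneg (by norm_num) (measure_ne_top _ _)
    have h3 : Tendsto (fun k => eLpNorm (h k) 2 (volume.restrict B) * c) atTop (𝓝 0) := by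
      simpa using ENNReal.Tendsto.mul_const h2 (Or.inr hc)
    exact tendsto_of_tendsto_of_tendsto_of_le_of_le tendsto_const_nhds h3 (fun _ => zero_le)
      fun k => eLpNorm_le_eLpNorm_mul_rpow_measure_univ one_le_two (hhm k)
  have hpi : ∀ k, Integrable (fun p : ℝ × ℝ => p.1 • h k (polarPoint p.1 p.2)) (polarBox R) :=
    fun k => (integrable_polarBox_iff (hhm k)).2 (hhi k)
  set N : ℕ → ℝ → ℝ := fun k r => ∫ θ in Ioo (-Real.pi) Real.pi, ‖r • h k (polarPoint r θ)‖ with hN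
  have hN1 : ∀ k, eLpNorm (N k) 1 (volume.restrict (Ioo 0 R)) =
      eLpNorm (h k) 1 (volume.restrict B) := by
    intro k
    have i1 : Integrable (N k) (volume.restrict (Ioo 0 R)) := (hpi k).norm.integral_prod_left
    rw [eLpNorm_one_eq_lintegral_enorm, eLpNorm_one_eq_lintegral_enorm,
      ← ofReal_integral_norm_eq_lintegral_enorm i1,
      ← ofReal_integral_norm_eq_lintegral_enorm (hhi k), integral_ball_eq_polar (hhi k).norm]
    congr 1
    refine setIntegral_congr_fun measurableSet_Ioo fun r hr => ?_
    simp only [hN]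
    rw [Real.norm_eq_abs, abs_of_nonneg (integral_nonneg fun _ => norm_nonneg _)]
    refine integral_congr_ae (Eventually.of_forall fun θ => ?_)
    simp [norm_smul, abs_of_pos hr.1]
  have hNm : TendstoInMeasure (volume.restrict (Ioo 0 R)) N atTop (fun _ => 0) := by
    refine tendstoInMeasure_of_tendsto_eLpNorm one_ne_zero
      (fun k => (hpi k).norm.integral_prod_left.1) aestronglyMeasurable_const ?_
    refine hlim1.congr fun k => ?_
    rw [← hN1 k]
    congr 1; ext r; simp
  obtain ⟨ns, hns, hns0⟩ := hNm.exists_seq_tendsto_ae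
  have hGs : ∀ᵐ r ∂volume.restrict (Ioo 0 R),
      MemLp (fun θ => G (polarPoint r θ)) 2 (volume.restrict (Ioo (-Real.pi) Real.pi)) :=
    hw.grad_memL2loc.ae_memLp_circle R
  filter_upwards [hns0, hGs] with r hr0 hrG a ha b hb
  have hsub : uIoc a b ⊆ Ioc (-Real.pi) Real.pi := by
    intro θ hθ
    rw [mem_uIoc] at hθ
    rcases hθ with h | h
    · exact ⟨ha.1.trans_lt h.1, h.2.trans hb.2⟩
    · exact ⟨hb.1.trans_lt h.1, h.2.trans ha.2⟩
  have hGi : IntegrableOn (fun θ => G (polarPoint r θ)) (Ioc (-Real.pi) Real.pi) := by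
    rw [integrableOn_Ioc_iff_integrableOn_Ioo]
    exact hrG.integrable one_le_two
  have hpc : Continuous fun θ => polarPoint r θ :=
    continuous_polarPoint.comp (continuous_const.prodMk continuous_id)
  have hGik : ∀ k, IntegrableOn (fun θ => mollify k G (polarPoint r θ)) (Ioc (-Real.pi) Real.pi) :=
    fun k => ((hGc k).comp hpc).integrableOn_Ioc
  have hcomp : ∀ {v : ℝ → EuclideanSpace ℝ (Fin 2)}, IntegrableOn v (Ioc (-Real.pi) Real.pi) →
      IntervalIntegrable (fun θ => r * inner ℝ (v θ) (angularDir θ)) volume a b := by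
    intro v hv
    refine IntervalIntegrable.const_mul ?_ r
    rw [intervalIntegrable_iff]
    refine (hv.mono_set hsub).norm.mono' ((hv.mono_set hsub).1.inner
      continuous_angularDir.aestronglyMeasurable) (Eventually.of_forall fun θ => ?_)
    refine (norm_inner_le_norm (𝕜 := ℝ) _ _).trans ?_
    rw [norm_angularDir, mul_one]
  have hsmooth : ∀ k, mollify k u (polarPoint r b) - mollify k u (polarPoint r a) =
      ∫ θ in a..b, r * inner ℝ (mollify k G (polarPoint r θ)) (angularDir θ) := by
    intro k
    symm
    refine intervalIntegral.integral_eq_sub_of_hasDerivAt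
      (f := fun θ => mollify k u (polarPoint r θ)) (fun θ _ => ?_) (hcomp (hGik k))
    have := (hw.hasGradientAt_mollify k (polarPoint r θ)).hasFDerivAt.comp_hasDerivAt θ
      (hasDerivAt_polarPoint_angle r θ)
    simpa [inner_smul_right] using! this
  have hbound : ∀ k, |(mollify k u (polarPoint r b) - mollify k u (polarPoint r a)) -
      ∫ θ in a..b, r * inner ℝ (G (polarPoint r θ)) (angularDir θ)| ≤ N k r := by
    intro k
    rw [hsmooth k, ← intervalIntegral.integral_sub (hcomp (hGik k)) (hcomp hGi), ← Real.norm_eq_abs]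
    refine intervalIntegral.norm_integral_le_integral_norm_uIoc.trans ?_
    have hi : IntegrableOn (fun θ => ‖r • h k (polarPoint r θ)‖) (Ioc (-Real.pi) Real.pi) :=
      (((hGik k).sub hGi).smul r).norm
    calc _ ≤ ∫ θ in uIoc a b, ‖r • h k (polarPoint r θ)‖ := by
          refine integral_mono_of_nonneg (Eventually.of_forall fun _ => norm_nonneg _)
            (hi.mono_set hsub) (Eventually.of_forall fun θ => ?_)
          simp only [h, Pi.sub_apply]
          rw [← mul_sub, ← inner_sub_left, norm_smul, norm_mul]
          refine mul_le_mul_of_nonneg_left ?_ (norm_nonneg _)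
          refine (norm_inner_le_norm (𝕜 := ℝ) _ _).trans ?_
          rw [norm_angularDir, mul_one]
      _ ≤ ∫ θ in Ioc (-Real.pi) Real.pi, ‖r • h k (polarPoint r θ)‖ :=
          setIntegral_mono_set hi (Eventually.of_forall fun _ => norm_nonneg _)
            hsub.eventuallyLE
      _ = N k r := by rw [integral_Ioc_eq_integral_Ioo]
  have hlimu : Tendsto (fun j => (mollify (ns j) u (polarPoint r b) -
      mollify (ns j) u (polarPoint r a)) -
      ∫ θ in a..b, r * inner ℝ (G (polarPoint r θ)) (angularDir θ)) atTop
      (𝓝 ((u (polarPoint r b) - u (polarPoint r a)) -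
      ∫ θ in a..b, r * inner ℝ (G (polarPoint r θ)) (angularDir θ))) :=
    ((((mollify_tendsto hu _).sub (mollify_tendsto hu _)).sub_const _)).comp hns.tendsto_atTop
  have h0 := squeeze_zero_norm (fun j => (Real.norm_eq_abs _).trans_le (hbound (ns j))) hr0
  exact sub_eq_zero.1 (tendsto_nhds_unique hlimu h0)

end Polar

/-! ### Energy in discs and flux through circles -/

section CircleEnergy

open Filter Topology Set

/-- A nonnegative continuous subsolution `u` of `-div(A ∇u) ≤ 0` in the plane, with a chosen weak
gradient `G`. -/
structure IsPlanarSubsolution (lam L : ℝ)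
    (A : EuclideanSpace ℝ (Fin 2) → Matrix (Fin 2) (Fin 2) ℝ)
    (u : EuclideanSpace ℝ (Fin 2) → ℝ) (G : EuclideanSpace ℝ (Fin 2) → EuclideanSpace ℝ (Fin 2)) :
    Prop where
  lam_pos : 0 < lam
  lam_le : lam ≤ L
  elliptic : EllipticClass lam L A
  weakGradient : HasWeakGradient u G
  continuous : Continuous u
  nonneg : ∀ x, 0 ≤ u x
  subsolution : ∀ φ : EuclideanSpace ℝ (Fin 2) → ℝ, IsTestFunction φ → (∀ x, 0 ≤ φ x) →
    ∫ x, inner ℝ (Matrix.toEuclideanLin (A x) (G x)) (gradient φ x) ≤ 0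

/-- The energy `∫ A G · G` over the disc of radius `r`. -/
noncomputable def diskEnergy (A : EuclideanSpace ℝ (Fin 2) → Matrix (Fin 2) (Fin 2) ℝ)
    (G : EuclideanSpace ℝ (Fin 2) → EuclideanSpace ℝ (Fin 2)) (r : ℝ) : ℝ :=
  ∫ x in Metric.ball 0 r, inner ℝ (Matrix.toEuclideanLin (A x) (G x)) (G x)

/-- The energy `∫ A G · G` over the circle of radius `r`, with respect to arc length. -/
noncomputable def circleEnergy (A : EuclideanSpace ℝ (Fin 2) → Matrix (Fin 2) (Fin 2) ℝ)
    (G : EuclideanSpace ℝ (Fin 2) → EuclideanSpace ℝ (Fin 2)) (r : ℝ) : ℝ :=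
  ∫ θ in Ioo (-Real.pi) Real.pi, r * inner ℝ
    (Matrix.toEuclideanLin (A (polarPoint r θ)) (G (polarPoint r θ))) (G (polarPoint r θ))

/-- The flux `∫ u A G · ν` through the circle of radius `r`, with respect to arc length. -/
noncomputable def circleFlux (A : EuclideanSpace ℝ (Fin 2) → Matrix (Fin 2) (Fin 2) ℝ)
    (u : EuclideanSpace ℝ (Fin 2) → ℝ)
    (G : EuclideanSpace ℝ (Fin 2) → EuclideanSpace ℝ (Fin 2)) (r : ℝ) : ℝ :=
  ∫ θ in Ioo (-Real.pi) Real.pi, r * (u (polarPoint r θ) * inner ℝ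
    (Matrix.toEuclideanLin (A (polarPoint r θ)) (G (polarPoint r θ))) (radialDir θ))

namespace IsPlanarSubsolution

variable {lam L : ℝ} {A : EuclideanSpace ℝ (Fin 2) → Matrix (Fin 2) (Fin 2) ℝ}
  {u : EuclideanSpace ℝ (Fin 2) → ℝ} {G : EuclideanSpace ℝ (Fin 2) → EuclideanSpace ℝ (Fin 2)}

theorem memL2loc_flux (h : IsPlanarSubsolution lam L A u G) :
    MemL2loc (fun x => Matrix.toEuclideanLin (A x) (G x)) :=
  h.elliptic.memL2loc h.lam_pos.le (h.lam_pos.le.trans h.lam_le) h.weakGradient.grad_memL2loc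

theorem energy_nonneg (h : IsPlanarSubsolution lam L A u G) (x : EuclideanSpace ℝ (Fin 2)) :
    0 ≤ inner ℝ (Matrix.toEuclideanLin (A x) (G x)) (G x) :=
  h.elliptic.inner_self_nonneg h.lam_pos.le _ _

theorem locallyIntegrable_energy (h : IsPlanarSubsolution lam L A u G) :
    LocallyIntegrable fun x => inner ℝ (Matrix.toEuclideanLin (A x) (G x)) (G x) :=
  locallyIntegrable_iff.2 fun K hK =>
    (h.memL2loc_flux K hK).integrable_inner (h.weakGradient.grad_memL2loc K hK)

theorem integrableOn_energy_ball (h : IsPlanarSubsolution lam L A u G) (R : ℝ) :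
    IntegrableOn (fun x => inner ℝ (Matrix.toEuclideanLin (A x) (G x)) (G x))
      (Metric.ball 0 R) :=
  (h.locallyIntegrable_energy.integrableOn_isCompact (isCompact_closedBall 0 R)).mono_set
    Metric.ball_subset_closedBall

theorem diskEnergy_mono (h : IsPlanarSubsolution lam L A u G) : Monotone (diskEnergy A G) :=
  fun _ s hrs => setIntegral_mono_set (h.integrableOn_energy_ball s)
    (Eventually.of_forall h.energy_nonneg) (Metric.ball_subset_ball hrs).eventuallyLE

theorem diskEnergy_nonneg (h : IsPlanarSubsolution lam L A u G) (r : ℝ) : 0 ≤ diskEnergy A G r :=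
  integral_nonneg h.energy_nonneg

theorem integrableOn_circleEnergy (h : IsPlanarSubsolution lam L A u G) (R : ℝ) :
    IntegrableOn (circleEnergy A G) (Ioo 0 R) :=
  ((integrable_polarBox_iff (h.integrableOn_energy_ball R).1).2
    (h.integrableOn_energy_ball R)).integral_prod_left

theorem diskEnergy_eq_integral (h : IsPlanarSubsolution lam L A u G) {R : ℝ} (hR : 0 ≤ R) :
    diskEnergy A G R = ∫ r in (0 : ℝ)..R, circleEnergy A G r := by
  rw [diskEnergy, integral_ball_eq_polar (h.integrableOn_energy_ball R),
    intervalIntegral.integral_of_le hR, integral_Ioc_eq_integral_Ioo]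
  rfl

theorem ae_hasDerivAt_diskEnergy (h : IsPlanarSubsolution lam L A u G) (R : ℝ) :
    ∀ᵐ r, r ∈ Ioo 0 R → HasDerivAt (diskEnergy A G) (circleEnergy A G r) r := by
  rcases le_or_gt R 0 with hR | hR
  · simp [Ioo_eq_empty (not_lt.2 hR)]
  have hi : IntervalIntegrable (circleEnergy A G) volume 0 R := by
    rw [intervalIntegrable_iff_integrableOn_Ioo_of_le hR.le]
    exact h.integrableOn_circleEnergy R
  filter_upwards [hi.ae_hasDerivAt_integral] with r hr hrR
  have := hr (by rw [uIcc_of_le hR.le]; exact Ioo_subset_Icc_self hrR) 0 (by simp)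
  refine this.congr_of_eventuallyEq ?_
  filter_upwards [lt_mem_nhds hrR.1] with s hs
  exact h.diskEnergy_eq_integral hs.le

theorem integrableOn_flux_ball (h : IsPlanarSubsolution lam L A u G) (R : ℝ) :
    IntegrableOn (fun x => u x * inner ℝ (Matrix.toEuclideanLin (A x) (G x)) x)
      (Metric.ball 0 R) := by
  refine IntegrableOn.mono_set ?_ Metric.ball_subset_closedBall
  have hK := isCompact_closedBall (0 : EuclideanSpace ℝ (Fin 2)) R
  have hfin : IsFiniteMeasure
      (volume.restrict (Metric.closedBall (0 : EuclideanSpace ℝ (Fin 2)) R)) :=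
    ⟨by
      rw [Measure.restrict_apply_univ]; exact hK.measure_lt_top⟩
  obtain ⟨M, hM⟩ := hK.exists_bound_of_continuousOn
    (h.continuous.smul continuous_id : Continuous fun x => u x • x).continuousOn
  have hb : MemLp (fun x => u x • x) 2
      (volume.restrict (Metric.closedBall (0 : EuclideanSpace ℝ (Fin 2)) R)) := by
    refine MemLp.of_bound (h.continuous.smul continuous_id).aestronglyMeasurable M ?_
    filter_upwards [ae_restrict_mem measurableSet_closedBall] with x hx using hM x hx
  refine ((h.memL2loc_flux _ hK).integrable_inner hb).congr (Eventually.of_forall fun x => ?_)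
  simp [inner_smul_right]

theorem mul_circleFlux_eq (r : ℝ) :
    r * circleFlux A u G r = ∫ θ in Ioo (-Real.pi) Real.pi, r • (u (polarPoint r θ) * inner ℝ
      (Matrix.toEuclideanLin (A (polarPoint r θ)) (G (polarPoint r θ))) (polarPoint r θ)) := by
  rw [circleFlux, ← integral_const_mul]
  refine integral_congr_ae (Eventually.of_forall fun θ => ?_)
  simp only [polarPoint_eq_smul r θ, inner_smul_right, smul_eq_mul]
  ring

theorem integrableOn_mul_circleFlux (h : IsPlanarSubsolution lam L A u G) (R : ℝ) :
    IntegrableOn (fun r => r * circleFlux A u G r) (Ioo 0 R) := by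
  simp only [mul_circleFlux_eq]
  exact ((integrable_polarBox_iff (h.integrableOn_flux_ball R).1).2
    (h.integrableOn_flux_ball R)).integral_prod_left

/-- Testing with the radial function `∫_{|x|²}^∞ χ`, where `χ` is a bump function supported in
`[a², b²]`. -/
theorem bump_mul_diskEnergy_le (h : IsPlanarSubsolution lam L A u G) {a b : ℝ} (ha : 0 < a)
    (hab : a < b) (χ : ContDiffBump ((a ^ 2 + b ^ 2) / 2 : ℝ)) (hχ : χ.rOut = (b ^ 2 - a ^ 2) / 2) :
    2 * χ.rIn * diskEnergy A G a ≤
      ∫ r in Ioo 0 b, (χ : ℝ → ℝ) (r ^ 2) * (2 * (r * circleFlux A u G r)) := by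
  have hb : 0 < b := ha.trans hab
  have hab2 : a ^ 2 < b ^ 2 := by gcongr
  have hχc : Continuous χ := χ.continuous
  have hχ0 : ∀ s, b ^ 2 ≤ s → χ s = 0 := fun s hs => by
    refine χ.zero_of_le_dist ?_
    rw [hχ, Real.dist_eq]
    exact le_trans (by linarith) (le_abs_self _)
  set g : ℝ → ℝ := fun s => -∫ t in b ^ 2..s, χ t with hg
  have hgd : ∀ s, HasDerivAt g (-χ s) s := fun s =>
    (hχc.integral_hasStrictDerivAt _ s).hasDerivAt.neg
  have hgs : ContDiff ℝ ∞ g := by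
    rw [contDiff_infty_iff_deriv]
    refine ⟨fun s => (hgd s).differentiableAt, ?_⟩
    rw [show deriv g = fun s => -χ s from funext fun s => (hgd s).deriv]
    exact χ.contDiff.neg
  have hg0 : ∀ s, b ^ 2 ≤ s → g s = 0 := fun s hs => by
    simp only [hg, neg_eq_zero]
    refine intervalIntegral.integral_zero_ae (Eventually.of_forall fun t ht => ?_)
    rw [uIoc_of_le hs] at ht
    exact hχ0 t ht.1.le
  have hgn : ∀ s, 0 ≤ g s := fun s => by
    rcases le_total (b ^ 2) s with hs | hs
    · rw [hg0 s hs]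
    · simp only [hg]
      rw [← intervalIntegral.integral_symm]
      exact intervalIntegral.integral_nonneg hs fun t _ => χ.nonneg
  have hga : ∀ s, s ≤ a ^ 2 → 2 * χ.rIn ≤ g s := fun s hs => by
    simp only [hg]
    rw [← intervalIntegral.integral_symm]
    have hlt := χ.rIn_lt_rOut
    rw [hχ] at hlt
    have hi : ∀ p q : ℝ, IntervalIntegrable χ volume p q := fun p q => hχc.intervalIntegrable p q
    calc 2 * χ.rIn
        = ∫ t in ((a ^ 2 + b ^ 2) / 2 - χ.rIn)..((a ^ 2 + b ^ 2) / 2 + χ.rIn), (1 : ℝ) := by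
          simp; ring
      _ = ∫ t in ((a ^ 2 + b ^ 2) / 2 - χ.rIn)..((a ^ 2 + b ^ 2) / 2 + χ.rIn), χ t := by
          refine intervalIntegral.integral_congr fun t ht => ?_
          rw [uIcc_of_le (by linarith [χ.rIn_pos])] at ht
          refine (χ.one_of_mem_closedBall ?_).symm
          rw [Real.closedBall_eq_Icc]
          exact ht
      _ ≤ ∫ t in s..b ^ 2, χ t :=
          intervalIntegral.integral_mono_interval (by linarith) (by linarith [χ.rIn_pos])
            (by linarith) (Eventually.of_forall fun t => χ.nonneg) (hi _ _)
  set η : EuclideanSpace ℝ (Fin 2) → ℝ := fun x => g (‖x‖ ^ 2) with hη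
  have hηout : ∀ x, x ∉ Metric.closedBall (0 : EuclideanSpace ℝ (Fin 2)) b → η x = 0 := by
    intro x hx
    rw [mem_closedBall_zero_iff, not_le] at hx
    exact hg0 _ (by gcongr)
  have hηt : IsTestFunction η :=
    ⟨hgs.comp (contDiff_norm_sq ℝ), HasCompactSupport.intro (isCompact_closedBall _ b) hηout⟩
  have hηg : ∀ x, gradient η x = (-(2 * χ (‖x‖ ^ 2))) • x := by
    intro x
    refine HasGradientAt.gradient ?_
    rw [hasGradientAt_iff_hasFDerivAt]
    have h1 := (hgd (‖x‖ ^ 2)).comp_hasFDerivAt x (hasStrictFDerivAt_norm_sq x).hasFDerivAt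
    have h2 : (InnerProductSpace.toDual ℝ (EuclideanSpace ℝ (Fin 2)))
        ((-(2 * χ (‖x‖ ^ 2))) • x) = -χ (‖x‖ ^ 2) • 2 • innerSL ℝ x := by
      ext v
      simp
      ring
    rw [h2]
    exact h1
  have hS := integral_mul_energy_le h.elliptic h.lam_pos.le (h.lam_pos.le.trans h.lam_le)
    h.weakGradient h.continuous h.nonneg h.subsolution hηt fun x => hgn _
  have hleft : 2 * χ.rIn * diskEnergy A G a ≤
      ∫ x, η x * inner ℝ (Matrix.toEuclideanLin (A x) (G x)) (G x) := by
    rw [diskEnergy, ← integral_const_mul]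
    have hi : Integrable fun x => η x * inner ℝ (Matrix.toEuclideanLin (A x) (G x)) (G x) :=
      h.locallyIntegrable_energy.integrable_smul_left_of_hasCompactSupport hηt.1.continuous hηt.2
    refine le_trans (setIntegral_mono_on ((h.integrableOn_energy_ball a).const_mul _)
      hi.integrableOn measurableSet_ball fun x hx => ?_)
      (setIntegral_le_integral hi (Eventually.of_forall fun x =>
        mul_nonneg (hgn _) (h.energy_nonneg x)))
    refine mul_le_mul_of_nonneg_right (hga _ ?_) (h.energy_nonneg x)
    have := mem_ball_zero_iff.1 hx
    gcongr
  refine hleft.trans (hS.trans (le_of_eq ?_))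
  have hout : ∀ x, x ∉ Metric.ball (0 : EuclideanSpace ℝ (Fin 2)) b →
      u x * inner ℝ (Matrix.toEuclideanLin (A x) (G x)) (gradient η x) = 0 := by
    intro x hx
    rw [mem_ball_zero_iff, not_lt] at hx
    rw [hηg, hχ0 _ (by gcongr)]
    simp
  rw [← setIntegral_eq_integral_of_forall_compl_eq_zero hout, ← integral_neg]
  have heq : ∀ x, -(u x * inner ℝ (Matrix.toEuclideanLin (A x) (G x)) (gradient η x)) =
      (2 * χ (‖x‖ ^ 2)) * (u x * inner ℝ (Matrix.toEuclideanLin (A x) (G x)) x) := by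
    intro x
    rw [hηg, inner_smul_right]
    ring
  simp only [heq]
  have hi2 : IntegrableOn (fun x => (2 * χ (‖x‖ ^ 2)) *
      (u x * inner ℝ (Matrix.toEuclideanLin (A x) (G x)) x)) (Metric.ball 0 b) := by
    refine (h.integrableOn_flux_ball b).bdd_mul (c := 2)
      (continuous_const.mul (hχc.comp (by fun_prop))).aestronglyMeasurable
      (Eventually.of_forall fun x => ?_)
    rw [Real.norm_eq_abs, abs_of_nonneg (mul_nonneg zero_le_two χ.nonneg)]
    linarith [χ.le_one (x := ‖x‖ ^ 2)]
  rw [integral_ball_eq_polar hi2]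
  refine setIntegral_congr_fun measurableSet_Ioo fun r hr => ?_
  rw [mul_circleFlux_eq, ← mul_assoc, ← integral_const_mul]
  refine integral_congr_ae (Eventually.of_forall fun θ => ?_)
  simp only [norm_polarPoint, sq_abs, smul_eq_mul]
  ring

theorem sq_sub_sq_mul_diskEnergy_le (h : IsPlanarSubsolution lam L A u G) {a b : ℝ} (ha : 0 < a)
    (hab : a < b) :
    (b ^ 2 - a ^ 2) * diskEnergy A G a ≤ ∫ r in a..b, 2 * (r * circleFlux A u G r) := by
  have hw : 0 < (b ^ 2 - a ^ 2) / 2 := by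
    have : a ^ 2 < b ^ 2 := by gcongr
    linarith
  set w := (b ^ 2 - a ^ 2) / 2 with hwdef
  set χ : ℕ → ContDiffBump ((a ^ 2 + b ^ 2) / 2) := fun n =>
    ⟨w * ((n + 1 : ℝ) / (n + 2)), w, by positivity, by
      have : ((n + 1 : ℝ) / (n + 2)) < 1 := by
        rw [div_lt_one (by positivity)]; linarith
      nlinarith⟩ with hχ
  have hin : Tendsto (fun n => (χ n).rIn) atTop (𝓝 w) := by
    have h1 : Tendsto (fun n : ℕ => w * (1 - 1 / ((n : ℝ) + 1 + 1))) atTop (𝓝 (w * (1 - 0))) := by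
      refine (tendsto_const_nhds.sub ?_).const_mul w
      exact_mod_cast (tendsto_one_div_add_atTop_nhds_zero_nat (𝕜 := ℝ)).comp
        (tendsto_add_atTop_nat 1)
    rw [sub_zero, mul_one] at h1
    refine h1.congr fun n => ?_
    change _ = w * ((n + 1 : ℝ) / (n + 2))
    field_simp
    ring
  have hlim : Tendsto (fun n => ∫ r in Ioo 0 b, χ n (r ^ 2) * (2 * (r * circleFlux A u G r))) atTop
      (𝓝 (∫ r in Ioo 0 b, (Ioo a b).indicator (fun r => 2 * (r * circleFlux A u G r)) r)) := by
    have hi := (h.integrableOn_mul_circleFlux b).const_mul 2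
    refine tendsto_integral_of_dominated_convergence
      (fun r => ‖2 * (r * circleFlux A u G r)‖) (fun n => ?_) hi.norm (fun n => ?_) ?_
    · exact (((χ n).continuous.comp (by fun_prop)).aestronglyMeasurable).mul hi.1
    · refine Eventually.of_forall fun r => ?_
      rw [norm_mul]
      refine mul_le_of_le_one_left (norm_nonneg _) ?_
      rw [Real.norm_eq_abs, abs_of_nonneg (χ n).nonneg]
      exact (χ n).le_one
    · filter_upwards [ae_restrict_mem measurableSet_Ioo] with r hr
      by_cases hra : a < r
      · have hm : r ∈ Ioo a b := ⟨hra, hr.2⟩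
        rw [indicator_of_mem hm]
        refine tendsto_const_nhds.congr' ?_
        have hd : dist (r ^ 2) ((a ^ 2 + b ^ 2) / 2) < w := by
          have h1 : a ^ 2 < r ^ 2 := by gcongr
          have h2 : r ^ 2 < b ^ 2 := by have := hr.1; have := hr.2; gcongr
          rw [Real.dist_eq, abs_lt]
          constructor <;> linarith
        filter_upwards [hin.eventually (lt_mem_nhds hd)] with n hn
        rw [(χ n).one_of_mem_closedBall (Metric.mem_closedBall.2 hn.le), one_mul]
      · rw [indicator_of_notMem (fun hm => hra hm.1)]
        refine tendsto_const_nhds.congr fun n => ?_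
        rw [(χ n).zero_of_le_dist, zero_mul]
        have h1 : r ^ 2 ≤ a ^ 2 := by have := hr.1; have := not_lt.1 hra; gcongr
        change w ≤ _
        rw [Real.dist_eq, abs_sub_comm]
        exact le_trans (by linarith) (le_abs_self _)
  have hle := le_of_tendsto_of_tendsto ((hin.const_mul 2).mul_const (diskEnergy A G a)) hlim
    (Eventually.of_forall fun n => h.bump_mul_diskEnergy_le ha hab (χ n) rfl)
  rw [setIntegral_indicator measurableSet_Ioo,
    inter_eq_right.2 (Ioo_subset_Ioo_left ha.le)] at hle
  rw [intervalIntegral.integral_of_le hab.le, integral_Ioc_eq_integral_Ioo]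
  refine le_trans (le_of_eq ?_) hle
  rw [hwdef]
  ring

/-- The energy in a disc is bounded by the flux through its boundary: this is the equation tested
with `u` times the indicator of the disc. -/
theorem ae_diskEnergy_le_circleFlux (h : IsPlanarSubsolution lam L A u G) (R : ℝ) :
    ∀ᵐ r, r ∈ Ioo 0 R → diskEnergy A G r ≤ circleFlux A u G r := by
  rcases le_or_gt R 0 with hR | hR
  · simp [Ioo_eq_empty (not_lt.2 hR)]
  have hi : IntervalIntegrable (fun r => 2 * (r * circleFlux A u G r)) volume 0 R := by
    rw [intervalIntegrable_iff_integrableOn_Ioo_of_le hR.le]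
    exact (h.integrableOn_mul_circleFlux R).const_mul 2
  filter_upwards [hi.ae_hasDerivAt_integral] with a ha haR
  have hd := ha (by rw [uIcc_of_le hR.le]; exact Ioo_subset_Icc_self haR) a
    (by rw [uIcc_of_le hR.le]; exact Ioo_subset_Icc_self haR)
  have hs := (hasDerivAt_iff_tendsto_slope.1 hd).mono_left
    (nhdsWithin_mono a (fun b (hb : a < b) => hb.ne') : 𝓝[>] a ≤ 𝓝[≠] a)
  have hl : Tendsto (fun b => (b + a) * diskEnergy A G a) (𝓝[>] a)
      (𝓝 ((a + a) * diskEnergy A G a)) :=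
    ((tendsto_id.add_const a).mul_const _).mono_left nhdsWithin_le_nhds
  have := le_of_tendsto_of_tendsto hl hs ?_
  · have h2 : (2 * a) * diskEnergy A G a ≤ (2 * a) * circleFlux A u G a := by linarith
    exact le_of_mul_le_mul_left h2 (by linarith [haR.1])
  · filter_upwards [self_mem_nhdsWithin] with b hb
    have hab : a < b := hb
    rw [slope_def_field, intervalIntegral.integral_same, sub_zero,
      le_div_iff₀ (sub_pos.2 hab)]
    calc _ = (b ^ 2 - a ^ 2) * diskEnergy A G a := by ring
      _ ≤ _ := h.sq_sub_sq_mul_diskEnergy_le haR.1 hab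

end IsPlanarSubsolution

end CircleEnergy

/-! ### Wirtinger's inequality in terms of the support -/

section Wirtinger

open Filter Topology Set intervalIntegral

/-- The length of the part of `[a, b]` on which `w` does not vanish. -/
noncomputable def supportLength (w : ℝ → ℝ) (a b : ℝ) : ℝ :=
  ∫ t in a..b, {t | w t ≠ 0}.indicator (fun _ => (1 : ℝ)) t

theorem intervalIntegrable_indicator_support {w : ℝ → ℝ} (hw : Continuous w) (a b : ℝ) :
    IntervalIntegrable ({t | w t ≠ 0}.indicator fun _ => (1 : ℝ)) volume a b := by
  rw [intervalIntegrable_iff]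
  refine Integrable.indicator ?_ (isOpen_ne_fun hw continuous_const).measurableSet
  exact integrableOn_const (by simp)

theorem supportLength_nonneg (w : ℝ → ℝ) {a b : ℝ} (hab : a ≤ b) : 0 ≤ supportLength w a b :=
  integral_nonneg hab fun _ _ => indicator_nonneg (fun _ _ => zero_le_one) _

theorem supportLength_add {w : ℝ → ℝ} (hw : Continuous w) (a b c : ℝ) :
    supportLength w a b + supportLength w b c = supportLength w a c :=
  integral_add_adjacent_intervals (intervalIntegrable_indicator_support hw _ _)
    (intervalIntegrable_indicator_support hw _ _)

theorem supportLength_le (w : ℝ → ℝ) {a b : ℝ} (hab : a ≤ b) : supportLength w a b ≤ b - a := by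
  have h := norm_integral_le_of_norm_le_const (a := a) (b := b) (C := 1)
    (f := {t | w t ≠ 0}.indicator fun _ => (1 : ℝ)) fun t _ => by
      rw [Real.norm_eq_abs, abs_of_nonneg (indicator_nonneg (fun _ _ => zero_le_one) _)]
      exact indicator_le_self' (fun _ _ => zero_le_one) t
  rw [one_mul, abs_of_nonneg (sub_nonneg.2 hab)] at h
  exact (le_abs_self _).trans h

/-- One-dimensional Wirtinger inequality with boundary terms, for a frequency `a` such that the
phase `a (c + |{w ≠ 0} ∩ [α, θ]|)` stays in `(-π / 2, π / 2)`. With `S` the tangent of the phase,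
`(g + a S w)² ≥ 0` and `(S w²)' = a (1 + S²) w² + 2 S w g`. -/
theorem sq_mul_integral_sq_le {α β a c : ℝ} (hαβ : α ≤ β) (ha : 0 < a) {w g : ℝ → ℝ}
    (hwc : Continuous w) (hw : ∀ θ ∈ Icc α β, w θ - w α = ∫ t in α..θ, g t)
    (hg : MemLp g 2 (volume.restrict (Ioc α β)))
    (h1 : -(Real.pi / 2) < a * c) (h2 : a * (c + supportLength w α β) < Real.pi / 2) :
    a ^ 2 * ∫ θ in α..β, w θ ^ 2 ≤ (∫ θ in α..β, g θ ^ 2) +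
      a * (Real.tan (a * (c + supportLength w α β)) * w β ^ 2 - Real.tan (a * c) * w α ^ 2) := by
  have hgi : IntervalIntegrable g volume α β := by
    rw [intervalIntegrable_iff_integrableOn_Ioc_of_le hαβ]
    exact hg.integrable one_le_two
  have hg2 : IntervalIntegrable (fun θ => g θ ^ 2) volume α β := by
    rw [intervalIntegrable_iff_integrableOn_Ioc_of_le hαβ]
    exact hg.integrable_sq
  set χ : ℝ → ℝ := {t | w t ≠ 0}.indicator fun _ => (1 : ℝ) with hχ
  have hχi : IntervalIntegrable χ volume α β := intervalIntegrable_indicator_support hwc _ _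
  set M : ℝ → ℝ := fun θ => supportLength w α θ with hM
  set W : ℝ → ℝ := fun θ => w α + ∫ t in α..θ, g t with hW
  have hWw : ∀ θ ∈ Icc α β, W θ = w θ := fun θ hθ => by
    simp only [hW]; rw [← hw θ hθ]; ring
  set y : ℝ → ℝ := fun θ => a * (c + M θ) with hy
  set S : ℝ → ℝ := fun θ => Real.tan (y θ) with hS
  have hMdiff : ∀ s t, M t - M s = supportLength w s t := fun s t => by
    have := supportLength_add hwc α s t
    simp only [hM]; linarith
  have hyIcc : ∀ θ ∈ Icc α β, y θ ∈ Icc (a * c) (a * (c + M β)) := by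
    intro θ hθ
    have e1 : 0 ≤ M θ := supportLength_nonneg w hθ.1
    have e2 : 0 ≤ M β - M θ := by rw [hMdiff]; exact supportLength_nonneg w hθ.2
    constructor
    · exact mul_le_mul_of_nonneg_left (by linarith) ha.le
    · exact mul_le_mul_of_nonneg_left (by linarith) ha.le
  have hcos : ∀ z ∈ Icc (a * c) (a * (c + M β)), Real.cos z ≠ 0 := fun z hz =>
    (Real.cos_pos_of_mem_Ioo ⟨h1.trans_le hz.1, hz.2.trans_lt h2⟩).ne'
  have hSac : AbsolutelyContinuousOnInterval S α β := by
    have htan : ContDiffOn ℝ 1 Real.tan (Icc (a * c) (a * (c + M β))) := fun z hz =>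
      (Real.contDiffAt_tan.2 (hcos z hz)).contDiffWithinAt
    obtain ⟨K, hK⟩ := htan.exists_lipschitzOnWith one_ne_zero (convex_Icc _ _) isCompact_Icc
    have hyL : LipschitzOnWith (Real.toNNReal a) y (uIcc α β) := by
      refine LipschitzOnWith.of_dist_le_mul fun s _ t _ => ?_
      rw [Real.coe_toNNReal _ ha.le, Real.dist_eq, Real.dist_eq]
      have : y s - y t = a * (M s - M t) := by simp only [hy]; ring
      rw [this, abs_mul, abs_of_pos ha]
      refine mul_le_mul_of_nonneg_left ?_ ha.le
      rcases le_total s t with h | h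
      · rw [abs_sub_comm, hMdiff, abs_of_nonneg (supportLength_nonneg w h), abs_sub_comm s t,
          abs_of_nonneg (sub_nonneg.2 h)]
        exact supportLength_le w h
      · rw [hMdiff, abs_of_nonneg (supportLength_nonneg w h), abs_of_nonneg (sub_nonneg.2 h)]
        exact supportLength_le w h
    refine (hK.comp hyL ?_).absolutelyContinuousOnInterval
    rw [uIcc_of_le hαβ]
    exact hyIcc
  have hWac : AbsolutelyContinuousOnInterval W α β := by
    have e1 : AbsolutelyContinuousOnInterval (fun _ : ℝ => w α) α β :=
      (LipschitzWith.const (w α)).lipschitzOnWith.absolutelyContinuousOnInterval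
    exact e1.add (hgi.absolutelyContinuousOnInterval_intervalIntegral left_mem_uIcc)
  have hPac : AbsolutelyContinuousOnInterval (fun θ => S θ * (W θ * W θ)) α β :=
    hSac.fun_mul (hWac.fun_mul hWac)
  have hint := hPac.integral_deriv_eq_sub
  have hder : ∀ᵐ θ, θ ∈ Icc α β → a ^ 2 * w θ ^ 2 ≤
      g θ ^ 2 + a * deriv (fun θ => S θ * (W θ * W θ)) θ := by
    filter_upwards [hχi.ae_hasDerivAt_integral, hgi.ae_hasDerivAt_integral] with θ hθ1 hθ2 hθ
    have hθ' : θ ∈ uIcc α β := by rwa [uIcc_of_le hαβ]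
    have dM : HasDerivAt M (χ θ) θ := hθ1 hθ' α left_mem_uIcc
    have dW : HasDerivAt W (g θ) θ := (hθ2 hθ' α left_mem_uIcc).const_add (w α)
    have dy : HasDerivAt y (a * χ θ) θ := by
      simpa using! (dM.const_add c).const_mul a
    have dS := (Real.hasDerivAt_tan (hcos _ (hyIcc θ hθ))).comp θ dy
    have dP := (dS.mul (dW.mul dW)).deriv
    have e : deriv (fun θ => S θ * (W θ * W θ)) θ =
        (1 / Real.cos (y θ) ^ 2 * (a * χ θ)) * (W θ * W θ) + S θ * (g θ * W θ + W θ * g θ) := dP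
    have hχw : χ θ * (w θ * w θ) = w θ * w θ := by
      by_cases h0 : w θ = 0
      · simp [h0]
      · rw [hχ, indicator_of_mem (by exact h0), one_mul]
    have hsec : 1 / Real.cos (y θ) ^ 2 = 1 + S θ ^ 2 := by
      have := hcos _ (hyIcc θ hθ)
      simp only [hS, Real.tan_eq_sin_div_cos]
      field_simp
      linarith [Real.sin_sq_add_cos_sq (y θ)]
    rw [e, hWw θ hθ, hsec]
    have : (1 + S θ ^ 2) * (a * χ θ) * (w θ * w θ) = a * (1 + S θ ^ 2) * (w θ * w θ) := by
      linear_combination a * (1 + S θ ^ 2) * hχw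
    rw [this]
    nlinarith [sq_nonneg (g θ + a * S θ * w θ)]
  have hmono : ∫ θ in α..β, a ^ 2 * w θ ^ 2 ≤
      ∫ θ in α..β, (g θ ^ 2 + a * deriv (fun θ => S θ * (W θ * W θ)) θ) := by
    refine integral_mono_ae_restrict hαβ ?_ ?_ ?_
    · exact (by fun_prop : Continuous fun θ => a ^ 2 * w θ ^ 2).intervalIntegrable _ _
    · exact hg2.add (hPac.intervalIntegrable_deriv.const_mul a)
    · rw [EventuallyLE, ae_restrict_iff' measurableSet_Icc]
      exact hder
  rw [intervalIntegral.integral_const_mul, intervalIntegral.integral_add hg2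
    (hPac.intervalIntegrable_deriv.const_mul a), intervalIntegral.integral_const_mul, hint,
    hWw α (left_mem_Icc.2 hαβ), hWw β (right_mem_Icc.2 hαβ)] at hmono
  have hMα : M α = 0 := by simp [hM, supportLength]
  have hSα : S α = Real.tan (a * c) := by simp only [hS, hy, hMα, add_zero]
  have hSβ : S β = Real.tan (a * (c + supportLength w α β)) := rfl
  rw [hSα, hSβ] at hmono
  calc _ ≤ _ := hmono
    _ = _ := by ring

/-- Wirtinger inequality on the circle for a function with a zero, in terms of the length of its
support. The circle is cut at the zero. -/
theorem sq_pi_div_supportLength_mul_integral_sq_le {w g : ℝ → ℝ} (hwc : Continuous w)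
    (hw : ∀ a ∈ Icc (-Real.pi) Real.pi, ∀ b ∈ Icc (-Real.pi) Real.pi,
      w b - w a = ∫ t in a..b, g t)
    (hg : MemLp g 2 (volume.restrict (Ioc (-Real.pi) Real.pi)))
    (hper : w (-Real.pi) = w Real.pi) {z : ℝ} (hz : z ∈ Icc (-Real.pi) Real.pi) (hwz : w z = 0)
    (hl : 0 < supportLength w (-Real.pi) Real.pi) :
    (Real.pi / supportLength w (-Real.pi) Real.pi) ^ 2 * ∫ θ in -Real.pi..Real.pi, w θ ^ 2 ≤
      ∫ θ in -Real.pi..Real.pi, g θ ^ 2 := by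
  have hπ := Real.pi_pos
  set l := supportLength w (-Real.pi) Real.pi with hldef
  have hsum : supportLength w (-Real.pi) z + supportLength w z Real.pi = l :=
    supportLength_add hwc _ _ _
  set m₁ := supportLength w z Real.pi with hm₁
  set m₂ := supportLength w (-Real.pi) z with hm₂
  have hm₁0 : 0 ≤ m₁ := supportLength_nonneg w hz.2
  have hm₂0 : 0 ≤ m₂ := supportLength_nonneg w hz.1
  have hgr : MemLp g 2 (volume.restrict (Ioc z Real.pi)) :=
    hg.mono_measure (Measure.restrict_mono (Ioc_subset_Ioc_left hz.1) le_rfl)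
  have hgl : MemLp g 2 (volume.restrict (Ioc (-Real.pi) z)) :=
    hg.mono_measure (Measure.restrict_mono (Ioc_subset_Ioc_right hz.2) le_rfl)
  have hg2 : ∀ {p q : ℝ}, p ≤ q → MemLp g 2 (volume.restrict (Ioc p q)) →
      IntervalIntegrable (fun θ => g θ ^ 2) volume p q := fun hpq h => by
    rw [intervalIntegrable_iff_integrableOn_Ioc_of_le hpq]
    exact h.integrable_sq
  have hw2 : ∀ p q : ℝ, IntervalIntegrable (fun θ => w θ ^ 2) volume p q := fun p q =>
    (by fun_prop : Continuous fun θ => w θ ^ 2).intervalIntegrable _ _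
  -- below the frequency `π / l` the phase, which runs from `-a l / 2` to `a l / 2`, has a finite
  -- tangent; the boundary terms at `±π` cancel and those at `z` vanish
  have key : ∀ a ∈ Ioo 0 (Real.pi / l), a ^ 2 * ∫ θ in -Real.pi..Real.pi, w θ ^ 2 ≤
      ∫ θ in -Real.pi..Real.pi, g θ ^ 2 := by
    intro a ha
    have hal : a * l < Real.pi := (lt_div_iff₀ hl).1 ha.2
    have b1 := sq_mul_integral_sq_le (c := -(l / 2)) hz.2 ha.1 hwc
      (fun θ hθ => hw z hz θ ⟨hz.1.trans hθ.1, hθ.2⟩) hgr (by nlinarith) (by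
        rw [← hm₁]; nlinarith [mul_nonneg ha.1.le hm₂0])
    have b2 := sq_mul_integral_sq_le (c := -(l / 2) + m₁) hz.1 ha.1 hwc
      (fun θ hθ => hw _ ⟨le_rfl, by linarith⟩ θ ⟨hθ.1, hθ.2.trans hz.2⟩) hgl
      (by nlinarith [mul_nonneg ha.1.le hm₁0]) (by
        rw [← hm₂, show -(l / 2) + m₁ + m₂ = l / 2 by linarith]; linarith)
    rw [← hm₁, hwz] at b1
    rw [← hm₂, hwz] at b2
    rw [← integral_add_adjacent_intervals (hw2 _ z) (hw2 z _),
      ← integral_add_adjacent_intervals (hg2 hz.1 hgl) (hg2 hz.2 hgr), mul_add]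
    rw [hper] at b2
    linarith
  have hlim : Tendsto (fun a : ℝ => a ^ 2 * ∫ θ in -Real.pi..Real.pi, w θ ^ 2)
      (𝓝[<] (Real.pi / l)) (𝓝 ((Real.pi / l) ^ 2 * ∫ θ in -Real.pi..Real.pi, w θ ^ 2)) :=
    (Continuous.tendsto (by fun_prop) _).mono_left nhdsWithin_le_nhds
  refine le_of_tendsto hlim ?_
  filter_upwards [Ioo_mem_nhdsLT (div_pos hπ hl)] with a ha using key a ha

end Wirtinger

/-! ### Flux and energy on a circle -/

section CircleEstimate

open Filter Topology Set

/-- Splitting the energy density into the normal flux and the tangential derivative. The two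
constants are the bounds for `A ν · ν` and for `det A / (A ν · ν)`. -/
theorem EllipticClass.sq_div_add_le {lam L : ℝ}
    {A : EuclideanSpace ℝ (Fin 2) → Matrix (Fin 2) (Fin 2) ℝ} (hA : EllipticClass lam L A)
    (hlam : 0 < lam) (x v : EuclideanSpace ℝ (Fin 2)) (θ : ℝ) :
    inner ℝ (Matrix.toEuclideanLin (A x) v) (radialDir θ) ^ 2 / L +
      lam * inner ℝ v (angularDir θ) ^ 2 ≤ inner ℝ (Matrix.toEuclideanLin (A x) v) v := by
  set T := Matrix.toEuclideanLin (A x) with hT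
  set α := inner ℝ (T (radialDir θ)) (radialDir θ) with hα
  set β := inner ℝ (T (radialDir θ)) (angularDir θ) with hβ
  set γ := inner ℝ (T (angularDir θ)) (angularDir θ) with hγ
  have hβ' : inner ℝ (T (angularDir θ)) (radialDir θ) = β := hA.inner_comm x _ _
  set p := inner ℝ v (radialDir θ)
  set q := inner ℝ v (angularDir θ)
  have hv : v = p • radialDir θ + q • angularDir θ := eq_inner_smul_add_inner_smul θ v
  have e1 : inner ℝ (T v) (radialDir θ) = p * α + q * β := by
    rw [hv]
    simp only [map_add, map_smul, inner_add_left, inner_smul_left, conj_trivial, hβ']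
    rfl
  have e2 : inner ℝ (T v) v = p ^ 2 * α + 2 * (p * q * β) + q ^ 2 * γ := by
    nth_rewrite 1 2 [hv]
    simp only [map_add, map_smul, inner_add_left, inner_smul_left, inner_add_right,
      inner_smul_right, conj_trivial, hβ']
    simp only [← hα, ← hβ, ← hγ]
    ring
  have hα1 : lam ≤ α := by
    have := hA.lower x (radialDir θ)
    rwa [norm_radialDir, one_pow, mul_one] at this
  have hα2 : α ≤ L := by
    have := hA.upper x (radialDir θ)
    rwa [norm_radialDir, one_pow, mul_one] at this
  have hα0 : 0 < α := hlam.trans_le hα1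
  have hdet : lam * α ≤ α * γ - β ^ 2 := by
    have h1 := hA.lower x ((-β) • radialDir θ + α • angularDir θ)
    have h2 : ‖(-β) • radialDir θ + α • angularDir θ‖ ^ 2 = β ^ 2 + α ^ 2 := by
      rw [← real_inner_self_eq_norm_sq]
      simp only [inner_add_left, inner_smul_left, inner_add_right, inner_smul_right, conj_trivial,
        inner_radialDir_self, inner_angularDir_self, inner_radialDir_angularDir,
        real_inner_comm (radialDir θ) (angularDir θ)]
      ring
    rw [h2] at h1
    simp only [map_add, map_smul, inner_add_left, inner_smul_left, inner_add_right,
      inner_smul_right, conj_trivial] at h1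
    rw [← hT, hβ', ← hα, ← hβ, ← hγ] at h1
    have h3 : (lam * α) * α ≤ (α * γ - β ^ 2) * α := by nlinarith [mul_nonneg hlam.le (sq_nonneg β)]
    exact le_of_mul_le_mul_right h3 hα0
  rw [e1, e2]
  have h4 : (p * α + q * β) ^ 2 / L ≤ (p * α + q * β) ^ 2 / α := by gcongr
  have h5 : (p * α + q * β) ^ 2 / α + lam * q ^ 2 ≤ p ^ 2 * α + 2 * (p * q * β) + q ^ 2 * γ := by
    rw [div_add' _ _ _ hα0.ne', div_le_iff₀ hα0]
    nlinarith [mul_le_mul_of_nonneg_left hdet (sq_nonneg q)]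
  linarith

namespace IsPlanarSubsolution

variable {lam L : ℝ} {A : EuclideanSpace ℝ (Fin 2) → Matrix (Fin 2) (Fin 2) ℝ}
  {u : EuclideanSpace ℝ (Fin 2) → ℝ} {G : EuclideanSpace ℝ (Fin 2) → EuclideanSpace ℝ (Fin 2)}

theorem continuous_circle (h : IsPlanarSubsolution lam L A u G) (r : ℝ) :
    Continuous fun θ => u (polarPoint r θ) :=
  h.continuous.comp (continuous_polarPoint.comp (continuous_const.prodMk continuous_id))

/-- On almost every circle, the normal flux `p` and the tangential derivative `g` of `u` (with
respect to the angle) are square integrable and controlled by the energy. -/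
theorem ae_circle (h : IsPlanarSubsolution lam L A u G) (R : ℝ) :
    ∀ᵐ r, r ∈ Ioo 0 R → ∃ p g : ℝ → ℝ,
      MemLp p 2 (volume.restrict (Ioo (-Real.pi) Real.pi)) ∧
      MemLp g 2 (volume.restrict (Ioo (-Real.pi) Real.pi)) ∧
      (∀ a ∈ Icc (-Real.pi) Real.pi, ∀ b ∈ Icc (-Real.pi) Real.pi,
        u (polarPoint r b) - u (polarPoint r a) = ∫ θ in a..b, g θ) ∧
      circleFlux A u G r = ∫ θ in Ioo (-Real.pi) Real.pi, u (polarPoint r θ) * p θ ∧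
      (∫ θ in Ioo (-Real.pi) Real.pi, p θ ^ 2) / L +
        lam * (∫ θ in Ioo (-Real.pi) Real.pi, g θ ^ 2) ≤ r * circleEnergy A G r := by
  have h1 := (ae_restrict_iff' measurableSet_Ioo).1 (h.memL2loc_flux.ae_memLp_circle R)
  have h2 := (ae_restrict_iff' measurableSet_Ioo).1
    (h.weakGradient.grad_memL2loc.ae_memLp_circle R)
  have h3 := (ae_restrict_iff' measurableSet_Ioo).1
    (h.weakGradient.ae_sub_eq_integral h.continuous R)
  filter_upwards [h1, h2, h3] with r h1 h2 h3 hr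
  replace h1 := h1 hr
  replace h2 := h2 hr
  set H : ℝ → EuclideanSpace ℝ (Fin 2) := fun θ =>
    Matrix.toEuclideanLin (A (polarPoint r θ)) (G (polarPoint r θ)) with hH
  have hp : MemLp (fun θ => r * inner ℝ (H θ) (radialDir θ)) 2
      (volume.restrict (Ioo (-Real.pi) Real.pi)) := by
    refine MemLp.const_mul (h1.mono (h1.1.inner continuous_radialDir.aestronglyMeasurable) ?_) r
    refine Eventually.of_forall fun θ => (norm_inner_le_norm (𝕜 := ℝ) _ _).trans ?_
    rw [norm_radialDir, mul_one]
  have hg : MemLp (fun θ => r * inner ℝ (G (polarPoint r θ)) (angularDir θ)) 2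
      (volume.restrict (Ioo (-Real.pi) Real.pi)) := by
    refine MemLp.const_mul (h2.mono (h2.1.inner continuous_angularDir.aestronglyMeasurable) ?_) r
    refine Eventually.of_forall fun θ => (norm_inner_le_norm (𝕜 := ℝ) _ _).trans ?_
    rw [norm_angularDir, mul_one]
  refine ⟨_, _, hp, hg, h3 hr, ?_, ?_⟩
  · rw [circleFlux]
    refine integral_congr_ae (Eventually.of_forall fun θ => ?_)
    simp only [hH]
    ring
  · have he := (h1.integrable_inner h2).const_mul (r * r)
    rw [circleEnergy, ← integral_const_mul, ← integral_div, ← integral_const_mul,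
      ← integral_add (hp.integrable_sq.div_const L) (hg.integrable_sq.const_mul lam)]
    refine integral_mono ((hp.integrable_sq.div_const L).add (hg.integrable_sq.const_mul lam))
      (by simpa only [mul_assoc] using he) fun θ => ?_
    have := h.elliptic.sq_div_add_le h.lam_pos (polarPoint r θ) (G (polarPoint r θ)) θ
    calc (r * inner ℝ (H θ) (radialDir θ)) ^ 2 / L +
          lam * (r * inner ℝ (G (polarPoint r θ)) (angularDir θ)) ^ 2
        = r ^ 2 * (inner ℝ (H θ) (radialDir θ) ^ 2 / L +
          lam * inner ℝ (G (polarPoint r θ)) (angularDir θ) ^ 2) := by ring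
      _ ≤ r ^ 2 * inner ℝ (H θ) (G (polarPoint r θ)) :=
          mul_le_mul_of_nonneg_left this (sq_nonneg r)
      _ = _ := by simp only [hH]; ring

/-- The flux through a circle is bounded by the energy on it and the length of the part of the
circle on which `u` is positive, provided that `u` has a zero on the circle. -/
theorem ae_circleFlux_le_circleEnergy (h : IsPlanarSubsolution lam L A u G) (R : ℝ) :
    ∀ᵐ r, r ∈ Ioo 0 R →
      (∃ z ∈ Icc (-Real.pi) Real.pi, u (polarPoint r z) = 0) →
      0 < supportLength (fun θ => u (polarPoint r θ)) (-Real.pi) Real.pi →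
      2 * Real.sqrt (lam / L) *
        (Real.pi / supportLength (fun θ => u (polarPoint r θ)) (-Real.pi) Real.pi) *
        circleFlux A u G r ≤ r * circleEnergy A G r := by
  filter_upwards [h.ae_circle R] with r hr hrR ⟨z, hz, hz0⟩ hl
  obtain ⟨p, g, hp, hg, hw, hF, hE⟩ := hr hrR
  have hπ := Real.pi_pos
  have hLpos : 0 < L := h.lam_pos.trans_le h.lam_le
  have hwc := h.continuous_circle r
  have hper : u (polarPoint r (-Real.pi)) = u (polarPoint r Real.pi) := by
    congr 1
    simp [polarPoint]
  have hW := sq_pi_div_supportLength_mul_integral_sq_le hwc hw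
    (by rwa [restrict_Ioo_eq_restrict_Ioc] at hg) hper hz hz0 hl
  set a := Real.pi / supportLength (fun θ => u (polarPoint r θ)) (-Real.pi) Real.pi with ha
  rw [intervalIntegral.integral_of_le (by linarith), intervalIntegral.integral_of_le (by linarith),
    ← restrict_Ioo_eq_restrict_Ioc] at hW
  set κ := Real.sqrt (lam / L) with hκ
  have hκ2 : κ ^ 2 * L = lam := by
    rw [hκ, Real.sq_sqrt (div_nonneg h.lam_pos.le hLpos.le)]
    field_simp
  have hwL : MemLp (fun θ => u (polarPoint r θ)) 2 (volume.restrict (Ioo (-Real.pi) Real.pi)) := by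
    obtain ⟨M, hM⟩ := (isCompact_Icc (a := -Real.pi) (b := Real.pi)).exists_bound_of_continuousOn
      hwc.continuousOn
    refine MemLp.of_bound hwc.aestronglyMeasurable M ?_
    filter_upwards [ae_restrict_mem measurableSet_Ioo] with θ hθ using hM θ (Ioo_subset_Icc_self hθ)
  have hwp : Integrable (fun θ => u (polarPoint r θ) * p θ)
      (volume.restrict (Ioo (-Real.pi) Real.pi)) := hwL.integrable_mul hp
  have hkey : 2 * κ * a * circleFlux A u G r ≤
      (∫ θ in Ioo (-Real.pi) Real.pi, p θ ^ 2) / L +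
        lam * a ^ 2 * (∫ θ in Ioo (-Real.pi) Real.pi, u (polarPoint r θ) ^ 2) := by
    rw [hF, ← integral_const_mul, ← integral_div, ← integral_const_mul,
      ← integral_add (hp.integrable_sq.div_const L) (hwL.integrable_sq.const_mul _)]
    refine integral_mono (hwp.const_mul _)
      ((hp.integrable_sq.div_const L).add (hwL.integrable_sq.const_mul _)) fun θ => ?_
    have h0 : 0 ≤ (p θ - L * κ * a * u (polarPoint r θ)) ^ 2 / L := by positivity
    have h1 : (p θ - L * κ * a * u (polarPoint r θ)) ^ 2 / L = p θ ^ 2 / L +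
        (κ ^ 2 * L) * a ^ 2 * u (polarPoint r θ) ^ 2 - 2 * κ * a * (u (polarPoint r θ) * p θ) := by
      field_simp
      ring
    rw [h1, hκ2] at h0
    linarith
  have := mul_le_mul_of_nonneg_left hW h.lam_pos.le
  linarith

/-- The flux through a circle in terms of the energy on it and of a bound for `u`. -/
theorem ae_sq_circleFlux_le (h : IsPlanarSubsolution lam L A u G) (R : ℝ) :
    ∀ᵐ r, r ∈ Ioo 0 R → ∀ B : ℝ, (∀ θ, u (polarPoint r θ) ≤ B) →
      circleFlux A u G r ^ 2 ≤ (2 * Real.pi * B ^ 2) * (L * (r * circleEnergy A G r)) := by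
  filter_upwards [h.ae_circle R] with r hr hrR B hB
  obtain ⟨p, g, hp, hg, hw, hF, hE⟩ := hr hrR
  have hπ := Real.pi_pos
  have hLpos : 0 < L := h.lam_pos.trans_le h.lam_le
  have hwc := h.continuous_circle r
  have hB0 : 0 ≤ B := (h.nonneg _).trans (hB 0)
  have hp2 : ∫ θ in Ioo (-Real.pi) Real.pi, p θ ^ 2 ≤ L * (r * circleEnergy A G r) := by
    have hg0 : 0 ≤ lam * ∫ θ in Ioo (-Real.pi) Real.pi, g θ ^ 2 :=
      mul_nonneg h.lam_pos.le (integral_nonneg fun _ => sq_nonneg _)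
    rw [← div_le_iff₀' hLpos]
    linarith
  have hpi : Integrable p (volume.restrict (Ioo (-Real.pi) Real.pi)) := hp.integrable one_le_two
  have hF1 : |circleFlux A u G r| ≤ B * ∫ θ in Ioo (-Real.pi) Real.pi, |p θ| := by
    rw [hF, ← integral_const_mul]
    refine norm_integral_le_of_norm_le (f := fun θ => u (polarPoint r θ) * p θ)
      (hpi.abs.const_mul B) (Eventually.of_forall fun θ => ?_)
    rw [norm_mul, Real.norm_eq_abs, Real.norm_eq_abs, abs_of_nonneg (h.nonneg _)]
    exact mul_le_mul_of_nonneg_right (hB θ) (abs_nonneg _)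
  have hF2 : (∫ θ in Ioo (-Real.pi) Real.pi, |p θ|) ^ 2 ≤
      (2 * Real.pi) * ∫ θ in Ioo (-Real.pi) Real.pi, p θ ^ 2 := by
    set I := ∫ θ in Ioo (-Real.pi) Real.pi, |p θ| with hI
    -- the variance of `|p|` is nonnegative
    have h0 : 0 ≤ ∫ θ in Ioo (-Real.pi) Real.pi, (|p θ| - I / (2 * Real.pi)) ^ 2 :=
      integral_nonneg fun _ => sq_nonneg _
    have h1 : ∫ θ in Ioo (-Real.pi) Real.pi, (|p θ| - I / (2 * Real.pi)) ^ 2 =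
        (∫ θ in Ioo (-Real.pi) Real.pi, p θ ^ 2) - 2 * (I / (2 * Real.pi)) * I +
          (I / (2 * Real.pi)) ^ 2 * (2 * Real.pi) := by
      have e : ∀ θ, (|p θ| - I / (2 * Real.pi)) ^ 2 =
          p θ ^ 2 - 2 * (I / (2 * Real.pi)) * |p θ| + (I / (2 * Real.pi)) ^ 2 := fun θ => by
        rw [sub_sq, sq_abs]; ring
      simp only [e]
      have hi : Integrable (fun θ => p θ ^ 2 - 2 * (I / (2 * Real.pi)) * |p θ|)
          (volume.restrict (Ioo (-Real.pi) Real.pi)) :=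
        hp.integrable_sq.sub (hpi.abs.const_mul _)
      rw [integral_add hi (integrable_const _),
        integral_sub hp.integrable_sq (hpi.abs.const_mul _), integral_const_mul, ← hI]
      simp
      rw [max_eq_left (by linarith)]
      ring
    rw [h1] at h0
    have h2 : 2 * (I / (2 * Real.pi)) * I - (I / (2 * Real.pi)) ^ 2 * (2 * Real.pi) =
        I ^ 2 / (2 * Real.pi) := by
      field_simp; ring
    have h3 : I ^ 2 / (2 * Real.pi) ≤ ∫ θ in Ioo (-Real.pi) Real.pi, p θ ^ 2 := by linarith
    rwa [div_le_iff₀' (by positivity)] at h3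
  calc circleFlux A u G r ^ 2 = |circleFlux A u G r| ^ 2 := (sq_abs _).symm
    _ ≤ (B * ∫ θ in Ioo (-Real.pi) Real.pi, |p θ|) ^ 2 := by gcongr
    _ = B ^ 2 * (∫ θ in Ioo (-Real.pi) Real.pi, |p θ|) ^ 2 := by ring
    _ ≤ B ^ 2 * ((2 * Real.pi) * (L * (r * circleEnergy A G r))) := by
        gcongr
        exact hF2.trans (by gcongr)
    _ = _ := by ring

theorem exists_ne_zero_of_circleFlux_pos {r : ℝ} (h : 0 < circleFlux A u G r) :
    ∃ θ ∈ Ioo (-Real.pi) Real.pi, u (polarPoint r θ) ≠ 0 := by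
  by_contra! hne
  refine h.ne' (setIntegral_eq_zero_of_forall_eq_zero fun θ hθ => ?_)
  rw [hne θ hθ]
  simp

theorem supportLength_pos (h : IsPlanarSubsolution lam L A u G) {r : ℝ}
    (hF : 0 < circleFlux A u G r) :
    0 < supportLength (fun θ => u (polarPoint r θ)) (-Real.pi) Real.pi := by
  have hπ := Real.pi_pos
  refine lt_of_le_of_ne (supportLength_nonneg _ (by linarith)) fun h0 => hF.ne' ?_
  rw [supportLength, intervalIntegral.integral_of_le (by linarith), eq_comm,
    integral_eq_zero_iff_of_nonneg (fun _ => indicator_nonneg (fun _ _ => zero_le_one) _)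
      ((intervalIntegrable_iff_integrableOn_Ioc_of_le (by linarith)).1
        (intervalIntegrable_indicator_support (h.continuous_circle r) _ _)),
    ← restrict_Ioo_eq_restrict_Ioc] at h0
  refine integral_eq_zero_of_ae ?_
  filter_upwards [h0] with θ hθ
  have : u (polarPoint r θ) = 0 := by
    by_contra hne
    rw [indicator_of_mem (by exact hne)] at hθ
    exact one_ne_zero hθ
  simp [this]

end IsPlanarSubsolution

end CircleEstimate

/-! ### Growth of the energy -/

section Growth

open Filter Topology Set

theorem MonotoneOn.integral_le_sub {f φ : ℝ → ℝ} {a b : ℝ} (hab : a ≤ b)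
    (hf : MonotoneOn f (Icc a b)) (hφ : IntervalIntegrable φ volume a b)
    (hd : ∀ᵐ x, x ∈ Ioo a b → φ x ≤ deriv f x) : ∫ x in a..b, φ x ≤ f b - f a := by
  rw [← uIcc_of_le hab] at hf
  have h1 := hf.intervalIntegral_deriv_mem_uIcc
  have h2 : f a ≤ f b := hf left_mem_uIcc right_mem_uIcc hab
  rw [uIcc_of_le (sub_nonneg.2 h2)] at h1
  refine le_trans ?_ h1.2
  refine intervalIntegral.integral_mono_ae_restrict hab hφ hf.intervalIntegrable_deriv ?_
  rw [← restrict_Ioo_eq_restrict_Icc]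
  exact (ae_restrict_iff' measurableSet_Ioo).2 hd

namespace IsPlanarSubsolution

variable {lam L : ℝ} {A : EuclideanSpace ℝ (Fin 2) → Matrix (Fin 2) (Fin 2) ℝ}
  {u : EuclideanSpace ℝ (Fin 2) → ℝ} {G : EuclideanSpace ℝ (Fin 2) → EuclideanSpace ℝ (Fin 2)}

/-- A subsolution of growth at most `|x|^γ` has energy of growth at most `R^{2γ}`: the differential
inequality `D² ≤ c r^{2γ+1} D'` bounds `-1 / D` from below on `[R, 2R]`. -/
theorem exists_diskEnergy_le_rpow (h : IsPlanarSubsolution lam L A u G) {γ C : ℝ} (hγ : 0 < γ)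
    (hC : 0 < C) (hu : ∀ x, u x ≤ C * (1 + ‖x‖ ^ γ)) {s : ℝ} (hs : 1 ≤ s)
    (hD : 0 < diskEnergy A G s) :
    ∃ K, 0 < K ∧ ∀ R, s ≤ R → diskEnergy A G R ≤ K * R ^ (2 * γ) := by
  have hLpos : 0 < L := h.lam_pos.trans_le h.lam_le
  have hπ := Real.pi_pos
  set c := 2 * Real.pi * (2 * C) ^ 2 * L with hc
  have hc0 : 0 < c := by positivity
  refine ⟨c * 2 ^ (2 * γ + 1), by positivity, fun R hR => ?_⟩
  have hR0 : 0 < R := by linarith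
  have hR2 : R ≤ 2 * R := by linarith
  set D := diskEnergy A G with hDdef
  have hDpos : ∀ r, s ≤ r → 0 < D r := fun r hr => hD.trans_le (h.diskEnergy_mono hr)
  have hmono : MonotoneOn (fun r => -(D r)⁻¹) (Icc R (2 * R)) := by
    intro r hr t ht hrt
    have h1 := hDpos r (hR.trans hr.1)
    have h2 : D r ≤ D t := h.diskEnergy_mono hrt
    simp only [neg_le_neg_iff]
    exact inv_anti₀ h1 h2
  have hint := hmono.integral_le_sub hR2
    (φ := fun _ => (c * (2 * R) ^ (2 * γ + 1))⁻¹) intervalIntegrable_const ?_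
  · have hD2 := inv_pos.2 (hDpos (2 * R) (by linarith))
    have hDR := hDpos R hR
    rw [intervalIntegral.integral_const, smul_eq_mul] at hint
    have h1 : R * (c * (2 * R) ^ (2 * γ + 1))⁻¹ ≤ (D R)⁻¹ := by
      have : 2 * R - R = R := by ring
      rw [this] at hint
      linarith
    have hX : 0 < (2 * R) ^ (2 * γ + 1) := by positivity
    have h2 : D R * R ≤ c * (2 * R) ^ (2 * γ + 1) := by
      rw [← div_eq_mul_inv, le_inv_comm₀ (by positivity) hDR, inv_div, le_div_iff₀ hR0] at h1
      exact h1
    have h3 : (2 * R) ^ (2 * γ + 1) = 2 ^ (2 * γ + 1) * R ^ (2 * γ) * R := by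
      rw [Real.mul_rpow zero_le_two hR0.le, Real.rpow_add_one hR0.ne' (2 * γ)]
      ring
    refine le_of_mul_le_mul_right ?_ hR0
    calc D R * R ≤ _ := h2
      _ = _ := by rw [h3]; ring
  · filter_upwards [h.ae_hasDerivAt_diskEnergy (2 * R), h.ae_diskEnergy_le_circleFlux (2 * R),
      h.ae_sq_circleFlux_le (2 * R)] with r hr1 hr2 hr3 hr
    have hr0 : 0 < r := hR0.trans hr.1
    have hr' : r ∈ Ioo 0 (2 * R) := ⟨hr0, hr.2⟩
    have hDr := hDpos r (hR.trans hr.1.le)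
    have hr1' : 1 ≤ r := by linarith [hr.1]
    have hder : deriv (fun r => -(D r)⁻¹) r = circleEnergy A G r / D r ^ 2 := by
      have := ((hr1 hr').inv hDr.ne').neg.deriv
      rw [show (fun r => -(D r)⁻¹) = -D⁻¹ from rfl, this]
      ring
    rw [hder]
    have hF := hr3 hr' (2 * C * r ^ γ) fun θ => by
      refine (hu _).trans ?_
      rw [norm_polarPoint, abs_of_pos hr0]
      have : 1 ≤ r ^ γ := Real.one_le_rpow hr1' hγ.le
      nlinarith
    have hDF : D r ^ 2 ≤ circleFlux A u G r ^ 2 := by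
      have := hr2 hr'
      gcongr
    have e1 : 2 * Real.pi * (2 * C * r ^ γ) ^ 2 * (L * (r * circleEnergy A G r)) =
        c * r ^ (2 * γ + 1) * circleEnergy A G r := by
      rw [Real.rpow_add_one hr0.ne', mul_comm 2 γ, Real.rpow_mul hr0.le, hc]
      norm_cast
      ring
    rw [e1] at hF
    have hX : 0 < c * r ^ (2 * γ + 1) := by positivity
    have hE : 0 ≤ circleEnergy A G r := by
      have h0 : 0 ≤ c * r ^ (2 * γ + 1) * circleEnergy A G r := (sq_nonneg _).trans hF
      exact nonneg_of_mul_nonneg_right h0 hX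
    calc (c * (2 * R) ^ (2 * γ + 1))⁻¹ ≤ (c * r ^ (2 * γ + 1))⁻¹ := by
          have := hr.2.le
          gcongr
      _ ≤ circleEnergy A G r / D r ^ 2 := by
          rw [le_div_iff₀ (by positivity), inv_mul_le_iff₀ hX]
          exact hDF.trans hF

/-- A nontrivial subsolution vanishing at the origin has positive energy on large discs. -/
theorem exists_diskEnergy_pos (h : IsPlanarSubsolution lam L A u G) (h0 : u 0 = 0)
    (hne : ∃ x, u x ≠ 0) : ∃ r, 0 < diskEnergy A G r := by
  by_contra! hD
  obtain ⟨x, hx⟩ := hne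
  refine hx ?_
  rw [← h0]
  refine h.weakGradient.eq_of_ae_eq_zero h.continuous ?_ x 0
  have hz : ∀ k : ℕ, G =ᵐ[volume.restrict (Metric.ball 0 (k : ℝ))] 0 := by
    intro k
    have h1 : diskEnergy A G k = 0 := le_antisymm (hD k) (h.diskEnergy_nonneg k)
    rw [diskEnergy, integral_eq_zero_iff_of_nonneg h.energy_nonneg
      (h.integrableOn_energy_ball k)] at h1
    filter_upwards [h1] with y hy
    have h2 := h.elliptic.lower y (G y)
    have hy' : inner ℝ (Matrix.toEuclideanLin (A y) (G y)) (G y) = 0 := hy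
    rw [hy'] at h2
    have h3 : ‖G y‖ ^ 2 ≤ 0 := by
      by_contra! hpos
      exact absurd h2 (not_le.2 (mul_pos h.lam_pos hpos))
    simpa using h3
  have hun := (ae_restrict_iUnion_iff
    (fun k : ℕ => Metric.ball (0 : EuclideanSpace ℝ (Fin 2)) (k : ℝ))
    (fun y => G y = (0 : EuclideanSpace ℝ (Fin 2) → EuclideanSpace ℝ (Fin 2)) y)).2 hz
  rwa [Metric.iUnion_ball_nat, Measure.restrict_univ] at hun

end IsPlanarSubsolution

/-- The supports of the traces of a segregated family on a circle have total length at most that of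
the circle. -/
theorem sum_supportLength_le {m : ℕ} {w : Fin m → ℝ → ℝ} (hw : ∀ i, Continuous (w i))
    (hdis : ∀ i j, i ≠ j → ∀ t, w i t ≠ 0 → w j t = 0) {a b : ℝ} (hab : a ≤ b) :
    ∑ i, supportLength (w i) a b ≤ b - a := by
  unfold supportLength
  rw [← intervalIntegral.integral_finsetSum
    fun i _ => intervalIntegrable_indicator_support (hw i) a b]
  have h1 : ∫ _ in a..b, (1 : ℝ) = b - a := by simp
  rw [← h1]
  have hi := IntervalIntegrable.sum Finset.univ
    fun i _ => intervalIntegrable_indicator_support (hw i) a b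
  rw [Finset.sum_fn] at hi
  refine intervalIntegral.integral_mono_on hab hi
    intervalIntegrable_const fun t _ => ?_
  by_cases hex : ∃ i, w i t ≠ 0
  · obtain ⟨i, hi⟩ := hex
    rw [Finset.sum_eq_single i]
    · exact indicator_le_self' (fun _ _ => zero_le_one) t
    · intro j _ hji
      exact indicator_of_notMem (not_not.2 (hdis i j hji.symm t hi)) _
    · simp
  · push Not at hex
    rw [Finset.sum_eq_zero fun i _ => indicator_of_notMem (not_not.2 (hex i)) _]
    exact zero_le_one

/-- The differential inequality behind the monotonicity of `r^{-2 m k*} ∏ D_i(r)`, where the `D_i`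
are the disc energies. -/
theorem ae_le_sum_circleEnergy_div {m : ℕ} (hm : 2 ≤ m) {lam L : ℝ}
    {A : EuclideanSpace ℝ (Fin 2) → Matrix (Fin 2) (Fin 2) ℝ}
    {u : Fin m → EuclideanSpace ℝ (Fin 2) → ℝ}
    {G : Fin m → EuclideanSpace ℝ (Fin 2) → EuclideanSpace ℝ (Fin 2)}
    (h : ∀ i, IsPlanarSubsolution lam L A (u i) (G i))
    (hdis : ∀ i j, i ≠ j → ∀ x, u i x ≠ 0 → u j x = 0) (R : ℝ) :
    ∀ᵐ r, r ∈ Ioo 0 R → (∀ i, 0 < diskEnergy A (G i) r) →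
      2 * m * kStar m lam L / r ≤ ∑ i, circleEnergy A (G i) r / diskEnergy A (G i) r := by
  have hπ := Real.pi_pos
  have hnt : Nontrivial (Fin m) := Fin.nontrivial_iff_two_le.2 hm
  filter_upwards [ae_all_iff.2 fun i => (h i).ae_diskEnergy_le_circleFlux R,
    ae_all_iff.2 fun i => (h i).ae_circleFlux_le_circleEnergy R] with r hr1 hr2 hr hD
  have hF : ∀ i, 0 < circleFlux A (u i) (G i) r := fun i => (hD i).trans_le (hr1 i hr)
  set l : Fin m → ℝ := fun i =>
    supportLength (fun θ => u i (polarPoint r θ)) (-Real.pi) Real.pi with hl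
  have hl0 : ∀ i, 0 < l i := fun i => (h i).supportLength_pos (hF i)
  have hlsum : ∑ i, l i ≤ 2 * Real.pi := by
    have := sum_supportLength_le (fun i => (h i).continuous_circle r)
      (fun i j hij t => hdis i j hij (polarPoint r t)) (show -Real.pi ≤ Real.pi by linarith)
    linarith
  set κ := Real.sqrt (lam / L) with hκ
  have hκ0 : 0 ≤ κ := Real.sqrt_nonneg _
  have hterm : ∀ i, (2 * κ * Real.pi / r) * (1 / l i) ≤
      circleEnergy A (G i) r / diskEnergy A (G i) r := by
    intro i
    obtain ⟨j, hj⟩ := exists_ne i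
    obtain ⟨z, hz, hzj⟩ := IsPlanarSubsolution.exists_ne_zero_of_circleFlux_pos (hF j)
    have h1 := hr2 i hr ⟨z, Ioo_subset_Icc_self hz, hdis j i hj _ hzj⟩ (hl0 i)
    rw [le_div_iff₀ (hD i)]
    have h2 : 2 * κ * (Real.pi / l i) * diskEnergy A (G i) r ≤ r * circleEnergy A (G i) r := by
      refine le_trans ?_ h1
      have := hr1 i hr
      have := hl0 i
      gcongr
    have h3 : (2 * κ * Real.pi / r) * (1 / l i) * diskEnergy A (G i) r =
        (2 * κ * (Real.pi / l i) * diskEnergy A (G i) r) / r := by ring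
    rw [h3, div_le_iff₀' hr.1]
    exact h2
  have hsum : (m : ℝ) ^ 2 / (2 * Real.pi) ≤ ∑ i, 1 / l i := by
    have h1 := Finset.sq_sum_div_le_sum_sq_div Finset.univ (fun _ : Fin m => (1 : ℝ))
      (g := l) fun i _ => hl0 i
    simp only [Finset.sum_const, Finset.card_univ, Fintype.card_fin, nsmul_eq_mul, mul_one,
      one_pow] at h1
    have hpos : 0 < ∑ i, l i := Finset.sum_pos (fun i _ => hl0 i) Finset.univ_nonempty
    refine le_trans ?_ h1
    gcongr
  calc 2 * m * kStar m lam L / r = (2 * κ * Real.pi / r) * ((m : ℝ) ^ 2 / (2 * Real.pi)) := by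
        rw [kStar, ← hκ]
        field_simp
    _ ≤ (2 * κ * Real.pi / r) * ∑ i, 1 / l i := by
        have := hr.1
        gcongr
    _ = ∑ i, (2 * κ * Real.pi / r) * (1 / l i) := Finset.mul_sum _ _ _
    _ ≤ _ := Finset.sum_le_sum fun i _ => hterm i

/-- The integrated form of the monotonicity of `r^{-2 m k*} ∏ D_i(r)`. -/
theorem mul_log_le_sum_log_diskEnergy {m : ℕ} (hm : 2 ≤ m) {lam L : ℝ}
    {A : EuclideanSpace ℝ (Fin 2) → Matrix (Fin 2) (Fin 2) ℝ}
    {u : Fin m → EuclideanSpace ℝ (Fin 2) → ℝ}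
    {G : Fin m → EuclideanSpace ℝ (Fin 2) → EuclideanSpace ℝ (Fin 2)}
    (h : ∀ i, IsPlanarSubsolution lam L A (u i) (G i))
    (hdis : ∀ i j, i ≠ j → ∀ x, u i x ≠ 0 → u j x = 0) {s R : ℝ} (hs : 0 < s) (hsR : s ≤ R)
    (hD : ∀ i, 0 < diskEnergy A (G i) s) :
    2 * m * kStar m lam L * (Real.log R - Real.log s) ≤
      ∑ i, Real.log (diskEnergy A (G i) R) - ∑ i, Real.log (diskEnergy A (G i) s) := by
  have hR : 0 < R := hs.trans_le hsR
  have hDpos : ∀ r, s ≤ r → ∀ i, 0 < diskEnergy A (G i) r :=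
    fun r hr i => (hD i).trans_le ((h i).diskEnergy_mono hr)
  have hmono : MonotoneOn (fun r => ∑ i, Real.log (diskEnergy A (G i) r)) (Icc s R) := by
    intro r hr t ht hrt
    exact Finset.sum_le_sum fun i _ =>
      Real.log_le_log (hDpos r hr.1 i) ((h i).diskEnergy_mono hrt)
  have hint : IntervalIntegrable (fun r : ℝ => 2 * m * kStar m lam L * r⁻¹) volume s R := by
    refine IntervalIntegrable.const_mul ?_ _
    rw [intervalIntegrable_inv_iff]
    right
    rw [uIcc_of_le hsR]
    exact fun h0 => absurd h0.1 (not_le.2 hs)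
  have := hmono.integral_le_sub hsR hint ?_
  · rwa [intervalIntegral.integral_const_mul, integral_inv_of_pos hs hR,
      Real.log_div hR.ne' hs.ne'] at this
  · filter_upwards [ae_le_sum_circleEnergy_div hm h hdis R,
      ae_all_iff.2 fun i => (h i).ae_hasDerivAt_diskEnergy R] with r hr1 hr2 hr
    have hr' : r ∈ Ioo 0 R := ⟨hs.trans hr.1, hr.2⟩
    have hd : HasDerivAt (fun r => ∑ i, Real.log (diskEnergy A (G i) r))
        (∑ i, circleEnergy A (G i) r / diskEnergy A (G i) r) r :=
      HasDerivAt.fun_sum fun i _ => (hr2 i hr').log (hDpos r hr.1.le i).ne'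
    rw [hd.deriv, ← div_eq_mul_inv]
    exact hr1 hr' (hDpos r hr.1.le)

/-- A segregated family of subsolutions of growth less than `|x|^{k*}` has a trivial member. -/
theorem IsSegregatedFamily.exists_eq_zero {m : ℕ} (hm : 2 ≤ m) {lam L : ℝ} (hlam : 0 < lam)
    (hL : lam ≤ L) {A : EuclideanSpace ℝ (Fin 2) → Matrix (Fin 2) (Fin 2) ℝ}
    (hA : EllipticClass lam L A) {u : Fin m → EuclideanSpace ℝ (Fin 2) → ℝ}
    (hu : IsSegregatedFamily A u) {γ : ℝ} (hγ : 0 < γ) (hγk : γ < kStar m lam L) {C : ℝ}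
    (hC : 0 < C) (hgr : ∀ i x, u i x ≤ C * (1 + ‖x‖ ^ γ)) : ∃ j, ∀ x, u j x = 0 := by
  by_contra! hne
  choose G hG hsub using hu.subsolution
  have h : ∀ i, IsPlanarSubsolution lam L A (u i) (G i) := fun i =>
    ⟨hlam, hL, hA, hG i, hu.continuous i, hu.nonneg i, hsub i⟩
  have hdis : ∀ i j, i ≠ j → ∀ x, u i x ≠ 0 → u j x = 0 := by
    intro i j hij x hx
    by_contra hx'
    exact Set.disjoint_left.1 (hu.disjoint hij) (lt_of_le_of_ne (hu.nonneg i x) (Ne.symm hx))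
      (lt_of_le_of_ne (hu.nonneg j x) (Ne.symm hx'))
  choose ρ hρ using fun i => (h i).exists_diskEnergy_pos (hu.zero i) (hne i)
  obtain ⟨s, hs1, hs⟩ : ∃ s : ℝ, 1 ≤ s ∧ ∀ i, ρ i ≤ s := by
    obtain ⟨b, hb⟩ := (Set.finite_range ρ).bddAbove
    exact ⟨max 1 b, le_max_left _ _, fun i => (hb (Set.mem_range_self i)).trans (le_max_right _ _)⟩
  have hs0 : 0 < s := by linarith
  have hDs : ∀ i, 0 < diskEnergy A (G i) s := fun i =>
    (hρ i).trans_le ((h i).diskEnergy_mono (hs i))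
  choose K hK hKle using fun i => (h i).exists_diskEnergy_le_rpow hγ hC (hgr i) hs1 (hDs i)
  set a := 2 * m * kStar m lam L with ha
  set c := ∑ i, Real.log (K i) - ∑ i, Real.log (diskEnergy A (G i) s) + a * Real.log s with hc
  have hbound : ∀ R, s ≤ R → (a - 2 * m * γ) * Real.log R ≤ c := by
    intro R hR
    have hR0 : 0 < R := hs0.trans_le hR
    have h1 := mul_log_le_sum_log_diskEnergy hm h hdis hs0 hR hDs
    have h2 : ∑ i, Real.log (diskEnergy A (G i) R) ≤
        ∑ i : Fin m, (Real.log (K i) + 2 * γ * Real.log R) := by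
      refine Finset.sum_le_sum fun i _ => ?_
      rw [← Real.log_rpow hR0, ← Real.log_mul (hK i).ne' (by positivity)]
      exact Real.log_le_log ((hDs i).trans_le ((h i).diskEnergy_mono hR)) (hKle i R hR)
    rw [Finset.sum_add_distrib, Finset.sum_const, Finset.card_univ, Fintype.card_fin,
      nsmul_eq_mul] at h2
    rw [hc]
    linarith
  have hpos : 0 < a - 2 * m * γ := by
    have hm0 : (0 : ℝ) < m := by exact_mod_cast (by omega : 0 < m)
    rw [ha]
    nlinarith
  have htend : Tendsto (fun R => (a - 2 * m * γ) * Real.log R) atTop atTop :=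
    Real.tendsto_log_atTop.const_mul_atTop hpos
  obtain ⟨R, hR1, hR2⟩ := ((htend.eventually_gt_atTop c).and (eventually_ge_atTop s)).exists
  exact absurd (hbound R hR2) (not_le.2 hR1)

end Growth

/-! ### Meyers' matrix and integration by parts on sectors -/

section Meyers

open Filter Topology Set

theorem toEuclideanLin_meyersMatrix (lam L : ℝ) (x ξ : EuclideanSpace ℝ (Fin 2)) :
    Matrix.toEuclideanLin (meyersMatrix lam L x) ξ =
      lam • ξ + ((L - lam) * (inner ℝ x ξ / ‖x‖ ^ 2)) • x := by
  ext i
  have h : inner ℝ x ξ = x 0 * ξ 0 + x 1 * ξ 1 := by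
    simp [PiLp.inner_apply, Fin.sum_univ_two, mul_comm]
  rw [h]
  fin_cases i <;>
  · simp [meyersMatrix, Matrix.toLpLin_apply]
    ring

theorem ellipticClass_meyersMatrix {lam L : ℝ} (hL : lam ≤ L) :
    EllipticClass lam L (meyersMatrix lam L) := by
  have hinner : ∀ x ξ : EuclideanSpace ℝ (Fin 2),
      inner ℝ (Matrix.toEuclideanLin (meyersMatrix lam L x) ξ) ξ =
        lam * ‖ξ‖ ^ 2 + (L - lam) * (inner ℝ x ξ ^ 2 / ‖x‖ ^ 2) := by
    intro x ξ
    rw [toEuclideanLin_meyersMatrix, inner_add_left, inner_smul_left, inner_smul_left,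
      real_inner_self_eq_norm_sq]
    simp only [conj_trivial]
    ring
  refine ⟨fun i j => ?_, fun x => ?_, fun x ξ => ?_, fun x ξ => ?_⟩
  · have hc : ∀ l : Fin 2, Measurable fun x : EuclideanSpace ℝ (Fin 2) => x l := fun l =>
      (EuclideanSpace.proj (𝕜 := ℝ) l).continuous.measurable
    exact (measurable_const.add (measurable_const.mul
      (((hc i).mul (hc j)).div (measurable_norm.pow_const 2)))).aemeasurable
  · ext i j
    simp only [meyersMatrix, Matrix.transpose_apply, Matrix.of_apply]
    rw [mul_comm (x j)]
    simp only [eq_comm]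
  · rw [hinner]
    have := mul_nonneg (sub_nonneg.2 hL) (div_nonneg (sq_nonneg (inner ℝ x ξ)) (sq_nonneg ‖x‖))
    linarith
  · rw [hinner]
    have h1 : inner ℝ x ξ ^ 2 / ‖x‖ ^ 2 ≤ ‖ξ‖ ^ 2 := by
      refine div_le_of_le_mul₀ (sq_nonneg _) (sq_nonneg _) ?_
      rw [← mul_pow, ← sq_abs (inner ℝ x ξ)]
      have := abs_real_inner_le_norm x ξ
      rw [mul_comm ‖ξ‖]
      gcongr
    nlinarith [mul_le_mul_of_nonneg_left h1 (sub_nonneg.2 hL)]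

theorem fderiv_apply_eq_inner_gradient (φ : EuclideanSpace ℝ (Fin 2) → ℝ)
    (x v : EuclideanSpace ℝ (Fin 2)) : fderiv ℝ φ x v = inner ℝ (gradient φ x) v := by
  simp [gradient]

theorem continuous_polarPoint_radius (θ : ℝ) : Continuous fun r => polarPoint r θ := by
  simp only [polarPoint_eq_smul]
  exact continuous_id.smul continuous_const

theorem continuous_polarPoint_angle (r : ℝ) : Continuous fun θ => polarPoint r θ := by
  simp only [polarPoint_eq_smul]
  exact continuous_radialDir.const_smul r

/-- Integration by parts along a ray, for a function vanishing at distance `R`. -/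
theorem integral_ray_eq {φ : EuclideanSpace ℝ (Fin 2) → ℝ} (hφ : ContDiff ℝ 1 φ) {R θ : ℝ}
    (hR : 0 < R) (hφR : φ (polarPoint R θ) = 0) {κ : ℝ} (hκ : 0 < κ) :
    ∫ r in Ioo 0 R, r ^ κ * inner ℝ (gradient φ (polarPoint r θ)) (radialDir θ) =
      -∫ r in Ioo 0 R, κ * r ^ (κ - 1) * φ (polarPoint r θ) := by
  have hc1 : Continuous fun r => φ (polarPoint r θ) :=
    hφ.continuous.comp (continuous_polarPoint_radius θ)
  have hc2 : Continuous fun r => inner ℝ (gradient φ (polarPoint r θ)) (radialDir θ) :=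
    (hφ.continuous_gradient.comp (continuous_polarPoint_radius θ)).inner continuous_const
  have hpw : Continuous fun r : ℝ => r ^ κ := continuous_id.rpow_const fun _ => Or.inr hκ.le
  have hdr : ∀ r, HasDerivAt (fun r => φ (polarPoint r θ))
      (inner ℝ (gradient φ (polarPoint r θ)) (radialDir θ)) r := fun r => by
    rw [← fderiv_apply_eq_inner_gradient]
    exact ((hφ.differentiable one_ne_zero).differentiableAt.hasFDerivAt).comp_hasDerivAt r
      (hasDerivAt_polarPoint_radius r θ)
  have j1 : IntervalIntegrable (fun r => κ * r ^ (κ - 1) * φ (polarPoint r θ)) volume 0 R :=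
    ((intervalIntegral.intervalIntegrable_rpow' (by linarith)).const_mul κ).mul_continuousOn
      hc1.continuousOn
  have j2 : IntervalIntegrable (fun r => r ^ κ *
      inner ℝ (gradient φ (polarPoint r θ)) (radialDir θ)) volume 0 R :=
    (hpw.mul hc2).intervalIntegrable _ _
  have hFTC := intervalIntegral.integral_eq_sub_of_hasDerivAt_of_le hR.le
    (f := fun r => r ^ κ * φ (polarPoint r θ))
    (f' := fun r => κ * r ^ (κ - 1) * φ (polarPoint r θ) +
      r ^ κ * inner ℝ (gradient φ (polarPoint r θ)) (radialDir θ))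
    (hpw.mul hc1).continuousOn
    (fun r hr => (Real.hasDerivAt_rpow_const (Or.inl hr.1.ne')).mul (hdr r)) (j1.add j2)
  rw [hφR, Real.zero_rpow hκ.ne', mul_zero, zero_mul, sub_zero,
    intervalIntegral.integral_add j1 j2, intervalIntegral.integral_of_le hR.le,
    intervalIntegral.integral_of_le hR.le, integral_Ioc_eq_integral_Ioo,
    integral_Ioc_eq_integral_Ioo] at hFTC
  exact eq_neg_of_add_eq_zero_right hFTC

/-- Integration by parts along a circular arc. -/
theorem integral_arc_eq {φ : EuclideanSpace ℝ (Fin 2) → ℝ} (hφ : ContDiff ℝ 1 φ) (r : ℝ)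
    {s t : ℝ} (hst : s ≤ t) {b b' : ℝ → ℝ} (hb : ∀ θ, HasDerivAt b (b' θ) θ)
    (hb' : Continuous b') :
    ∫ θ in Ioo s t, b θ * (r * inner ℝ (gradient φ (polarPoint r θ)) (angularDir θ)) =
      (b t * φ (polarPoint r t) - b s * φ (polarPoint r s)) -
        ∫ θ in Ioo s t, b' θ * φ (polarPoint r θ) := by
  have hbc : Continuous b := continuous_iff_continuousAt.2 fun θ => (hb θ).continuousAt
  have hc1 : Continuous fun θ => φ (polarPoint r θ) :=
    hφ.continuous.comp (continuous_polarPoint_angle r)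
  have hc2 : Continuous fun θ => inner ℝ (gradient φ (polarPoint r θ)) (angularDir θ) :=
    (hφ.continuous_gradient.comp (continuous_polarPoint_angle r)).inner continuous_angularDir
  have hdθ : ∀ θ, HasDerivAt (fun θ => φ (polarPoint r θ))
      (r * inner ℝ (gradient φ (polarPoint r θ)) (angularDir θ)) θ := fun θ => by
    rw [← inner_smul_right, ← fderiv_apply_eq_inner_gradient]
    exact ((hφ.differentiable one_ne_zero).differentiableAt.hasFDerivAt).comp_hasDerivAt θ
      (hasDerivAt_polarPoint_angle r θ)
  have j1 : IntervalIntegrable (fun θ => b' θ * φ (polarPoint r θ)) volume s t :=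
    (hb'.mul hc1).intervalIntegrable _ _
  have j2 : IntervalIntegrable (fun θ => b θ *
      (r * inner ℝ (gradient φ (polarPoint r θ)) (angularDir θ))) volume s t :=
    (hbc.mul (continuous_const.mul hc2)).intervalIntegrable _ _
  have hFTC := intervalIntegral.integral_eq_sub_of_hasDerivAt
    (f := fun θ => b θ * φ (polarPoint r θ)) (a := s) (b := t)
    (fun θ _ => (hb θ).mul (hdθ θ)) (j1.add j2)
  rw [intervalIntegral.integral_add j1 j2, intervalIntegral.integral_of_le hst,
    intervalIntegral.integral_of_le hst, integral_Ioc_eq_integral_Ioo,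
    integral_Ioc_eq_integral_Ioo] at hFTC
  rw [← hFTC]
  ring

/-- Integration by parts in polar coordinates on the sector `(0, R) × (s, t)`, for the vector field
`r ^ (κ - 1) (a ν + b τ)` with `ν` and `τ` the radial and the angular direction: the extra factor
`r` is the Jacobian. -/
theorem integral_sector_eq {φ : EuclideanSpace ℝ (Fin 2) → ℝ} (hφ : ContDiff ℝ 1 φ) {R : ℝ}
    (hR : 0 < R) (hφR : ∀ θ, φ (polarPoint R θ) = 0) {s t : ℝ} (hst : s ≤ t) {κ : ℝ} (hκ : 0 < κ)
    {a b b' : ℝ → ℝ} (ha : Continuous a) (hb : ∀ θ, HasDerivAt b (b' θ) θ) (hb' : Continuous b') :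
    ∫ r in Ioo 0 R, ∫ θ in Ioo s t, r ^ κ *
        (a θ * inner ℝ (gradient φ (polarPoint r θ)) (radialDir θ) +
          b θ * inner ℝ (gradient φ (polarPoint r θ)) (angularDir θ)) =
      (∫ r in Ioo 0 R, r ^ (κ - 1) * (b t * φ (polarPoint r t) - b s * φ (polarPoint r s))) -
        ∫ r in Ioo 0 R, ∫ θ in Ioo s t, r ^ (κ - 1) * ((κ * a θ + b' θ) * φ (polarPoint r θ)) := by
  have hbc : Continuous b := continuous_iff_continuousAt.2 fun θ => (hb θ).continuousAt
  have hgc : Continuous (gradient φ) := hφ.continuous_gradient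
  set μ : Measure (ℝ × ℝ) := (volume.restrict (Ioo 0 R)).prod (volume.restrict (Ioo s t)) with hμ
  have hμr : μ = volume.restrict (Ioo 0 R ×ˢ Ioo s t) := by
    rw [hμ, Measure.prod_restrict, Measure.volume_eq_prod]
  have hcΦ : Continuous fun p : ℝ × ℝ => φ (polarPoint p.1 p.2) :=
    hφ.continuous.comp continuous_polarPoint
  have hcr : Continuous fun p : ℝ × ℝ =>
      inner ℝ (gradient φ (polarPoint p.1 p.2)) (radialDir p.2) :=
    (hgc.comp continuous_polarPoint).inner (continuous_radialDir.comp continuous_snd)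
  have hcθ : Continuous fun p : ℝ × ℝ =>
      inner ℝ (gradient φ (polarPoint p.1 p.2)) (angularDir p.2) :=
    (hgc.comp continuous_polarPoint).inner (continuous_angularDir.comp continuous_snd)
  have hcpow : Continuous fun p : ℝ × ℝ => p.1 ^ κ :=
    continuous_fst.rpow_const fun _ => Or.inr hκ.le
  have hsub : Ioo 0 R ×ˢ Ioo s t ⊆ Icc 0 R ×ˢ Icc s t :=
    prod_mono Ioo_subset_Icc_self Ioo_subset_Icc_self
  have hcint : ∀ {f : ℝ × ℝ → ℝ}, Continuous f → Integrable f μ := fun hf => by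
    rw [hμr]
    exact (hf.continuousOn.integrableOn_compact (isCompact_Icc.prod isCompact_Icc)).mono_set hsub
  have hpowi : IntegrableOn (fun r : ℝ => r ^ (κ - 1)) (Ioo 0 R) := by
    rw [← intervalIntegrable_iff_integrableOn_Ioo_of_le hR.le]
    exact intervalIntegral.intervalIntegrable_rpow' (by linarith)
  have hsing : ∀ {f : ℝ × ℝ → ℝ}, Continuous f → Integrable (fun p => p.1 ^ (κ - 1) * f p) μ := by
    intro f hf
    obtain ⟨M, hM⟩ := (isCompact_Icc (a := (0 : ℝ)) (b := R)).prod
      (isCompact_Icc (a := s) (b := t)) |>.exists_bound_of_continuousOn hf.continuousOn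
    have h1 : Integrable (fun p : ℝ × ℝ => p.1 ^ (κ - 1) * (1 : ℝ)) μ :=
      Integrable.mul_prod hpowi (integrable_const (1 : ℝ))
    simp only [mul_one] at h1
    refine h1.mul_bdd (c := M) hf.aestronglyMeasurable ?_
    rw [hμr]
    filter_upwards [ae_restrict_mem (measurableSet_Ioo.prod measurableSet_Ioo)] with p hp
      using hM p (hsub hp)
  have iA : Integrable (fun p : ℝ × ℝ => p.1 ^ κ *
      (a p.2 * inner ℝ (gradient φ (polarPoint p.1 p.2)) (radialDir p.2))) μ :=
    hcint (hcpow.mul ((ha.comp continuous_snd).mul hcr))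
  have iB : Integrable (fun p : ℝ × ℝ => p.1 ^ κ *
      (b p.2 * inner ℝ (gradient φ (polarPoint p.1 p.2)) (angularDir p.2))) μ :=
    hcint (hcpow.mul ((hbc.comp continuous_snd).mul hcθ))
  have iA' : Integrable (fun p : ℝ × ℝ => p.1 ^ (κ - 1) *
      ((κ * a p.2) * φ (polarPoint p.1 p.2))) μ :=
    hsing (((continuous_const (y := κ)).mul (ha.comp continuous_snd)).mul hcΦ)
  have iB' : Integrable (fun p : ℝ × ℝ => p.1 ^ (κ - 1) *
      (b' p.2 * φ (polarPoint p.1 p.2))) μ :=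
    hsing ((hb'.comp continuous_snd).mul hcΦ)
  have iAB : Integrable (fun p : ℝ × ℝ => p.1 ^ κ *
      (a p.2 * inner ℝ (gradient φ (polarPoint p.1 p.2)) (radialDir p.2)) + p.1 ^ κ *
      (b p.2 * inner ℝ (gradient φ (polarPoint p.1 p.2)) (angularDir p.2))) μ := iA.add iB
  have iAB' : Integrable (fun p : ℝ × ℝ => p.1 ^ (κ - 1) *
      ((κ * a p.2) * φ (polarPoint p.1 p.2)) + p.1 ^ (κ - 1) *
      (b' p.2 * φ (polarPoint p.1 p.2))) μ := iA'.add iB'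
  have iAn : Integrable (fun p : ℝ × ℝ => -(p.1 ^ (κ - 1) *
      ((κ * a p.2) * φ (polarPoint p.1 p.2)))) μ := iA'.neg
  have hA : ∫ p, p.1 ^ κ * (a p.2 * inner ℝ (gradient φ (polarPoint p.1 p.2)) (radialDir p.2)) ∂μ =
      -∫ p, p.1 ^ (κ - 1) * ((κ * a p.2) * φ (polarPoint p.1 p.2)) ∂μ := by
    rw [hμ, integral_prod_symm _ iA, ← integral_neg, integral_prod_symm _ iAn]
    refine integral_congr_ae (Eventually.of_forall fun θ => ?_)
    simp only
    calc ∫ r in Ioo 0 R, r ^ κ * (a θ * inner ℝ (gradient φ (polarPoint r θ)) (radialDir θ))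
        = a θ * ∫ r in Ioo 0 R, r ^ κ * inner ℝ (gradient φ (polarPoint r θ)) (radialDir θ) := by
          rw [← integral_const_mul]
          refine integral_congr_ae (Eventually.of_forall fun r => ?_)
          simp only; ring
      _ = -(a θ * ∫ r in Ioo 0 R, κ * r ^ (κ - 1) * φ (polarPoint r θ)) := by
          rw [integral_ray_eq hφ hR (hφR θ) hκ]; ring
      _ = _ := by
          rw [← integral_const_mul, ← integral_neg]
          refine integral_congr_ae (Eventually.of_forall fun r => ?_)
          simp only; ring
  have hB : ∫ p, p.1 ^ κ * (b p.2 * inner ℝ (gradient φ (polarPoint p.1 p.2)) (angularDir p.2)) ∂μ =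
      (∫ r in Ioo 0 R, r ^ (κ - 1) * (b t * φ (polarPoint r t) - b s * φ (polarPoint r s))) -
        ∫ p, p.1 ^ (κ - 1) * (b' p.2 * φ (polarPoint p.1 p.2)) ∂μ := by
    have i3 : IntegrableOn (fun r : ℝ => r ^ (κ - 1) *
        (b t * φ (polarPoint r t) - b s * φ (polarPoint r s))) (Ioo 0 R) := by
      have hc : Continuous fun r => b t * φ (polarPoint r t) - b s * φ (polarPoint r s) :=
        (continuous_const.mul (hcΦ.comp (continuous_id.prodMk continuous_const))).sub
          (continuous_const.mul (hcΦ.comp (continuous_id.prodMk continuous_const)))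
      rw [← intervalIntegrable_iff_integrableOn_Ioo_of_le hR.le]
      exact (intervalIntegral.intervalIntegrable_rpow' (by linarith)).mul_continuousOn
        hc.continuousOn
    rw [hμ, integral_prod _ iB, integral_prod _ iB', ← integral_sub i3 iB'.integral_prod_left]
    refine setIntegral_congr_fun measurableSet_Ioo fun r hr => ?_
    have hpow : r ^ κ = r ^ (κ - 1) * r := by
      rw [← Real.rpow_add_one hr.1.ne', sub_add_cancel]
    calc ∫ θ in Ioo s t, r ^ κ * (b θ * inner ℝ (gradient φ (polarPoint r θ)) (angularDir θ))
        = r ^ (κ - 1) * ∫ θ in Ioo s t, b θ *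
            (r * inner ℝ (gradient φ (polarPoint r θ)) (angularDir θ)) := by
          rw [← integral_const_mul]
          refine integral_congr_ae (Eventually.of_forall fun θ => ?_)
          simp only [hpow]; ring
      _ = r ^ (κ - 1) * (b t * φ (polarPoint r t) - b s * φ (polarPoint r s)) -
            r ^ (κ - 1) * ∫ θ in Ioo s t, b' θ * φ (polarPoint r θ) := by
          rw [← mul_sub, integral_arc_eq hφ r hst hb hb']
      _ = _ := by rw [← integral_const_mul]
  have hL : ∫ r in Ioo 0 R, ∫ θ in Ioo s t, r ^ κ *
        (a θ * inner ℝ (gradient φ (polarPoint r θ)) (radialDir θ) +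
          b θ * inner ℝ (gradient φ (polarPoint r θ)) (angularDir θ)) =
      ∫ p, (p.1 ^ κ * (a p.2 * inner ℝ (gradient φ (polarPoint p.1 p.2)) (radialDir p.2)) +
        p.1 ^ κ * (b p.2 * inner ℝ (gradient φ (polarPoint p.1 p.2)) (angularDir p.2))) ∂μ := by
    rw [hμ, integral_prod _ iAB]
    simp only [mul_add]
  have hRt : ∫ r in Ioo 0 R, ∫ θ in Ioo s t,
        r ^ (κ - 1) * ((κ * a θ + b' θ) * φ (polarPoint r θ)) =
      ∫ p, (p.1 ^ (κ - 1) * ((κ * a p.2) * φ (polarPoint p.1 p.2)) +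
        p.1 ^ (κ - 1) * (b' p.2 * φ (polarPoint p.1 p.2))) ∂μ := by
    rw [hμ, integral_prod _ iAB']
    simp only [mul_add, add_mul]
  rw [hL, hRt, integral_add iA iB, integral_add iA' iB', hA, hB]
  ring

end Meyers

/-! ### Homogeneous functions supported in a sector -/

section Sectors

open Filter Topology Set

/-- The function `r ^ k * cos (m / 2 * (θ - α))` on the sector `|θ - α| < π / m`, extended by zero.
The angle with `radialDir α` replaces `|θ - α|`, so that continuity needs no branch of the angle. -/
noncomputable def sectorFun (m : ℕ) (k α : ℝ) (x : EuclideanSpace ℝ (Fin 2)) : ℝ :=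
  ‖x‖ ^ k *
    Real.cos (min (m / 2 * InnerProductGeometry.angle x (radialDir α)) (Real.pi / 2))

/-- The gradient of `sectorFun m k α` at `polarPoint r θ`, divided by `r ^ (k - 1)`. -/
noncomputable def sectorField (m : ℕ) (k α θ : ℝ) : EuclideanSpace ℝ (Fin 2) :=
  (Ioo (α - Real.pi / m) (α + Real.pi / m)).indicator
    (fun θ => (k * Real.cos (m / 2 * (θ - α))) • radialDir θ +
      (-(m / 2) * Real.sin (m / 2 * (θ - α))) • angularDir θ) θ

/-- The polar angle in `(-π, π]`. -/
noncomputable def planarArg (x : EuclideanSpace ℝ (Fin 2)) : ℝ := Complex.arg ⟨x 0, x 1⟩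

/-- The weak gradient of `sectorFun m k α`. -/
noncomputable def sectorGrad (m : ℕ) (k α : ℝ) (x : EuclideanSpace ℝ (Fin 2)) :
    EuclideanSpace ℝ (Fin 2) :=
  ‖x‖ ^ (k - 1) • sectorField m k α (planarArg x)

theorem planarArg_mem (x : EuclideanSpace ℝ (Fin 2)) :
    planarArg x ∈ Ioc (-Real.pi) Real.pi := Complex.arg_mem_Ioc _

theorem planarArg_polarPoint {r θ : ℝ} (hr : 0 < r) (hθ : θ ∈ Ioc (-Real.pi) Real.pi) :
    planarArg (polarPoint r θ) = θ := by
  have h : (⟨polarPoint r θ 0, polarPoint r θ 1⟩ : ℂ) =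
      r * (Complex.cos θ + Complex.sin θ * Complex.I) := by
    apply Complex.ext <;>
      simp [polarPoint, ← Complex.ofReal_cos, ← Complex.ofReal_sin]
  rw [planarArg, h, Complex.arg_mul_cos_add_sin_mul_I hr hθ]

theorem polarPoint_norm_planarArg (x : EuclideanSpace ℝ (Fin 2)) :
    polarPoint ‖x‖ (planarArg x) = x := by
  have hn : ‖(⟨x 0, x 1⟩ : ℂ)‖ = ‖x‖ := by
    rw [EuclideanSpace.norm_eq, Complex.norm_eq_sqrt_sq_add_sq]
    simp [Fin.sum_univ_two]
  ext i
  fin_cases i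
  · simpa [polarPoint, hn] using! Complex.norm_mul_cos_arg (⟨x 0, x 1⟩ : ℂ)
  · simpa [polarPoint, hn] using! Complex.norm_mul_sin_arg (⟨x 0, x 1⟩ : ℂ)

theorem measurable_planarArg : Measurable planarArg := by
  have hc : ∀ l : Fin 2, Measurable fun x : EuclideanSpace ℝ (Fin 2) => x l := fun l =>
    (EuclideanSpace.proj (𝕜 := ℝ) l).continuous.measurable
  have : Measurable fun x : EuclideanSpace ℝ (Fin 2) =>
      Complex.arg (Complex.measurableEquivRealProd.symm (x 0, x 1)) :=
    Complex.measurable_arg.comp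
      (Complex.measurableEquivRealProd.symm.measurable.comp ((hc 0).prodMk (hc 1)))
  exact this

theorem inner_radialDir_radialDir (θ α : ℝ) :
    inner ℝ (radialDir θ) (radialDir α) = Real.cos (θ - α) := by
  rw [Real.cos_sub]
  simp [radialDir, PiLp.inner_apply, Fin.sum_univ_two]
  ring

theorem angle_polarPoint_radialDir {r : ℝ} (hr : 0 < r) (θ α : ℝ) :
    InnerProductGeometry.angle (polarPoint r θ) (radialDir α) =
      Real.arccos (Real.cos (θ - α)) := by
  rw [polarPoint_eq_smul, InnerProductGeometry.angle_smul_left_of_pos _ _ hr,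
    InnerProductGeometry.angle, norm_radialDir, norm_radialDir, inner_radialDir_radialDir]
  norm_num

variable {m : ℕ} {k α : ℝ}

/-- The polar form of `sectorFun`, for a sector that does not cross the branch cut. -/
theorem sectorFun_polarPoint (hm : 1 ≤ m) (hα : -Real.pi ≤ α - Real.pi / m)
    (hα' : α + Real.pi / m ≤ Real.pi) {r θ : ℝ} (hr : 0 < r)
    (hθ : θ ∈ Icc (-Real.pi) Real.pi) :
    sectorFun m k α (polarPoint r θ) = r ^ k *
      (Ioo (α - Real.pi / m) (α + Real.pi / m)).indicator
        (fun θ => Real.cos (m / 2 * (θ - α))) θ := by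
  rw [sectorFun, norm_polarPoint, abs_of_pos hr, angle_polarPoint_radialDir hr]
  congr 1
  have hm0 : (0 : ℝ) < m := by exact_mod_cast hm
  have hpm : Real.pi / m ≤ Real.pi :=
    div_le_self Real.pi_pos.le (by exact_mod_cast hm)
  have hhalf : (m : ℝ) / 2 * (Real.pi / m) = Real.pi / 2 := by field_simp
  rw [← Real.cos_abs (θ - α)]
  by_cases h : θ ∈ Ioo (α - Real.pi / m) (α + Real.pi / m)
  · have habs : |θ - α| < Real.pi / m := abs_lt.2 ⟨by linarith [h.1], by linarith [h.2]⟩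
    have hlt : (m : ℝ) / 2 * |θ - α| ≤ Real.pi / 2 := by
      rw [← hhalf]
      exact mul_le_mul_of_nonneg_left habs.le (by positivity)
    rw [indicator_of_mem h, Real.arccos_cos (abs_nonneg _) (habs.le.trans hpm), min_eq_left hlt,
      ← Real.cos_abs (m / 2 * (θ - α)), abs_mul, abs_of_pos (by positivity : (0 : ℝ) < m / 2)]
  · have hge : Real.pi / m ≤ |θ - α| := by
      by_contra hlt
      rw [not_le, abs_lt] at hlt
      exact h ⟨by linarith [hlt.1], by linarith [hlt.2]⟩
    have hle : |θ - α| ≤ 2 * Real.pi - Real.pi / m :=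
      abs_le.2 ⟨by linarith [hθ.1], by linarith [hθ.2]⟩
    have hcos : Real.cos |θ - α| ≤ Real.cos (Real.pi / m) := by
      rcases le_total |θ - α| Real.pi with h1 | h1
      · exact Real.cos_le_cos_of_nonneg_of_le_pi (by positivity) h1 hge
      · rw [← Real.cos_two_pi_sub]
        exact Real.cos_le_cos_of_nonneg_of_le_pi (by positivity) (by linarith) (by linarith)
    have harc := Real.arccos_le_arccos hcos
    rw [Real.arccos_cos (by positivity) hpm] at harc
    rw [indicator_of_notMem h, min_eq_right, Real.cos_pi_div_two]
    rw [← hhalf]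
    exact mul_le_mul_of_nonneg_left harc (by positivity)

theorem sectorGrad_polarPoint {r θ : ℝ} (hr : 0 < r) (hθ : θ ∈ Ioc (-Real.pi) Real.pi) :
    sectorGrad m k α (polarPoint r θ) = r ^ (k - 1) • sectorField m k α θ := by
  rw [sectorGrad, planarArg_polarPoint hr hθ, norm_polarPoint, abs_of_pos hr]

theorem sectorFun_zero (hk : 0 < k) : sectorFun m k α 0 = 0 := by
  rw [sectorFun, norm_zero, Real.zero_rpow hk.ne', zero_mul]

theorem sectorFun_nonneg (x : EuclideanSpace ℝ (Fin 2)) : 0 ≤ sectorFun m k α x := by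
  refine mul_nonneg (by positivity) (Real.cos_nonneg_of_mem_Icc ⟨?_, min_le_right _ _⟩)
  have := InnerProductGeometry.angle_nonneg x (radialDir α)
  have h : 0 ≤ min ((m : ℝ) / 2 * InnerProductGeometry.angle x (radialDir α)) (Real.pi / 2) :=
    le_min (by positivity) (by positivity)
  linarith [Real.pi_pos]

theorem sectorFun_le (x : EuclideanSpace ℝ (Fin 2)) : sectorFun m k α x ≤ ‖x‖ ^ k :=
  mul_le_of_le_one_right (by positivity) (Real.cos_le_one _)

theorem sectorFun_radialDir : sectorFun m k α (radialDir α) = 1 := by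
  have h0 : radialDir α ≠ 0 := norm_ne_zero_iff.1 (by rw [norm_radialDir]; exact one_ne_zero)
  rw [sectorFun, norm_radialDir, InnerProductGeometry.angle_self h0, mul_zero,
    min_eq_left (by positivity), Real.cos_zero, Real.one_rpow, mul_one]

theorem continuous_sectorFun (hk : 0 < k) : Continuous (sectorFun m k α) := by
  rw [continuous_iff_continuousAt]
  intro x
  have hα0 : radialDir α ≠ 0 := norm_ne_zero_iff.1 (by rw [norm_radialDir]; exact one_ne_zero)
  have hn : Continuous fun x : EuclideanSpace ℝ (Fin 2) => ‖x‖ ^ k :=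
    continuous_norm.rpow_const fun _ => Or.inr hk.le
  rcases eq_or_ne x 0 with rfl | hx
  · rw [ContinuousAt, sectorFun_zero hk]
    have h := hn.tendsto 0
    simp only [norm_zero, Real.zero_rpow hk.ne'] at h
    exact squeeze_zero sectorFun_nonneg sectorFun_le h
  · have h1 : ContinuousAt (fun y => InnerProductGeometry.angle y (radialDir α)) x :=
      ContinuousAt.comp (f := fun y => (y, radialDir α))
        (InnerProductGeometry.continuousAt_angle (x := (x, radialDir α)) hx hα0) (by fun_prop)
    exact hn.continuousAt.mul
      (Real.continuous_cos.continuousAt.comp ((h1.const_mul _).min continuousAt_const))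

theorem norm_sectorField_le (hk : 0 ≤ k) (θ : ℝ) : ‖sectorField m k α θ‖ ≤ k + m / 2 := by
  unfold sectorField
  refine (norm_indicator_le_norm_self _ _).trans ((norm_add_le _ _).trans ?_)
  rw [norm_smul, norm_smul, norm_radialDir, norm_angularDir, mul_one, mul_one, norm_mul, norm_mul,
    Real.norm_eq_abs, Real.norm_eq_abs, Real.norm_eq_abs, Real.norm_eq_abs, abs_of_nonneg hk,
    abs_neg, abs_of_nonneg (by positivity : (0 : ℝ) ≤ m / 2)]
  exact add_le_add (mul_le_of_le_one_right hk (Real.abs_cos_le_one _))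
    (mul_le_of_le_one_right (by positivity) (Real.abs_sin_le_one _))

theorem measurable_sectorGrad : Measurable (sectorGrad m k α) := by
  have h : Measurable (sectorField m k α) := by
    refine Measurable.indicator (Continuous.measurable ?_) measurableSet_Ioo
    have := continuous_radialDir
    have := continuous_angularDir
    fun_prop
  exact (measurable_norm.pow_const _).smul (h.comp measurable_planarArg)

theorem memL2loc_of_forall_ball {F : Type*} [NormedAddCommGroup F]
    {f : EuclideanSpace ℝ (Fin 2) → F}
    (h : ∀ R, 0 < R → MemLp f 2 (volume.restrict (Metric.ball 0 R))) : MemL2loc f := by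
  intro K hK
  obtain ⟨R, hR, hKR⟩ := hK.isBounded.subset_ball_lt 0 0
  exact (h R hR).mono_measure (Measure.restrict_mono hKR le_rfl)

theorem Continuous.memLp_ball {F : Type*} [NormedAddCommGroup F]
    {f : EuclideanSpace ℝ (Fin 2) → F} [SecondCountableTopology F]
    (hf : Continuous f) (R : ℝ) :
    MemLp f 2 (volume.restrict (Metric.ball 0 R)) := by
  have : IsFiniteMeasure (volume.restrict (Metric.ball (0 : EuclideanSpace ℝ (Fin 2)) R)) :=
    ⟨by rw [Measure.restrict_apply_univ]; exact measure_ball_lt_top⟩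
  obtain ⟨M, hM⟩ := (isCompact_closedBall (0 : EuclideanSpace ℝ (Fin 2)) R
    ).exists_bound_of_continuousOn hf.continuousOn
  refine MemLp.of_bound hf.aestronglyMeasurable M ?_
  filter_upwards [ae_restrict_mem measurableSet_ball] with x hx
    using hM x (Metric.ball_subset_closedBall hx)

theorem memLp_sectorGrad (hk : 0 < k) {R : ℝ} (hR : 0 < R) :
    MemLp (sectorGrad m k α) 2 (volume.restrict (Metric.ball 0 R)) := by
  have hm : Measurable (sectorGrad m k α) := measurable_sectorGrad
  rw [memLp_two_iff_integrable_sq_norm hm.aestronglyMeasurable]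
  refine (integrable_polarBox_iff (hm.norm.pow_const 2).aestronglyMeasurable).1 ?_
  have hp : IntegrableOn (fun r : ℝ => r ^ (2 * k - 1)) (Ioo 0 R) := by
    rw [← intervalIntegrable_iff_integrableOn_Ioo_of_le hR.le]
    exact intervalIntegral.intervalIntegrable_rpow' (by linarith)
  have hdom : Integrable (fun p : ℝ × ℝ => p.1 ^ (2 * k - 1) * (k + m / 2 : ℝ) ^ 2)
      (polarBox R) :=
    Integrable.mul_prod hp (integrable_const _)
  have hmeas : Measurable fun p : ℝ × ℝ => p.1 • ‖sectorGrad m k α (polarPoint p.1 p.2)‖ ^ 2 :=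
    measurable_fst.smul ((hm.comp continuous_polarPoint.measurable).norm.pow_const 2)
  refine hdom.mono' hmeas.aestronglyMeasurable ?_
  filter_upwards [ae_polarBox_pos R] with p hp0
  rw [smul_eq_mul, norm_mul, Real.norm_eq_abs, abs_of_pos hp0, norm_pow, norm_norm, sectorGrad,
    norm_polarPoint, abs_of_pos hp0, norm_smul, Real.norm_eq_abs,
    abs_of_nonneg (Real.rpow_nonneg hp0.le _), mul_pow, ← mul_assoc]
  have e : p.1 * (p.1 ^ (k - 1)) ^ 2 = p.1 ^ (2 * k - 1) := by
    rw [← Real.rpow_natCast, ← Real.rpow_mul hp0.le, mul_comm, ← Real.rpow_add_one hp0.ne']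
    congr 1; push_cast; ring
  rw [e]
  exact mul_le_mul_of_nonneg_left
    (pow_le_pow_left₀ (norm_nonneg _) (norm_sectorField_le hk.le _) 2)
    (Real.rpow_nonneg hp0.le _)

theorem hasDerivAt_angularDir (θ : ℝ) : HasDerivAt angularDir (-radialDir θ) θ := by
  have h : angularDir = fun t => radialDir (t + Real.pi / 2) := by
    ext t i
    fin_cases i <;> simp [angularDir, radialDir, Real.cos_add_pi_div_two, Real.sin_add_pi_div_two]
  have h2 : -radialDir θ = angularDir (θ + Real.pi / 2) := by
    ext i
    fin_cases i <;> simp [angularDir, radialDir, Real.cos_add_pi_div_two, Real.sin_add_pi_div_two]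
  rw [h, h2]
  exact (hasDerivAt_radialDir _).comp_add_const θ (Real.pi / 2)

/-- Polar coordinates for a function supported in a sector. -/
theorem integral_eq_integral_sector {F : EuclideanSpace ℝ (Fin 2) → ℝ} {R s t : ℝ}
    (hF : IntegrableOn F (Metric.ball 0 R)) (hF0 : ∀ x ∉ Metric.ball 0 R, F x = 0)
    {g : ℝ → ℝ → ℝ} (hs : -Real.pi ≤ s) (ht : t ≤ Real.pi)
    (h : ∀ r ∈ Ioo 0 R, ∀ θ ∈ Ioo (-Real.pi) Real.pi,
      r * F (polarPoint r θ) = (Ioo s t).indicator (g r) θ) :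
    ∫ x, F x = ∫ r in Ioo 0 R, ∫ θ in Ioo s t, g r θ := by
  rw [← setIntegral_eq_integral_of_forall_compl_eq_zero hF0, integral_ball_eq_polar hF]
  refine setIntegral_congr_fun measurableSet_Ioo fun r hr => ?_
  calc ∫ θ in Ioo (-Real.pi) Real.pi, r • F (polarPoint r θ)
      = ∫ θ in Ioo (-Real.pi) Real.pi, (Ioo s t).indicator (g r) θ :=
        setIntegral_congr_fun measurableSet_Ioo fun θ hθ => h r hr θ hθ
    _ = ∫ θ in Ioo s t, g r θ := by
        rw [setIntegral_indicator measurableSet_Ioo,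
          inter_eq_right.2 (Ioo_subset_Ioo hs ht)]

theorem IsTestFunction.exists_ball {φ : EuclideanSpace ℝ (Fin 2) → ℝ} (hφ : IsTestFunction φ) :
    ∃ R, 0 < R ∧ (∀ x ∉ Metric.ball 0 R, φ x = 0) ∧
      ∀ x ∉ Metric.ball 0 R, gradient φ x = 0 := by
  obtain ⟨R, hR, hsub⟩ := hφ.2.isCompact.isBounded.subset_ball_lt 0 0
  refine ⟨R, hR, fun x hx => ?_, fun x hx => ?_⟩
  · by_contra h
    exact hx (hsub (subset_tsupport _ h))
  · have : fderiv ℝ φ x = 0 := by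
      by_contra h
      exact hx (hsub (support_fderiv_subset ℝ h))
    simp [gradient, this]

theorem hasDerivAt_cos_half (m : ℕ) (α θ : ℝ) :
    HasDerivAt (fun θ => Real.cos (m / 2 * (θ - α))) (-(m / 2) * Real.sin (m / 2 * (θ - α))) θ := by
  have h := (((hasDerivAt_id θ).sub_const α).const_mul ((m : ℝ) / 2)).cos
  simp only [id, mul_one] at h
  convert h using 1; ring

theorem hasDerivAt_sin_half (m : ℕ) (α θ : ℝ) :
    HasDerivAt (fun θ => Real.sin (m / 2 * (θ - α))) (m / 2 * Real.cos (m / 2 * (θ - α))) θ := by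
  have h := (((hasDerivAt_id θ).sub_const α).const_mul ((m : ℝ) / 2)).sin
  simp only [id, mul_one] at h
  convert h using 1; ring

/-- No boundary term arises, because `cos (m / 2 (θ - α))` vanishes on the two sides of the sector.
Against a fixed vector `e`, the identity is an integration by parts with the fields
`cos (m / 2 (θ - α)) ⟪ν, e⟫` and `cos (m / 2 (θ - α)) ⟪τ, e⟫`. -/
theorem hasWeakGradient_sectorFun (hm : 1 ≤ m) (hk : 0 < k)
    (hα : -Real.pi ≤ α - Real.pi / m) (hα' : α + Real.pi / m ≤ Real.pi) :
    HasWeakGradient (sectorFun m k α) (sectorGrad m k α) := by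
  have hc : Continuous (sectorFun m k α) := continuous_sectorFun hk
  refine ⟨memL2loc_of_forall_ball fun R _ => hc.memLp_ball R,
    memL2loc_of_forall_ball fun R hR => memLp_sectorGrad hk hR, fun φ hφ => ?_⟩
  obtain ⟨R, hR, hφ0, hg0⟩ := hφ.exists_ball
  have hφ1 : ContDiff ℝ 1 φ := hφ.1.of_le (by simp)
  have hm0 : (0 : ℝ) < m := by exact_mod_cast hm
  have hgc := hφ1.continuous_gradient
  have hG2 := memLp_sectorGrad (m := m) (α := α) hk hR
  have hfin : IsFiniteMeasure (volume.restrict (Metric.ball (0 : EuclideanSpace ℝ (Fin 2)) R)) :=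
    ⟨by rw [Measure.restrict_apply_univ]; exact measure_ball_lt_top⟩
  have i1 : IntegrableOn (fun x => sectorFun m k α x • gradient φ x) (Metric.ball 0 R) :=
    ((hc.smul hgc).memLp_ball R).integrable one_le_two
  have i2 : IntegrableOn (fun x => φ x • sectorGrad m k α x) (Metric.ball 0 R) :=
    memLp_one_iff_integrable.1 (hG2.smul (hφ.1.continuous.memLp_ball R))
  have z1 : ∀ x ∉ Metric.ball 0 R, sectorFun m k α x • gradient φ x = 0 := fun x hx => by
    rw [hg0 x hx, smul_zero]
  have z2 : ∀ x ∉ Metric.ball 0 R, φ x • sectorGrad m k α x = 0 := fun x hx => by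
    rw [hφ0 x hx, zero_smul]
  have j1 := (integrableOn_iff_integrable_of_support_subset
    (Function.support_subset_iff'.2 z1)).1 i1
  have j2 := (integrableOn_iff_integrable_of_support_subset
    (Function.support_subset_iff'.2 z2)).1 i2
  refine ext_inner_left ℝ fun e => ?_
  rw [inner_neg_right, ← integral_inner j1, ← integral_inner j2]
  set c : ℝ → ℝ := fun θ => Real.cos (m / 2 * (θ - α)) with hcdef
  set d : ℝ → ℝ := fun θ => -(m / 2) * Real.sin (m / 2 * (θ - α)) with hddef
  have hcd : ∀ θ, HasDerivAt c (d θ) θ := hasDerivAt_cos_half m α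
  have hcc : Continuous c := by fun_prop
  have hdc : Continuous d := by fun_prop
  have hrad : ∀ θ, HasDerivAt (fun θ => c θ * inner ℝ (angularDir θ) e)
      (d θ * inner ℝ (angularDir θ) e + c θ * inner ℝ (-radialDir θ) e) θ := fun θ => by
    have h := (hasDerivAt_angularDir θ).inner ℝ (hasDerivAt_const θ e)
    rw [inner_zero_right, zero_add] at h
    exact (hcd θ).mul h
  have hends : c (α - Real.pi / m) = 0 ∧ c (α + Real.pi / m) = 0 := by
    constructor
    · rw [hcdef]
      simp only
      rw [show (m : ℝ) / 2 * (α - Real.pi / m - α) = -(Real.pi / 2) by field_simp; ring,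
        Real.cos_neg, Real.cos_pi_div_two]
    · rw [hcdef]
      simp only
      rw [show (m : ℝ) / 2 * (α + Real.pi / m - α) = Real.pi / 2 by field_simp; ring,
        Real.cos_pi_div_two]
  have hstep := integral_sector_eq hφ1 hR
    (fun θ => hφ0 _ (by simp [norm_polarPoint, abs_of_pos hR]))
    (s := α - Real.pi / m) (t := α + Real.pi / m)
    (by have := div_pos Real.pi_pos hm0; linarith) (κ := k + 1) (by linarith)
    (a := fun θ => c θ * inner ℝ (radialDir θ) e)
    (hcc.mul (continuous_radialDir.inner continuous_const)) hrad
    ((hdc.mul (continuous_angularDir.inner continuous_const)).add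
      (hcc.mul (continuous_radialDir.neg.inner continuous_const)))
  rw [hends.1, hends.2] at hstep
  simp only [zero_mul, sub_zero, mul_zero, integral_zero, zero_sub, add_sub_cancel_right]
    at hstep
  rw [integral_eq_integral_sector (i1.const_inner e) (fun x hx => by rw [z1 x hx, inner_zero_right])
    hα hα' (g := fun r θ => r ^ (k + 1) *
      (c θ * inner ℝ (radialDir θ) e * inner ℝ (gradient φ (polarPoint r θ)) (radialDir θ) +
      c θ * inner ℝ (angularDir θ) e * inner ℝ (gradient φ (polarPoint r θ)) (angularDir θ))),
    hstep,
    integral_eq_integral_sector (i2.const_inner e) (fun x hx => by rw [z2 x hx, inner_zero_right])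
    hα hα' (g := fun r θ => r ^ k * (((k + 1) * (c θ * inner ℝ (radialDir θ) e) +
      (d θ * inner ℝ (angularDir θ) e + c θ * inner ℝ (-radialDir θ) e)) * φ (polarPoint r θ)))]
  · intro r hr θ hθ
    rw [sectorGrad_polarPoint hr.1 (Ioo_subset_Ioc_self hθ), sectorField]
    by_cases hmem : θ ∈ Ioo (α - Real.pi / m) (α + Real.pi / m)
    · rw [indicator_of_mem hmem, indicator_of_mem hmem, inner_smul_right, inner_smul_right,
        inner_add_right, inner_smul_right, inner_smul_right, inner_neg_left,
        real_inner_comm e, real_inner_comm e,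
        show r ^ k = r * r ^ (k - 1) by
          rw [← Real.rpow_one_add' hr.1.le (by linarith)]; congr 1; ring]
      simp only [hcdef, hddef]
      ring
    · rw [indicator_of_notMem hmem, indicator_of_notMem hmem, smul_zero, smul_zero,
        inner_zero_right, mul_zero]
  · intro r hr θ hθ
    rw [sectorFun_polarPoint hm hα hα' hr.1 (Ioo_subset_Icc_self hθ)]
    by_cases hmem : θ ∈ Ioo (α - Real.pi / m) (α + Real.pi / m)
    · rw [indicator_of_mem hmem, indicator_of_mem hmem, inner_smul_right,
        Real.rpow_add_one hr.1.ne']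
      conv_lhs => rw [eq_inner_smul_add_inner_smul θ (gradient φ (polarPoint r θ)),
        inner_add_right, inner_smul_right, inner_smul_right, real_inner_comm _ e,
        real_inner_comm _ e]
      simp only [hcdef]
      ring
    · rw [indicator_of_notMem hmem, indicator_of_notMem hmem, mul_zero, zero_smul,
        inner_zero_right, mul_zero]

end Sectors

/-! ### The extremal family -/

section MeyersFamily

open Filter Topology Set

/-- Meyers' matrix is `L` in the radial and `lam` in the angular direction. -/
theorem meyersMatrix_radialDir_angularDir (lam L : ℝ) {r : ℝ} (hr : 0 < r) (θ p q : ℝ) :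
    Matrix.toEuclideanLin (meyersMatrix lam L (polarPoint r θ))
        (p • radialDir θ + q • angularDir θ) =
      (L * p) • radialDir θ + (lam * q) • angularDir θ := by
  rw [toEuclideanLin_meyersMatrix, norm_polarPoint, abs_of_pos hr, polarPoint_eq_smul,
    inner_smul_left, inner_add_right, inner_smul_right, inner_smul_right, inner_radialDir_self,
    inner_radialDir_angularDir, smul_smul]
  have e : (L - lam) * ((starRingEnd ℝ) r * (p * 1 + q * 0) / r ^ 2) * r = (L - lam) * p := by
    simp only [conj_trivial]
    field_simp
    ring
  rw [e]
  module

variable {m : ℕ} {lam L α : ℝ}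

/-- If `L k² = lam (m / 2)²`, then `sectorFun` solves the equation of Meyers' matrix in its sector,
and the boundary terms on the two sides of the sector have the sign of a subsolution. -/
theorem integral_inner_sectorGrad_le (hm : 1 ≤ m) (hlam : 0 < lam) (hL : lam ≤ L) {k : ℝ}
    (hk : 0 < k) (hkL : L * k ^ 2 = lam * (m / 2) ^ 2)
    (hα : -Real.pi ≤ α - Real.pi / m) (hα' : α + Real.pi / m ≤ Real.pi)
    {φ : EuclideanSpace ℝ (Fin 2) → ℝ} (hφ : IsTestFunction φ) (hφ0 : ∀ x, 0 ≤ φ x) :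
    ∫ x, inner ℝ (Matrix.toEuclideanLin (meyersMatrix lam L x) (sectorGrad m k α x))
      (gradient φ x) ≤ 0 := by
  have hL0 : 0 < L := hlam.trans_le hL
  have hm0 : (0 : ℝ) < m := by exact_mod_cast hm
  obtain ⟨R, hR, hφR, hgR⟩ := hφ.exists_ball
  have hφ1 : ContDiff ℝ 1 φ := hφ.1.of_le (by simp)
  have hG := (hasWeakGradient_sectorFun hm hk hα hα').grad_memL2loc
  have hAG := (ellipticClass_meyersMatrix hL).memL2loc hlam.le hL0.le hG
  have hint : IntegrableOn (fun x => inner ℝ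
      (Matrix.toEuclideanLin (meyersMatrix lam L x) (sectorGrad m k α x)) (gradient φ x))
      (Metric.ball 0 R) :=
    ((hAG _ (isCompact_closedBall 0 R)).mono_measure
      (Measure.restrict_mono Metric.ball_subset_closedBall le_rfl)).integrable_inner
      (hφ1.continuous_gradient.memLp_ball R)
  set a : ℝ → ℝ := fun θ => L * (k * Real.cos (m / 2 * (θ - α))) with hadef
  set b : ℝ → ℝ := fun θ => lam * (-(m / 2) * Real.sin (m / 2 * (θ - α))) with hbdef
  set b' : ℝ → ℝ := fun θ => lam * (-(m / 2) * (m / 2 * Real.cos (m / 2 * (θ - α)))) with hb'def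
  have hab : ∀ θ, k * a θ + b' θ = 0 := fun θ => by
    simp only [hadef, hb'def]
    linear_combination Real.cos (m / 2 * (θ - α)) * hkL
  have hs : b (α - Real.pi / m) = lam * (m / 2) := by
    simp only [hbdef]
    rw [show (m : ℝ) / 2 * (α - Real.pi / m - α) = -(Real.pi / 2) by field_simp; ring,
      Real.sin_neg, Real.sin_pi_div_two]
    ring
  have ht : b (α + Real.pi / m) = -(lam * (m / 2)) := by
    simp only [hbdef]
    rw [show (m : ℝ) / 2 * (α + Real.pi / m - α) = Real.pi / 2 by field_simp; ring,
      Real.sin_pi_div_two]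
    ring
  rw [integral_eq_integral_sector hint (fun x hx => by rw [hgR x hx, inner_zero_right]) hα hα'
    (g := fun r θ => r ^ k * (a θ * inner ℝ (gradient φ (polarPoint r θ)) (radialDir θ) +
      b θ * inner ℝ (gradient φ (polarPoint r θ)) (angularDir θ))),
    integral_sector_eq hφ1 hR (fun θ => hφR _ (by simp [norm_polarPoint, abs_of_pos hR]))
      (by have := div_pos Real.pi_pos hm0; linarith) hk
      (a := a) (b := b) (b' := b') (by fun_prop)
      (fun θ => ((hasDerivAt_sin_half m α θ).const_mul _).const_mul _) (by fun_prop)]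
  · simp only [hab]
    simp only [zero_mul, mul_zero, integral_zero, sub_zero]
    refine setIntegral_nonpos measurableSet_Ioo fun r hr => ?_
    refine mul_nonpos_of_nonneg_of_nonpos (Real.rpow_nonneg hr.1.le _) ?_
    rw [hs, ht]
    have h1 := mul_nonneg (by positivity : 0 ≤ lam * (m / 2 : ℝ))
      (hφ0 (polarPoint r (α + Real.pi / m)))
    have h2 := mul_nonneg (by positivity : 0 ≤ lam * (m / 2 : ℝ))
      (hφ0 (polarPoint r (α - Real.pi / m)))
    linarith
  · intro r hr θ hθ
    rw [sectorGrad_polarPoint hr.1 (Ioo_subset_Ioc_self hθ), sectorField, map_smul]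
    by_cases hmem : θ ∈ Ioo (α - Real.pi / m) (α + Real.pi / m)
    · rw [indicator_of_mem hmem, indicator_of_mem hmem, meyersMatrix_radialDir_angularDir _ _ hr.1,
        inner_smul_left, inner_add_left, inner_smul_left, inner_smul_left,
        real_inner_comm _ (radialDir θ), real_inner_comm _ (angularDir θ),
        show r ^ k = r ^ (k - 1) * r by rw [← Real.rpow_add_one hr.1.ne', sub_add_cancel]]
      simp only [hadef, hbdef, conj_trivial]
      ring
    · rw [indicator_of_notMem hmem, indicator_of_notMem hmem, map_zero, smul_zero,
        inner_zero_left, mul_zero]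

/-- The central angle of the `i`-th of the `m` equal sectors of `(-π, π)`. -/
noncomputable def sectorCenter (m : ℕ) (i : Fin m) : ℝ :=
  -Real.pi + (2 * (i : ℝ) + 1) * (Real.pi / m)

theorem neg_pi_le_sectorCenter_sub (i : Fin m) : -Real.pi ≤ sectorCenter m i - Real.pi / m := by
  have : 0 ≤ (2 * (i : ℝ)) * (Real.pi / m) := by positivity
  rw [sectorCenter]
  linarith

theorem sectorCenter_add_le_pi (i : Fin m) : sectorCenter m i + Real.pi / m ≤ Real.pi := by
  have hm0 : (0 : ℝ) < m := by exact_mod_cast i.pos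
  have hi : (i : ℝ) + 1 ≤ m := by exact_mod_cast i.isLt
  have h := mul_le_mul_of_nonneg_right hi (by positivity : 0 ≤ 2 * (Real.pi / m))
  have e : (m : ℝ) * (2 * (Real.pi / m)) = 2 * Real.pi := by field_simp
  rw [sectorCenter]
  linarith

theorem disjoint_sectors {i j : Fin m} (hij : i < j) :
    Disjoint (Ioo (sectorCenter m i - Real.pi / m) (sectorCenter m i + Real.pi / m))
      (Ioo (sectorCenter m j - Real.pi / m) (sectorCenter m j + Real.pi / m)) := by
  have hji : (i : ℝ) + 1 ≤ (j : ℕ) := by exact_mod_cast hij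
  have h := mul_le_mul_of_nonneg_right hji (by positivity : 0 ≤ 2 * (Real.pi / m))
  rw [Set.disjoint_left]
  rintro θ ⟨-, h1⟩ ⟨h2, -⟩
  simp only [sectorCenter] at h1 h2
  linarith

theorem planarArg_mem_of_sectorFun_pos {k : ℝ} (hk : 0 < k) (i : Fin m)
    {x : EuclideanSpace ℝ (Fin 2)}
    (hx : 0 < sectorFun m k (sectorCenter m i) x) :
    planarArg x ∈ Ioo (sectorCenter m i - Real.pi / m) (sectorCenter m i + Real.pi / m) := by
  have hx0 : x ≠ 0 := by
    rintro rfl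
    rw [sectorFun_zero hk] at hx
    exact lt_irrefl _ hx
  rw [← polarPoint_norm_planarArg x, sectorFun_polarPoint i.pos (neg_pi_le_sectorCenter_sub i)
    (sectorCenter_add_le_pi i) (norm_pos_iff.2 hx0) (Ioc_subset_Icc_self (planarArg_mem x))] at hx
  by_contra h
  rw [indicator_of_notMem h, mul_zero] at hx
  exact lt_irrefl _ hx

theorem kStar_pos (hm : 1 ≤ m) (hlam : 0 < lam) (hL : lam ≤ L) : 0 < kStar m lam L := by
  have hm0 : (0 : ℝ) < m := by exact_mod_cast hm
  exact mul_pos (half_pos hm0) (Real.sqrt_pos.2 (div_pos hlam (hlam.trans_le hL)))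

theorem mul_kStar_sq (m : ℕ) (hlam : 0 < lam) (hL : lam ≤ L) :
    L * kStar m lam L ^ 2 = lam * (m / 2) ^ 2 := by
  have hL0 : 0 < L := hlam.trans_le hL
  rw [kStar, mul_pow, Real.sq_sqrt (div_nonneg hlam.le hL0.le)]
  field_simp

/-- The functions supported in `m` equal sectors form a segregated family for Meyers' matrix. -/
theorem isSegregatedFamily_sectorFun (hlam : 0 < lam) (hL : lam ≤ L) :
    IsSegregatedFamily (meyersMatrix lam L)
      fun i : Fin m => sectorFun m (kStar m lam L) (sectorCenter m i) where
  nonneg _ x := sectorFun_nonneg x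
  continuous i := continuous_sectorFun (kStar_pos i.pos hlam hL)
  subsolution i :=
    have hk := kStar_pos i.pos hlam hL
    ⟨sectorGrad m (kStar m lam L) (sectorCenter m i),
      hasWeakGradient_sectorFun i.pos hk (neg_pi_le_sectorCenter_sub i) (sectorCenter_add_le_pi i),
      fun _ hφ hφ0 => integral_inner_sectorGrad_le i.pos hlam hL hk (mul_kStar_sq m hlam hL)
        (neg_pi_le_sectorCenter_sub i) (sectorCenter_add_le_pi i) hφ hφ0⟩
  disjoint i j hij := by
    have hk := kStar_pos i.pos hlam hL
    refine Set.disjoint_left.2 ?_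
    intro x hi hj
    have h1 := planarArg_mem_of_sectorFun_pos hk i hi
    have h2 := planarArg_mem_of_sectorFun_pos hk j hj
    rcases lt_or_gt_of_ne hij with h | h
    · exact Set.disjoint_left.1 (disjoint_sectors h) h1 h2
    · exact Set.disjoint_left.1 (disjoint_sectors h) h2 h1
  zero i := sectorFun_zero (kStar_pos i.pos hlam hL)

end MeyersFamily

theorem proposition1p2 (m : ℕ) (hm : 2 ≤ m) (lam L : ℝ) (hlam : 0 < lam) (hL : lam ≤ L) :
    (∀ A : EuclideanSpace ℝ (Fin 2) → Matrix (Fin 2) (Fin 2) ℝ, EllipticClass lam L A →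
      ∀ u : Fin m → EuclideanSpace ℝ (Fin 2) → ℝ, IsSegregatedFamily A u →
      ∀ γ : ℝ, 0 < γ → γ < kStar m lam L →
      (∃ C : ℝ, 0 < C ∧ ∀ i x, u i x ≤ C * (1 + ‖x‖ ^ γ)) →
      ∃ j, ∀ x, u j x = 0) ∧
    -- sharpness: the exponent `kStar m lam L` itself is not admissible
    (EllipticClass lam L (meyersMatrix lam L) ∧
      ∃ u : Fin m → EuclideanSpace ℝ (Fin 2) → ℝ,
        IsSegregatedFamily (meyersMatrix lam L) u ∧
        (∀ i x, u i x ≤ ‖x‖ ^ kStar m lam L) ∧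
        ∀ i, ∃ x, u i x ≠ 0) := by
  refine ⟨fun A hA u hu γ hγ hγk ⟨C, hC, hgr⟩ => ?_, ellipticClass_meyersMatrix hL,
    fun i => sectorFun m (kStar m lam L) (sectorCenter m i), isSegregatedFamily_sectorFun hlam hL,
    fun i x => sectorFun_le x, fun i => ⟨radialDir (sectorCenter m i), ?_⟩⟩
  · exact hu.exists_eq_zero hm hlam hL hA hγ hγk hC hgr
  · exact sectorFun_radialDir.trans_ne one_ne_zero
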